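/- **Theorem (Insider First-Order Condition).** *Setting.* Let $a<b$, $\gamma\in(\tfrac13,\tfrac12)$ and $\delta\in(0,1]$ with $\gamma+\delta>1$. Let $C^\delta=C^\delta([a,b],\mathbb R)$ be the space of $\delta$-Hölder functions with norm $\|f\|_\infty+[f]_\delta$; its elements are the admissible portfolios and directions. Let $\Omega_\gamma$ be the set of $\gamma$-Hölder paths $\omega:[a,b]\to\mathbb R$ with $\omega(a)=0$, with the trace $\mathcal F_\gamma$ of the Borel $\sigma$-field of the sup norm. Let $\sigma^2\in C^\delta$ with $\sigma^2(x)>0$ for all $x$, and let $\mathbb P_0$ be the law on $\Omega_\gamma$ of $x\mapsto\int_a^x\sigma\,dB$ ($B$ a Brownian motion), i.e. the canonical process is a centred Gaussian process with covariance $\int_a^{x\wedge y}\sigma^2$. Let $S$ be a topological space with its Borel $\sigma$-field and a probability measure $\pi_0$; let $\eta:[a,b]\times S\to\mathbb R$ be jointly measurable with $\sup_{s}\int_a^b|\eta(x,s)|\,dx<\infty$ (for example, each $\eta(\cdot,s)$ a probability density). Let the market maker's belief $\widetilde W$ be a continuous map $s\mapsto\widetilde W(\cdot,s)$ from $S$ to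 $C^\delta$, and fix $s\in S$. For $W\in C^\delta$ and $\omega\in\Omega_\gamma$ put $$\ell(\omega,W)=\int_a^b\frac{W(x)}{\sigma^2(x)}\,d\omega_x-\frac12\int_a^b\frac{W(x)^2}{\sigma^2(x)}\,dx,$$ where the first integral is the pathwise (Young) integral, the limit of left-point Riemann sums as the mesh tends to $0$. Let $\mathbb P_W$ be given by $d\mathbb P_W=e^{\ell(\omega,W)}\,d\mathbb P_0$, let the posterior be $$\pi_1(du,\omega;\widetilde W)=\frac{e^{\ell(\omega,\widetilde W(\cdot,u))}\,\pi_0(du)}{\int_S e^{\ell(\omega,\widetilde W(\cdot,u'))}\,\pi_0(du')},$$ and let $$P(x,\omega;\widetilde W)=\int_S\eta(x,u)\,\pi_1(du,\omega;\widetilde W),\qquad \overline P(x,W;\widetilde W)=\mathbb E^{\mathbb P_W}[P(x,\omega;\widetilde W)],$$ $$J(W;\widetilde W,s)=\mathbb E^{\mathbb P_W}\Big[\int_a^b(\eta(x,s)-P(x,\omega;\widetilde W))\,W(x)\,dx\Big],\qquad \Pi_{insider}(v,u;\widetilde W)=\int_a^b\frac{\widetilde W(x,u)}{\sigma^2(x)}\,v(x)\,dx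 .$$ Write $\operatorname{Cov}(\cdot,\cdot\mid\omega;\widetilde W)$ for the covariance over the signal under $\pi_1(\cdot,\omega;\widetilde W)$. *Conclusion.* (0) These expressions are meaningful. For every $W\in C^\delta$: under $\mathbb P_W$ the canonical path has the law of $dY_x=W(x)\,dx+\sigma(x)\,dB_x$, $Y_a=0$; for $\mathbb P_W$-a.e. $\omega$ the posterior is a probability measure; and $\eta(x,s)-P(x,\omega;\widetilde W)$ is integrable over $\mathbb P_W\otimes dx$. For every $v\in C^\delta$, for $\mathbb P_W\otimes dx$-a.e. $(\omega,x)$, the functions $\eta(x,\cdot)$, $\Pi_{insider}(v,\cdot;\widetilde W)$ and their product are integrable under the posterior, and the resulting covariance is integrable over $\mathbb P_W\otimes dx$. (1) $J(\cdot\,;\widetilde W,s)$ is Gâteaux differentiable on $C^\delta$: for all $W,v\in C^\delta$ the limit $\partial J(W;\widetilde W,s)(v)=\lim_{\varepsilon\to0}\varepsilon^{-1}\big(J(W+\varepsilon v;\widetilde W,s)-J(W;\widetilde W,s)\big)$ exists, and $$\partial J(W;\widetilde W,s)(v)=\partial J_p(W)(v)-\partial J_{AD}(W)(v)-\partial J_K(W)(v),$$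 where $$\partial J_p(W)(v)=\int_a^b v(x)\,\eta(x,s)\,dx,\qquad \partial J_{AD}(W)(v)=\int_a^b\overline P(x,W;\widetilde W)\,v(x)\,dx,$$ $$\partial J_K(W)(v)=\int_a^b W(x)\,\mathbb E^{\mathbb P_W}\big[\operatorname{Cov}\big(\eta(x,\cdot),\Pi_{insider}(v,\cdot;\widetilde W)\mid\omega;\widetilde W\big)\big]\,dx .$$ (2) If $W$ maximizes $J(\cdot\,;\widetilde W,s)$ over $C^\delta$, then $\partial J(W;\widetilde W,s)(v)=0$ for all $v\in C^\delta$; equivalently, $\partial J_p(W)(v)=\partial J_{AD}(W)(v)+\partial J_K(W)(v)$ for all $v\in C^\delta$. -/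

import Mathlib

open MeasureTheory ProbabilityTheory Filter Topology
open scoped NNReal ENNReal

-- Lebesgue measure on `[a,b]`
attribute [local instance] Measure.Subtype.measureSpace

noncomputable section

namespace InsiderTrading

/-! ### The Hölder space `C^δ([a,b], ℝ)` of admissible portfolios -/

/-- The linear space of `δ`-Hölder continuous functions on `[a,b]`. -/
def holderSubmodule (a b : ℝ) (δ : ℝ≥0) : Submodule ℝ C(Set.Icc a b, ℝ) where
  carrier := {f | MemHolder δ (f : Set.Icc a b → ℝ)}
  add_mem' {f g} hf hg := by
    simpa only [Set.mem_ofPred_eq, ContinuousMap.coe_add] using MemHolder.add hf hg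
  zero_mem' := memHolder_zero
  smul_mem' c f hf := by
    simpa only [Set.mem_ofPred_eq, ContinuousMap.coe_smul] using MemHolder.smul (c := c) hf

/-- The Hölder space `C^δ([a,b], ℝ)`. It is a type of its own because it does not carry
the sup norm but the Hölder norm defined below. -/
def HolderSpace (a b : ℝ) (δ : ℝ≥0) : Type := holderSubmodule a b δ

namespace HolderSpace

variable {a b : ℝ} {δ : ℝ≥0}

instance : AddCommGroup (HolderSpace a b δ) := inferInstanceAs (AddCommGroup (holderSubmodule a b δ))

instance : Module ℝ (HolderSpace a b δ) := inferInstanceAs (Module ℝ (holderSubmodule a b δ))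

/-- The underlying continuous function. -/
def toContinuousMap (f : HolderSpace a b δ) : C(Set.Icc a b, ℝ) := f.1

instance : CoeFun (HolderSpace a b δ) (fun _ => Set.Icc a b → ℝ) := ⟨fun f => f.toContinuousMap⟩

theorem memHolder (f : HolderSpace a b δ) : MemHolder δ (f : Set.Icc a b → ℝ) := f.2

/-- The Hölder norm `‖f‖_δ = ‖f‖_∞ + [f]_δ`. -/
instance : Norm (HolderSpace a b δ) :=
  ⟨fun f => ‖f.toContinuousMap‖ + nnHolderNorm δ (f : Set.Icc a b → ℝ)⟩

theorem norm_def (f : HolderSpace a b δ) :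
    ‖f‖ = ‖f.toContinuousMap‖ + nnHolderNorm δ (f : Set.Icc a b → ℝ) := rfl

theorem normCore : NormedSpace.Core ℝ (HolderSpace a b δ) where
  norm_nonneg f := by rw [norm_def]; positivity
  norm_smul c f := by
    have h1 : (c • f).toContinuousMap = c • f.toContinuousMap := rfl
    have h2 := f.memHolder.nnHolderNorm_smul c
    rw [norm_def, norm_def, h1, norm_smul, ContinuousMap.coe_smul, h2]
    push_cast
    ring
  norm_triangle f g := by
    have h1 : (f + g).toContinuousMap = f.toContinuousMap + g.toContinuousMap := rfl
    have h2 := f.memHolder.nnHolderNorm_add_le g.memHolder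
    have h3 := norm_add_le f.toContinuousMap g.toContinuousMap
    rw [norm_def, norm_def, norm_def, h1, ContinuousMap.coe_add]
    have h4 := NNReal.coe_le_coe.mpr h2
    push_cast at h4
    linarith
  norm_eq_zero_iff f := by
    constructor
    · intro h
      rw [norm_def] at h
      have h1 : ‖f.toContinuousMap‖ = 0 :=
        le_antisymm (by linarith [NNReal.coe_nonneg (nnHolderNorm δ (f : Set.Icc a b → ℝ))])
          (norm_nonneg _)
      exact Subtype.ext (norm_eq_zero.mp h1)
    · rintro rfl
      have h1 : (0 : HolderSpace a b δ).toContinuousMap = 0 := rfl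
      rw [norm_def, h1, norm_zero, ContinuousMap.coe_zero, nnHolderNorm_zero]
      simp

instance : NormedAddCommGroup (HolderSpace a b δ) := NormedAddCommGroup.ofCore normCore

instance : NormedSpace ℝ (HolderSpace a b δ) := NormedSpace.ofCore normCore

end HolderSpace

/-! ### Order-flow paths -/

/-- The space `Ω_γ` of cumulative order-flow paths: the `γ`-Hölder paths on `[a,b]` that
start at `0`. -/
def OrderPath (a b : ℝ) (γ : ℝ≥0) : Type :=
  {ω : C(Set.Icc a b, ℝ) // (∀ x : Set.Icc a b, (x : ℝ) = a → ω x = 0) ∧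
    MemHolder γ (ω : Set.Icc a b → ℝ)}

instance {a b : ℝ} {γ : ℝ≥0} : CoeFun (OrderPath a b γ) (fun _ => Set.Icc a b → ℝ) :=
  ⟨fun ω => ω.1⟩

/-- The σ-field `F_γ`: the trace on `Ω_γ` of the Borel σ-field of the sup norm. -/
instance {a b : ℝ} {γ : ℝ≥0} : MeasurableSpace (OrderPath a b γ) :=
  (borel C(Set.Icc a b, ℝ)).comap Subtype.val

/-- `P` is the law of the order flow `dY_x = W(x) dx + σ(x) dB_x`, `Y_a = 0`, where `B` is a
standard Brownian motion: under `P` the canonical process is Gaussian with mean `∫_a^x W` and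
covariance `∫_a^{x ∧ y} σ²`. -/
structure IsOrderFlowLaw {a b : ℝ} {γ : ℝ≥0} (σ W : Set.Icc a b → ℝ)
    (P : Measure (OrderPath a b γ)) : Prop where
  isProbabilityMeasure : IsProbabilityMeasure P
  isGaussianProcess : IsGaussianProcess (fun (x : Set.Icc a b) (ω : OrderPath a b γ) => ω x) P
  mean : ∀ x : Set.Icc a b, ∫ ω : OrderPath a b γ, ω x ∂P = ∫ z in Set.Iic x, W z
  cov : ∀ x y : Set.Icc a b,
    covariance (fun ω : OrderPath a b γ => ω x) (fun ω : OrderPath a b γ => ω y) P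
      = ∫ z in Set.Iic (min x y), σ z ^ 2

/-! ### The pathwise (Young) integral -/

/-- Partitions `a = x_0 ≤ x_1 ≤ ⋯ ≤ x_n = b`. -/
structure Subdivision (a b : ℝ) where
  n : ℕ
  pt : Fin (n + 1) → Set.Icc a b
  mono : Monotone pt
  first : (pt 0 : ℝ) = a
  last : (pt (Fin.last n) : ℝ) = b

/-- The mesh `max_k (x_{k+1} - x_k)`. -/
def Subdivision.mesh {a b : ℝ} (p : Subdivision a b) : ℝ :=
  ⨆ k : Fin p.n, ((p.pt k.succ : ℝ) - p.pt k.castSucc)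

/-- The left-point Riemann sum `∑_k f(x_k) (ω(x_{k+1}) - ω(x_k))`. -/
def Subdivision.riemannSum {a b : ℝ} (f ω : Set.Icc a b → ℝ) (p : Subdivision a b) : ℝ :=
  ∑ k : Fin p.n, f (p.pt k.castSucc) * (ω (p.pt k.succ) - ω (p.pt k.castSucc))

/-- The Young integral `∫_a^b f dω`: the limit of the Riemann sums as the mesh tends to `0`. -/
def youngIntegral {a b : ℝ} (f ω : Set.Icc a b → ℝ) : ℝ :=
  limUnder (comap Subdivision.mesh (𝓝 (0 : ℝ))) (Subdivision.riemannSum f ω)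

/-! ### The trading game -/

section Game

variable {a b : ℝ} {γ δ : ℝ≥0} {S : Type*} [MeasurableSpace S]

/-- The log-likelihood `∫ (W/σ²) dω - ½ ∫ (W²/σ²) dx` of the order flow `ω` under the
portfolio `W`, relative to pure noise. -/
def logLikelihood (σ : Set.Icc a b → ℝ) (W : HolderSpace a b δ) (ω : OrderPath a b γ) : ℝ :=
  youngIntegral (fun x => W x / σ x ^ 2) ω - (1 / 2) * ∫ x, W x ^ 2 / σ x ^ 2

/-- The law `P_W` of the order flow induced by the portfolio `W`, through its density with
respect to the noise law `P₀`. -/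
def flowLaw (σ : Set.Icc a b → ℝ) (P₀ : Measure (OrderPath a b γ)) (W : HolderSpace a b δ) :
    Measure (OrderPath a b γ) :=
  P₀.withDensity fun ω => ENNReal.ofReal (Real.exp (logLikelihood σ W ω))

/-- The market maker's posterior `π₁(ds, ω; W')` on signals given the order flow `ω`, under the
belief `W'`: by Bayes' rule, the prior reweighted by the likelihood and normalized. -/
def signalPosterior (σ : Set.Icc a b → ℝ) (π₀ : Measure S) (W' : S → HolderSpace a b δ)
    (ω : OrderPath a b γ) : Measure S :=
  π₀.tilted fun s => logLikelihood σ (W' s) ω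

/-- The price `P(x, ω; W') = ∫ η(x,s) π₁(ds, ω; W')` of the security `x`. -/
def price (σ : Set.Icc a b → ℝ) (π₀ : Measure S) (η : Set.Icc a b → S → ℝ)
    (W' : S → HolderSpace a b δ) (x : Set.Icc a b) (ω : OrderPath a b γ) : ℝ :=
  ∫ s, η x s ∂(signalPosterior σ π₀ W' ω)

/-- The expected price `P̄(x, W; W') = E^{P_W}[P(x, ω; W')]`. -/
def expectedPrice (σ : Set.Icc a b → ℝ) (P₀ : Measure (OrderPath a b γ)) (π₀ : Measure S)
    (η : Set.Icc a b → S → ℝ) (W' : S → HolderSpace a b δ) (x : Set.Icc a b)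
    (W : HolderSpace a b δ) : ℝ :=
  ∫ ω, price σ π₀ η W' x ω ∂(flowLaw σ P₀ W)

/-- The insider's expected profit
`J(W; W', s) = E^{P_W}[∫ (η(x,s) - P(x, ω; W')) W(x) dx]`. -/
def expectedProfit (σ : Set.Icc a b → ℝ) (P₀ : Measure (OrderPath a b γ)) (π₀ : Measure S)
    (η : Set.Icc a b → S → ℝ) (W' : S → HolderSpace a b δ) (s : S) (W : HolderSpace a b δ) : ℝ :=
  ∫ ω, (∫ x, (η x s - price σ π₀ η W' x ω) * W x) ∂(flowLaw σ P₀ W)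

/-- The insider's projection coefficient `Π_insider(v, s; W') = ∫ W'(x,s) / σ²(x) · v(x) dx`. -/
def insiderProjection (σ : Set.Icc a b → ℝ) (W' : S → HolderSpace a b δ)
    (v : HolderSpace a b δ) (s : S) : ℝ :=
  ∫ x, W' s x / σ x ^ 2 * v x

/-- The conditional covariance `Cov(η(x,·), Π_insider(v,·; W') | ω; W')`, taken under the
market maker's posterior given `ω`. -/
def priceImpact (σ : Set.Icc a b → ℝ) (π₀ : Measure S) (η : Set.Icc a b → S → ℝ)
    (W' : S → HolderSpace a b δ) (v : HolderSpace a b δ) (x : Set.Icc a b)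
    (ω : OrderPath a b γ) : ℝ :=
  covariance (η x) (insiderProjection σ W' v) (signalPosterior σ π₀ W' ω)

/-- The marginal payoff `∂J_p(W)(v) = ∫ v(x) η(x,s) dx`. -/
def payoffTerm (η : Set.Icc a b → S → ℝ) (s : S) (v : HolderSpace a b δ) : ℝ :=
  ∫ x, v x * η x s

/-- The Arrow–Debreu cost term `∂J_AD(W)(v) = ∫ P̄(x, W; W') v(x) dx`. -/
def arrowDebreuTerm (σ : Set.Icc a b → ℝ) (P₀ : Measure (OrderPath a b γ)) (π₀ : Measure S)
    (η : Set.Icc a b → S → ℝ) (W' : S → HolderSpace a b δ) (W v : HolderSpace a b δ) : ℝ :=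
  ∫ x, expectedPrice σ P₀ π₀ η W' x W * v x

/-- The price-impact term
`∂J_K(W)(v) = ∫ W(x) E^{P_W}[Cov(η(x,·), Π_insider(v,·; W') | ω; W')] dx`. -/
def priceImpactTerm (σ : Set.Icc a b → ℝ) (P₀ : Measure (OrderPath a b γ)) (π₀ : Measure S)
    (η : Set.Icc a b → S → ℝ) (W' : S → HolderSpace a b δ) (W v : HolderSpace a b δ) : ℝ :=
  ∫ x, W x * ∫ ω, priceImpact σ π₀ η W' v x ω ∂(flowLaw σ P₀ W)

end Game

end InsiderTrading

end

open InsiderTrading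

/-!
The perturbed portfolio `W + t v` moves the expected profit in two ways: through the integrand and
through the law of the order flow, from which the market maker updates. The second effect is made
explicit by a Cameron–Martin shift.

* Under `P_W = e^{ℓ(·,W)} P₀` the canonical path is Gaussian with mean `∫_a^x W`
  (`IsNoiseModel.isOrderFlowLaw_flowLaw`, by computing moment generating functions of finite linear
  combinations of evaluations). Gaussian path laws are determined by mean and covariance, so
  `P_{W + t v}` is the image of `P_W` under the shift `ω ↦ ω + t ∫_a^· v`
  (`IsNoiseModel.flowLaw_add`). The Young integral against the shift is a Lebesgue integral, hence
  `ℓ(ω + t ∫ v, W'_u) = ℓ(ω, W'_u) + t ⟨W'_u, v⟩` with `⟨W, V⟩ = ∫ W V / σ²`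
  (`IsNoiseModel.logLikelihood_shift`).
* Consequently, seen from the fixed law `P_W`, trading `t v` in addition to `W` tilts the posterior
  exponentially along `u ↦ ⟨W'_u, v⟩`. The derivative of the posterior mean of a bounded function
  `G` along such a tilting is the posterior covariance of `G` and `⟨W'_·, v⟩`
  (`hasDerivAt_integral_tilted`).
* By Fubini's theorem `J(V) = G_V(s) - E^{P_V}[∫ G_V dπ₁]`, where `G_V(u) = ∫ η(x,u) V(x) dx` is a
  bounded function of the signal which is linear in `V` (`IsNoiseModel.expectedProfit_eq`). The
  product rule for `V = W + t v` gives the three terms of the derivative.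

Differentiation under `E^{P_W}` needs a bound on the posterior means of `|⟨W'_u, v⟩|`, for all small
`t`, that is integrable over the order flow (`IsNoiseModel.exists_integrable_bound`), although the
belief `u ↦ W'_u` may be unbounded without any moments under the prior. Such a posterior mean is a
quotient of two integrals of exponentials. The quotient is split by the inequality between the
arithmetic and the geometric mean with a path-dependent weight (`integral_abs_tilted_le`): the
numerator times the weight is integrable by completing the square, and the inverse of the
denominator is estimated by a negative exponential moment over a set of signals on which `W'` is
bounded. The signal space need not be separable: the joint measurability of the likelihood comes
from Riemann sums.
-/

namespace InsiderTrading

/-! ### The Young integral: existence of the limit of the Riemann sums -/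

section Young

variable {a b : ℝ}

/-- The Young–Loève estimate for the Riemann sums over consecutive points `x i ≤ ⋯ ≤ x j`. The
points are split at the midpoint of `[x i, x j]`; the two halves are handled by induction, and since
the exponent `θ` exceeds `1`, the constant reproduces itself. -/
theorem abs_sum_sub_le_rpow {f ω : Set.Icc a b → ℝ} {θ K : ℝ} (hθ : 1 < θ)
    (hK : 0 ≤ K) (hfω : ∀ s t u v : Set.Icc a b, ∀ d : ℝ, |(s : ℝ) - t| ≤ d → |(u : ℝ) - v| ≤ d →
      |(f s - f t) * (ω u - ω v)| ≤ K * d ^ θ)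
    {x : ℕ → Set.Icc a b} (hx : Monotone x) (n : ℕ) : ∀ i j : ℕ, i ≤ j → j ≤ i + n →
    |∑ k ∈ Finset.Ico i j, f (x k) * (ω (x (k + 1)) - ω (x k)) - f (x i) * (ω (x j) - ω (x i))|
      ≤ 2 * K / (1 - 2 ^ (1 - θ)) * ((x j : ℝ) - x i) ^ θ := by
  have h2 : (2 : ℝ) ^ (1 - θ) < 1 :=
    Real.rpow_lt_one_of_one_lt_of_neg (by norm_num) (by linarith)
  set C := 2 * K / (1 - 2 ^ (1 - θ)) with hC
  have hC0 : 0 ≤ C := div_nonneg (by linarith) (by linarith)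
  have hCeq : 2 * K + C * 2 ^ (1 - θ) = C := by
    have : C * (1 - 2 ^ (1 - θ)) = 2 * K := div_mul_cancel₀ _ (by linarith)
    linarith
  induction n with
  | zero =>
    intro i j hij hj
    obtain rfl : i = j := by omega
    rw [Finset.Ico_self, Finset.sum_empty, sub_self, sub_self, mul_zero, sub_zero, abs_zero]
    rw [Real.zero_rpow (by linarith)]; simp
  | succ n ih =>
    intro i j hij hj
    have hxij : (x i : ℝ) ≤ x j := hx hij
    rcases hij.eq_or_lt with rfl | hlt
    · rw [Finset.Ico_self, Finset.sum_empty, sub_self, sub_self, mul_zero, sub_zero, abs_zero]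
      rw [Real.zero_rpow (by linarith)]; simp
    set D := (x j : ℝ) - x i with hD
    have hD0 : 0 ≤ D := by linarith
    -- the interval of the partition that contains the midpoint
    obtain ⟨k, hik, hkj, hk1, hk2⟩ : ∃ k, i ≤ k ∧ k < j ∧ (x k : ℝ) ≤ x i + D / 2 ∧
        (x i : ℝ) + D / 2 ≤ x (k + 1) := by
      by_contra! H
      have : ∀ m, i + m ≤ j → (x (i + m) : ℝ) ≤ x i + D / 2 := by
        intro m
        induction m with
        | zero => intro _; simp; linarith
        | succ m ihm =>
          intro hm
          exact (H (i + m) (by omega) (by omega) (ihm (by omega))).le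
      have h1 := this (j - 1 - i) (by omega)
      have h3 := H (i + (j - 1 - i)) (by omega) (by omega) h1
      rw [show i + (j - 1 - i) + 1 = j by omega] at h3
      linarith
    have hki : (x i : ℝ) ≤ x k := hx hik
    have hkj' : (x (k + 1) : ℝ) ≤ x j := hx (Nat.succ_le_of_lt hkj)
    have hkk : (x k : ℝ) ≤ x (k + 1) := hx (Nat.le_succ k)
    have e1 := ih i k hik (by omega)
    have e2 := ih (k + 1) j hkj (by omega)
    have e3 : |(f (x k) - f (x i)) * (ω (x (k + 1)) - ω (x k))| ≤ K * D ^ θ := by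
      apply hfω <;> rw [abs_of_nonneg] <;> linarith
    have e4 : |(f (x (k + 1)) - f (x i)) * (ω (x j) - ω (x (k + 1)))| ≤ K * D ^ θ := by
      apply hfω <;> rw [abs_of_nonneg] <;> linarith
    have hhalf : ∀ d, 0 ≤ d → d ≤ D / 2 → C * d ^ θ ≤ C * (D ^ θ * 2 ^ (-θ)) := by
      intro d hd hdD
      gcongr
      calc d ^ θ ≤ (D / 2) ^ θ := Real.rpow_le_rpow hd hdD (by linarith)
        _ = D ^ θ * 2 ^ (-θ) := by
          rw [Real.div_rpow hD0 (by norm_num), Real.rpow_neg (by norm_num), div_eq_mul_inv]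
    have e1' := e1.trans (hhalf _ (by linarith) (by linarith))
    have e2' := e2.trans (hhalf _ (by linarith) (by linarith))
    have hsplit : ∑ l ∈ Finset.Ico i j, f (x l) * (ω (x (l + 1)) - ω (x l))
        = ∑ l ∈ Finset.Ico i k, f (x l) * (ω (x (l + 1)) - ω (x l))
          + f (x k) * (ω (x (k + 1)) - ω (x k))
          + ∑ l ∈ Finset.Ico (k + 1) j, f (x l) * (ω (x (l + 1)) - ω (x l)) := by
      rw [← Finset.sum_Ico_succ_top hik, Finset.sum_Ico_consecutive _ (by omega) (by omega)]
    have h22 : (2 : ℝ) ^ (1 - θ) = 2 * 2 ^ (-θ) := by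
      rw [sub_eq_add_neg, Real.rpow_add (by norm_num), Real.rpow_one]
    have hfinal : C * D ^ θ = 2 * K * D ^ θ + 2 * (C * (D ^ θ * 2 ^ (-θ))) := by
      nth_rewrite 1 [← hCeq]
      rw [h22]; ring
    rw [hsplit, hfinal]
    clear ih e1 e2 hfω hhalf
    rw [abs_le] at *
    constructor <;> linarith [e1'.1, e1'.2, e2'.1, e2'.2, e3.1, e3.2, e4.1, e4.2]

theorem Subdivision.mesh_nonneg (p : Subdivision a b) : 0 ≤ p.mesh :=
  Real.iSup_nonneg fun _ => sub_nonneg.2 (p.mono (Fin.castSucc_lt_succ).le)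

theorem Subdivision.sub_le_mesh (p : Subdivision a b) (k : Fin p.n) :
    (p.pt k.succ : ℝ) - p.pt k.castSucc ≤ p.mesh :=
  le_ciSup (f := fun k : Fin p.n => (p.pt k.succ : ℝ) - p.pt k.castSucc)
    (Set.finite_range _).bddAbove k

theorem Subdivision.sum_sub (hab : a ≤ b) (p : Subdivision a b) (g : Set.Icc a b → ℝ) :
    ∑ k : Fin p.n, (g (p.pt k.succ) - g (p.pt k.castSucc))
      = g ⟨b, Set.right_mem_Icc.2 hab⟩ - g ⟨a, Set.left_mem_Icc.2 hab⟩ := by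
  have h0 : p.pt 0 = ⟨a, Set.left_mem_Icc.2 hab⟩ := Subtype.ext p.first
  have hl : p.pt (Fin.last p.n) = ⟨b, Set.right_mem_Icc.2 hab⟩ := Subtype.ext p.last
  rw [← h0, ← hl, Finset.sum_sub_distrib]
  have e1 := Fin.sum_univ_succ (fun i => g (p.pt i))
  have e2 := Fin.sum_univ_castSucc (fun i => g (p.pt i))
  linarith

theorem rpow_eq_rpow_sub_one_mul {d θ : ℝ} (hd : 0 ≤ d) (hθ : 1 < θ) :
    d ^ θ = d ^ (θ - 1) * d := by
  nth_rewrite 3 [← Real.rpow_one d]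
  rw [← Real.rpow_add_of_nonneg hd (by linarith) (by norm_num)]; simp

/-- If `Y` is a primitive of `f dω` up to errors `C |t - s| ^ θ + e` with `θ > 1`, then every
Riemann sum is close to the increment of `Y`. -/
theorem Subdivision.abs_riemannSum_sub_le (hab : a ≤ b) {f ω Y : Set.Icc a b → ℝ} {θ C e : ℝ}
    (hθ : 1 < θ) (hC : 0 ≤ C)
    (hY : ∀ s t : Set.Icc a b, s ≤ t →
      |Y t - Y s - f s * (ω t - ω s)| ≤ C * ((t : ℝ) - s) ^ θ + e) (p : Subdivision a b) :
    |p.riemannSum f ω - (Y ⟨b, Set.right_mem_Icc.2 hab⟩ - Y ⟨a, Set.left_mem_Icc.2 hab⟩)|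
      ≤ C * (b - a) * p.mesh ^ (θ - 1) + p.n * e := by
  rw [← p.sum_sub hab Y, Subdivision.riemannSum, ← Finset.sum_sub_distrib]
  calc _ ≤ ∑ k : Fin p.n, |f (p.pt k.castSucc) * (ω (p.pt k.succ) - ω (p.pt k.castSucc))
          - (Y (p.pt k.succ) - Y (p.pt k.castSucc))| := Finset.abs_sum_le_sum_abs _ _
    _ ≤ ∑ k : Fin p.n, (C * p.mesh ^ (θ - 1) * ((p.pt k.succ : ℝ) - p.pt k.castSucc) + e) := by
        refine Finset.sum_le_sum fun k _ => ?_
        have hk : p.pt k.castSucc ≤ p.pt k.succ := p.mono (Fin.castSucc_lt_succ).le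
        have hk' : (p.pt k.castSucc : ℝ) ≤ p.pt k.succ := hk
        rw [abs_sub_comm]
        refine (hY _ _ hk).trans ?_
        rw [mul_assoc]
        gcongr
        have hd0 : 0 ≤ (p.pt k.succ : ℝ) - p.pt k.castSucc := by linarith
        rw [rpow_eq_rpow_sub_one_mul hd0 hθ]
        exact mul_le_mul_of_nonneg_right
          (Real.rpow_le_rpow hd0 (p.sub_le_mesh k) (by linarith)) hd0
    _ = _ := by
        rw [Finset.sum_add_distrib, ← Finset.mul_sum, p.sum_sub hab (fun x => (x : ℝ))]
        simp; ring

/-- The partition of `[a,b]` into `n + 1` intervals of equal length. -/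
noncomputable def uniformSubdivision (hab : a ≤ b) (n : ℕ) : Subdivision a b where
  n := n + 1
  pt k := ⟨a + k * ((b - a) / (n + 1)), by
    have h1 : (0 : ℝ) ≤ (b - a) / (n + 1) := div_nonneg (by linarith) (by positivity)
    have h2 : (k : ℝ) ≤ n + 1 := by exact_mod_cast Nat.lt_succ_iff.1 k.2
    refine ⟨by nlinarith [show (0 : ℝ) ≤ k by positivity], ?_⟩
    have h3 : ((n : ℝ) + 1) * ((b - a) / (n + 1)) = b - a := by field_simp
    nlinarith⟩
  mono i j hij := by
    have h1 : (0 : ℝ) ≤ (b - a) / (n + 1) := div_nonneg (by linarith) (by positivity)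
    have : ((i : ℕ) : ℝ) ≤ (j : ℕ) := by exact_mod_cast hij
    exact Subtype.mk_le_mk.2 (by gcongr)
  first := by simp
  last := by
    have h3 : ((n : ℝ) + 1) * ((b - a) / (n + 1)) = b - a := by field_simp
    simp [h3]

theorem uniformSubdivision_sub (hab : a ≤ b) (n : ℕ) (k : Fin (uniformSubdivision hab n).n) :
    ((uniformSubdivision hab n).pt k.succ : ℝ) - (uniformSubdivision hab n).pt k.castSucc
      = (b - a) / (n + 1) := by
  have h1 : ((k.succ : Fin _) : ℕ) = k + 1 := Fin.val_succ k
  have h2 : ((k.castSucc : Fin _) : ℕ) = k := Fin.val_castSucc k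
  change a + ((k.succ : Fin _) : ℕ) * ((b - a) / ((n : ℝ) + 1))
    - (a + ((k.castSucc : Fin _) : ℕ) * ((b - a) / ((n : ℝ) + 1))) = _
  rw [h1, h2]
  push_cast
  ring

theorem mesh_uniformSubdivision (hab : a ≤ b) (n : ℕ) :
    (uniformSubdivision hab n).mesh = (b - a) / (n + 1) := by
  have : Nonempty (Fin (uniformSubdivision hab n).n) := ⟨⟨0, Nat.succ_pos n⟩⟩
  simp only [Subdivision.mesh, uniformSubdivision_sub, ciSup_const]

theorem tendsto_uniformSubdivision (hab : a ≤ b) :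
    Tendsto (uniformSubdivision hab) atTop (comap Subdivision.mesh (𝓝 (0 : ℝ))) := by
  rw [tendsto_comap_iff]
  have : Tendsto (fun n : ℕ => (b - a) / ((n : ℝ) + 1)) atTop (𝓝 0) :=
    tendsto_const_nhds.div_atTop (tendsto_natCast_atTop_atTop.atTop_add tendsto_const_nhds)
  refine this.congr fun n => ?_
  rw [Function.comp_apply, mesh_uniformSubdivision]

theorem neBot_comap_mesh (hab : a ≤ b) :
    (comap (Subdivision.mesh (a := a) (b := b)) (𝓝 (0 : ℝ))).NeBot :=
  (tendsto_uniformSubdivision hab).neBot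

theorem tendsto_mesh_rpow {θ : ℝ} (hθ : 1 < θ) (c : ℝ) :
    Tendsto (fun p : Subdivision a b => c * p.mesh ^ (θ - 1))
      (comap Subdivision.mesh (𝓝 (0 : ℝ))) (𝓝 0) := by
  have h : Tendsto (fun x : ℝ => c * x ^ (θ - 1)) (𝓝 0) (𝓝 0) := by
    have := ((Real.continuousAt_rpow_const 0 (θ - 1) (Or.inr (by linarith))).tendsto).const_mul c
    rwa [Real.zero_rpow (by linarith), mul_zero] at this
  exact h.comp tendsto_comap

/-- A primitive of `f dω` up to an error of order larger than one computes the limit of the Riemann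
sums. -/
theorem tendsto_riemannSum_of_primitive (hab : a ≤ b) {f ω Y : Set.Icc a b → ℝ} {θ C : ℝ}
    (hθ : 1 < θ) (hC : 0 ≤ C)
    (hY : ∀ s t : Set.Icc a b, s ≤ t → |Y t - Y s - f s * (ω t - ω s)| ≤ C * ((t : ℝ) - s) ^ θ) :
    Tendsto (Subdivision.riemannSum f ω) (comap Subdivision.mesh (𝓝 (0 : ℝ)))
      (𝓝 (Y ⟨b, Set.right_mem_Icc.2 hab⟩ - Y ⟨a, Set.left_mem_Icc.2 hab⟩)) := by
  rw [tendsto_iff_dist_tendsto_zero]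
  refine squeeze_zero (fun _ => dist_nonneg) (fun p => ?_) (tendsto_mesh_rpow hθ (C * (b - a)))
  have := p.abs_riemannSum_sub_le hab (f := f) (ω := ω) (Y := Y) (e := 0) hθ hC
    (fun s t h => by simpa using hY s t h)
  rwa [mul_zero, add_zero, ← Real.dist_eq] at this

/-- The Riemann sum of `f dω` over the part of the partition in `[a, t]`; as a function of `t`
it is an approximate primitive of `f dω`. -/
noncomputable def Subdivision.partialSum (f ω : Set.Icc a b → ℝ) (p : Subdivision a b)
    (t : Set.Icc a b) : ℝ :=
  ∑ k : Fin p.n, f (p.pt k.castSucc) * (ω (min (p.pt k.succ) t) - ω (min (p.pt k.castSucc) t))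

theorem Subdivision.abs_partialSum_sub_le {f ω : Set.Icc a b → ℝ} {θ K : ℝ} (hθ : 1 < θ)
    (hK : 0 ≤ K) (hfω : ∀ s t u v : Set.Icc a b, ∀ d : ℝ, |(s : ℝ) - t| ≤ d → |(u : ℝ) - v| ≤ d →
      |(f s - f t) * (ω u - ω v)| ≤ K * d ^ θ)
    (p : Subdivision a b) {s t : Set.Icc a b} (hst : s ≤ t) :
    |p.partialSum f ω t - p.partialSum f ω s - f s * (ω t - ω s)|
      ≤ 2 * K / (1 - 2 ^ (1 - θ)) * ((t : ℝ) - s) ^ θ + p.n * (K * p.mesh ^ θ) := by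
  -- the points of the partition, clamped to `[s, t]`
  let x : ℕ → Set.Icc a b := fun k =>
    max s (min (p.pt ⟨min k p.n, Nat.lt_succ_of_le (min_le_right _ _)⟩) t)
  have hxk : ∀ k : Fin (p.n + 1), x k = max s (min (p.pt k) t) := by
    intro k
    have : (⟨min k p.n, Nat.lt_succ_of_le (min_le_right _ _)⟩ : Fin (p.n + 1)) = k :=
      Fin.ext (min_eq_left (Nat.lt_succ_iff.1 k.2))
    simp only [x, this]
  have hmono : Monotone x := fun i j hij =>
    max_le_max le_rfl (min_le_min (p.mono (Fin.mk_le_mk.2 (min_le_min hij le_rfl))) le_rfl)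
  have hx0 : x 0 = s := by
    have := hxk 0
    rw [Fin.val_zero] at this
    rw [this, max_eq_left]
    refine (min_le_left _ _).trans (Subtype.coe_le_coe.1 ?_)
    rw [p.first]; exact s.2.1
  have hxn : x p.n = t := by
    have := hxk (Fin.last _)
    rw [Fin.val_last] at this
    have ht : t ≤ p.pt (Fin.last p.n) := by
      refine Subtype.coe_le_coe.1 ?_
      rw [p.last]; exact t.2.2
    rw [this, min_eq_right ht, max_eq_right hst]
  have hclamp : ∀ y : Set.Icc a b, ω (min y t) - ω (min y s) = ω (max s (min y t)) - ω s := by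
    intro y
    rcases le_total y s with h | h
    · rw [min_eq_left h, min_eq_left (h.trans hst), max_eq_left h]; simp
    · rw [min_eq_right h, max_eq_right (le_min h hst)]
  have hdiff : p.partialSum f ω t - p.partialSum f ω s
      = ∑ k : Fin p.n, f (p.pt k.castSucc) * (ω (x (k + 1)) - ω (x k)) := by
    simp only [Subdivision.partialSum]
    rw [← Finset.sum_sub_distrib]
    refine Finset.sum_congr rfl fun k _ => ?_
    have h1 := hclamp (p.pt k.succ)
    have h2 := hclamp (p.pt k.castSucc)
    have h3 := hxk k.succ
    have h4 := hxk k.castSucc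
    rw [Fin.val_succ] at h3
    rw [Fin.val_castSucc] at h4
    rw [h3, h4]
    linear_combination f (p.pt k.castSucc) * (h1 - h2)
  have hY := abs_sum_sub_le_rpow hθ hK hfω hmono p.n 0 p.n (Nat.zero_le _) (by simp)
  rw [hx0, hxn, ← Finset.range_eq_Ico, ← Fin.sum_univ_eq_sum_range
    (fun k => f (x k) * (ω (x (k + 1)) - ω (x k)))] at hY
  -- only the interval that contains `s` contributes to the difference
  have hterm : ∀ k : Fin p.n, |f (p.pt k.castSucc) * (ω (x (k + 1)) - ω (x k))
      - f (x k) * (ω (x (k + 1)) - ω (x k))| ≤ K * p.mesh ^ θ := by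
    intro k
    have h3 := hxk k.succ
    have h4 := hxk k.castSucc
    rw [Fin.val_succ] at h3
    rw [Fin.val_castSucc] at h4
    have hm := p.sub_le_mesh k
    have hk' : p.pt k.castSucc ≤ p.pt k.succ := p.mono (Fin.castSucc_lt_succ).le
    have hpos : 0 ≤ K * p.mesh ^ θ := mul_nonneg hK (Real.rpow_nonneg p.mesh_nonneg _)
    rw [h3, h4, ← sub_mul]
    have hinc : |((max s (min (p.pt k.succ) t) : Set.Icc a b) : ℝ)
        - (max s (min (p.pt k.castSucc) t) : Set.Icc a b)| ≤ p.mesh := by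
      have hk'' : (p.pt k.castSucc : ℝ) ≤ p.pt k.succ := hk'
      refine le_trans ?_ hm
      rw [← abs_of_nonneg (sub_nonneg.2 hk'')]
      have e1 : ∀ y : Set.Icc a b,
          ((max s (min y t) : Set.Icc a b) : ℝ) = max (s : ℝ) (min (y : ℝ) t) := by
        intro y
        rw [(show Monotone (fun z : Set.Icc a b => (z : ℝ)) from fun _ _ h => h).map_max,
          (show Monotone (fun z : Set.Icc a b => (z : ℝ)) from fun _ _ h => h).map_min]
      rw [e1, e1]
      have e2 := abs_max_sub_max_le_max (s : ℝ) (min (p.pt k.succ : ℝ) t) s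
        (min (p.pt k.castSucc : ℝ) t)
      have e3 := abs_min_sub_min_le_max (p.pt k.succ : ℝ) t (p.pt k.castSucc) t
      rw [sub_self, abs_zero, max_eq_right (a := (0 : ℝ)) (abs_nonneg _)] at e2
      rw [sub_self, abs_zero, max_eq_left (b := (0 : ℝ)) (abs_nonneg _)] at e3
      exact e2.trans e3
    rcases le_total s (p.pt k.castSucc) with hs | hs
    · rcases le_total (p.pt k.castSucc) t with ht | ht
      · rw [min_eq_left ht, max_eq_right hs]; simpa using hpos
      · rw [min_eq_right ht, min_eq_right (ht.trans hk')]; simpa using hpos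
    · rcases le_total (p.pt k.succ) s with hs' | hs'
      · rw [min_eq_left (hs'.trans hst), min_eq_left (hs.trans hst), max_eq_left hs',
          max_eq_left hs]
        simpa using hpos
      · refine hfω _ _ _ _ _ ?_ hinc
        rw [min_eq_left (hs.trans hst), max_eq_left hs, abs_sub_comm, abs_of_nonneg
          (sub_nonneg.2 (show (p.pt k.castSucc : ℝ) ≤ s from hs))]
        have : (s : ℝ) ≤ p.pt k.succ := hs'
        linarith
  have hsum : |∑ k : Fin p.n, f (p.pt k.castSucc) * (ω (x (k + 1)) - ω (x k))
      - ∑ k : Fin p.n, f (x k) * (ω (x (k + 1)) - ω (x k))| ≤ p.n * (K * p.mesh ^ θ) := by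
    rw [← Finset.sum_sub_distrib]
    refine (Finset.abs_sum_le_sum_abs _ _).trans ((Finset.sum_le_sum fun k _ => hterm k).trans ?_)
    simp
  rw [hdiff]
  clear hfω hterm
  rw [abs_le] at *
  constructor <;> linarith [hsum.1, hsum.2, hY.1, hY.2]

/-- Young's theorem: the Riemann sums converge as the mesh tends to `0`, provided that the product
of an increment of `f` and one of `ω` over lengths at most `d` is `O(d ^ θ)` with `θ > 1`. -/
theorem exists_tendsto_riemannSum (hab : a ≤ b) {f ω : Set.Icc a b → ℝ} {θ K : ℝ} (hθ : 1 < θ)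
    (hK : 0 ≤ K) (hfω : ∀ s t u v : Set.Icc a b, ∀ d : ℝ, |(s : ℝ) - t| ≤ d → |(u : ℝ) - v| ≤ d →
      |(f s - f t) * (ω u - ω v)| ≤ K * d ^ θ) :
    ∃ L, Tendsto (Subdivision.riemannSum f ω) (comap Subdivision.mesh (𝓝 (0 : ℝ))) (𝓝 L) := by
  set C := 2 * K / (1 - 2 ^ (1 - θ)) with hC
  have h2 : (2 : ℝ) ^ (1 - θ) < 1 :=
    Real.rpow_lt_one_of_one_lt_of_neg (by norm_num) (by linarith)
  have hC0 : 0 ≤ C := div_nonneg (by linarith) (by linarith)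
  let U := uniformSubdivision hab
  let e : ℕ → ℝ := fun n => (U n).n * (K * (U n).mesh ^ θ)
  have he : Tendsto e atTop (𝓝 0) := by
    have h := (tendsto_mesh_rpow (a := a) (b := b) hθ (K * (b - a))).comp
      (tendsto_uniformSubdivision hab)
    refine h.congr fun n => ?_
    simp only [Function.comp_apply, e, U, mesh_uniformSubdivision]
    have hd0 : 0 ≤ (b - a) / ((n : ℝ) + 1) := div_nonneg (by linarith) (by positivity)
    have h3 : ((n : ℝ) + 1) * ((b - a) / ((n : ℝ) + 1)) = b - a := by field_simp
    have h4 : (((uniformSubdivision hab n).n : ℕ) : ℝ) = n + 1 := by simp [uniformSubdivision]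
    rw [rpow_eq_rpow_sub_one_mul hd0 hθ, h4]
    linear_combination (-K * ((b - a) / ((n : ℝ) + 1)) ^ (θ - 1)) * h3
  have hclose : ∀ n (p : Subdivision a b), |p.riemannSum f ω - (U n).riemannSum f ω|
      ≤ C * (b - a) * p.mesh ^ (θ - 1) + p.n * e n := by
    intro n p
    have := p.abs_riemannSum_sub_le hab (f := f) (ω := ω) (Y := (U n).partialSum f ω) (e := e n)
      hθ hC0 (fun s t hst => (U n).abs_partialSum_sub_le hθ hK hfω hst)
    have hb : (U n).partialSum f ω ⟨b, Set.right_mem_Icc.2 hab⟩ = (U n).riemannSum f ω := by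
      refine Finset.sum_congr rfl fun k _ => ?_
      have hle : ∀ y : Set.Icc a b, y ≤ ⟨b, Set.right_mem_Icc.2 hab⟩ := fun y => y.2.2
      rw [min_eq_left (hle _), min_eq_left (hle _)]
    have ha : (U n).partialSum f ω ⟨a, Set.left_mem_Icc.2 hab⟩ = 0 := by
      refine Finset.sum_eq_zero fun k _ => ?_
      have hle : ∀ y : Set.Icc a b, ⟨a, Set.left_mem_Icc.2 hab⟩ ≤ y := fun y => y.2.1
      rw [min_eq_right (hle _), min_eq_right (hle _), sub_self, mul_zero]
    rwa [ha, hb, sub_zero] at this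
  have hlim := (tendsto_mesh_rpow (a := a) (b := b) hθ (C * (b - a)))
  have hcauchy : CauchySeq fun n => (U n).riemannSum f ω := by
    rw [Metric.cauchySeq_iff]
    intro ε hε
    obtain ⟨m, hm⟩ := ((hlim.comp (tendsto_uniformSubdivision hab)).eventually
      (gt_mem_nhds (show (0 : ℝ) < ε / 4 by linarith))).exists
    have h1 : ∀ᶠ n in atTop, (U m).n * e n < ε / 4 := by
      have := he.const_mul ((U m).n : ℝ)
      rw [mul_zero] at this
      exact this.eventually (gt_mem_nhds (by linarith))
    obtain ⟨N, hN⟩ := eventually_atTop.1 h1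
    have h3 : ∀ n ≥ N, |(U m).riemannSum f ω - (U n).riemannSum f ω| < ε / 2 := by
      intro n hn
      have := hclose n (U m)
      have h4 := hN n hn
      simp only [Function.comp_apply] at hm
      linarith
    refine ⟨N, fun n hn k hk => ?_⟩
    have h4 := abs_lt.1 (h3 n hn)
    have h5 := abs_lt.1 (h3 k hk)
    rw [Real.dist_eq, abs_lt]
    constructor <;> linarith
  obtain ⟨L, hL⟩ := cauchySeq_tendsto_of_complete hcauchy
  refine ⟨L, ?_⟩
  rw [tendsto_iff_dist_tendsto_zero]
  refine squeeze_zero (fun _ => dist_nonneg) (fun p => ?_) hlim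
  have h5 : Tendsto (fun n => C * (b - a) * p.mesh ^ (θ - 1) + p.n * e n) atTop
      (𝓝 (C * (b - a) * p.mesh ^ (θ - 1))) := by
    simpa using (he.const_mul (p.n : ℝ)).const_add (C * (b - a) * p.mesh ^ (θ - 1))
  rw [Real.dist_eq]
  exact le_of_tendsto_of_tendsto' ((tendsto_const_nhds.sub hL).abs) h5 (fun n => hclose n p)

end Young

/-! ### Lebesgue measure on the interval -/

section Volume

variable {a b : ℝ}

theorem isFiniteMeasure_volume_Icc : IsFiniteMeasure (volume : Measure (Set.Icc a b)) := by
  constructor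
  rw [Measure.Subtype.volume_univ measurableSet_Icc.nullMeasurableSet]
  exact measure_Icc_lt_top

attribute [local instance] isFiniteMeasure_volume_Icc

theorem volume_singleton_Icc (x : Set.Icc a b) : (volume : Measure (Set.Icc a b)) {x} = 0 := by
  rw [← volume_image_subtype_coe measurableSet_Icc, Set.image_singleton]
  exact measure_singleton _

theorem volume_real_Ioc_Icc {x y : Set.Icc a b} (hxy : x ≤ y) :
    (volume : Measure (Set.Icc a b)).real (Set.Ioc x y) = (y : ℝ) - x := by
  have : Subtype.val '' (Set.Ioc x y) = Set.Ioc (x : ℝ) y := by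
    ext z
    constructor
    · rintro ⟨w, hw, rfl⟩
      exact hw
    · intro hz
      exact ⟨⟨z, x.2.1.trans hz.1.le, hz.2.trans y.2.2⟩, hz, rfl⟩
  rw [Measure.real, ← volume_image_subtype_coe measurableSet_Icc, this, Real.volume_Ioc,
    ENNReal.toReal_ofReal (sub_nonneg.2 hxy)]

theorem exists_abs_le_of_continuous {g : Set.Icc a b → ℝ} (hg : Continuous g) :
    ∃ C, 0 ≤ C ∧ ∀ x, |g x| ≤ C := by
  obtain ⟨C, hC⟩ := (isCompact_range hg).isBounded.exists_norm_le
  exact ⟨max C 0, le_max_right _ _, fun x => (hC _ ⟨x, rfl⟩).trans (le_max_left _ _)⟩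

theorem integrable_of_continuous {g : Set.Icc a b → ℝ} (hg : Continuous g) : Integrable g := by
  obtain ⟨C, _, hC⟩ := exists_abs_le_of_continuous hg
  exact Integrable.of_bound hg.measurable.aestronglyMeasurable C (.of_forall hC)

theorem setIntegral_Iic_sub {g : Set.Icc a b → ℝ} (hg : Continuous g) {x y : Set.Icc a b}
    (hxy : x ≤ y) :
    (∫ z in Set.Iic y, g z) - ∫ z in Set.Iic x, g z = ∫ z in Set.Ioc x y, g z := by
  have h := setIntegral_union (μ := volume) (Set.Iic_disjoint_Ioc (le_refl x) (c := y))
    measurableSet_Ioc (integrable_of_continuous hg).integrableOn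
    (integrable_of_continuous hg).integrableOn
  rw [Set.Iic_union_Ioc_eq_Iic hxy] at h
  rw [h, add_sub_cancel_left]

end Volume

attribute [local instance] isFiniteMeasure_volume_Icc

/-! ### The Young integral of Hölder functions -/

section YoungHolder

variable {a b : ℝ} {γ δ : ℝ≥0}

theorem _root_.MemHolder.exists_abs_sub_le {f : Set.Icc a b → ℝ} (hf : MemHolder δ f) :
    ∃ K, 0 ≤ K ∧ ∀ s t : Set.Icc a b, ∀ d : ℝ,
      |(s : ℝ) - t| ≤ d → |f s - f t| ≤ K * d ^ (δ : ℝ) := by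
  obtain ⟨K, hK⟩ := hf
  refine ⟨K, K.2, fun s t d hd => ?_⟩
  have h1 := hK.dist_le s t
  rw [Real.dist_eq, Subtype.dist_eq, Real.dist_eq] at h1
  exact h1.trans (mul_le_mul_of_nonneg_left (Real.rpow_le_rpow (abs_nonneg _) hd δ.2) K.2)

theorem exists_abs_sub_mul_sub_le {f ω : Set.Icc a b → ℝ} (hf : MemHolder δ f)
    (hω : MemHolder γ ω) : ∃ K, 0 ≤ K ∧ ∀ s t u v : Set.Icc a b, ∀ d : ℝ, |(s : ℝ) - t| ≤ d →
      |(u : ℝ) - v| ≤ d → |(f s - f t) * (ω u - ω v)| ≤ K * d ^ ((δ : ℝ) + γ) := by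
  obtain ⟨K, hK0, hK⟩ := hf.exists_abs_sub_le
  obtain ⟨K', hK0', hK'⟩ := hω.exists_abs_sub_le
  refine ⟨K * K', mul_nonneg hK0 hK0', fun s t u v d hd hd' => ?_⟩
  have hd0 : 0 ≤ d := (abs_nonneg _).trans hd
  rw [abs_mul, Real.rpow_add_of_nonneg hd0 δ.coe_nonneg γ.coe_nonneg]
  calc _ ≤ (K * d ^ (δ : ℝ)) * (K' * d ^ (γ : ℝ)) :=
        mul_le_mul (hK _ _ _ hd) (hK' _ _ _ hd') (abs_nonneg _) (by positivity)
    _ = _ := by ring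

theorem tendsto_youngIntegral (hab : a ≤ b) (hγδ : 1 < δ + γ) {f ω : Set.Icc a b → ℝ}
    (hf : MemHolder δ f) (hω : MemHolder γ ω) :
    Tendsto (Subdivision.riemannSum f ω) (comap Subdivision.mesh (𝓝 (0 : ℝ)))
      (𝓝 (youngIntegral f ω)) := by
  obtain ⟨K, hK0, hK⟩ := exists_abs_sub_mul_sub_le hf hω
  have := neBot_comap_mesh hab
  exact tendsto_nhds_limUnder (exists_tendsto_riemannSum hab (by exact_mod_cast hγδ) hK0 hK)

theorem youngIntegral_eq_of_tendsto (hab : a ≤ b) {f ω : Set.Icc a b → ℝ} {L : ℝ}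
    (h : Tendsto (Subdivision.riemannSum f ω) (comap Subdivision.mesh (𝓝 (0 : ℝ))) (𝓝 L)) :
    youngIntegral f ω = L := by
  have := neBot_comap_mesh hab
  exact h.limUnder_eq

theorem youngIntegral_add_smul_left (hab : a ≤ b) (hγδ : 1 < δ + γ) {f g ω : Set.Icc a b → ℝ}
    (hf : MemHolder δ f) (hg : MemHolder δ g) (hω : MemHolder γ ω) (c : ℝ) :
    youngIntegral (fun x => f x + c * g x) ω = youngIntegral f ω + c * youngIntegral g ω := by
  refine youngIntegral_eq_of_tendsto hab (((tendsto_youngIntegral hab hγδ hf hω).add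
    ((tendsto_youngIntegral hab hγδ hg hω).const_mul c)).congr fun p => ?_)
  simp only [Subdivision.riemannSum, Finset.mul_sum, ← Finset.sum_add_distrib]
  exact Finset.sum_congr rfl fun k _ => by ring

/-- Against an absolutely continuous path the Young integral is a Lebesgue integral. -/
theorem youngIntegral_add_primitive (hab : a ≤ b) (hδ : 0 < δ) (hγδ : 1 < δ + γ)
    {f ω v : Set.Icc a b → ℝ} (hf : MemHolder δ f) (hω : MemHolder γ ω) (hfc : Continuous f)
    (hv : Continuous v) :
    youngIntegral f (fun t => ω t + ∫ z in Set.Iic t, v z)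
      = youngIntegral f ω + ∫ x, f x * v x := by
  obtain ⟨K, hK0, hK⟩ := hf.exists_abs_sub_le
  obtain ⟨C, hC0, hC⟩ := exists_abs_le_of_continuous hv
  have hprim : Tendsto (Subdivision.riemannSum f (fun t => ∫ z in Set.Iic t, v z))
      (comap Subdivision.mesh (𝓝 (0 : ℝ))) (𝓝 (∫ x, f x * v x)) := by
    have h := tendsto_riemannSum_of_primitive hab (f := f) (ω := fun t => ∫ z in Set.Iic t, v z)
      (Y := fun t => ∫ z in Set.Iic t, f z * v z) (θ := δ + 1) (C := K * C)
      (by have : (0 : ℝ) < δ := hδ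
          linarith) (mul_nonneg hK0 hC0) ?_
    · have h1 : Set.Iic (⟨b, Set.right_mem_Icc.2 hab⟩ : Set.Icc a b) = Set.univ :=
        Set.eq_univ_of_forall fun y => y.2.2
      have h2 : Set.Iic (⟨a, Set.left_mem_Icc.2 hab⟩ : Set.Icc a b)
          = {⟨a, Set.left_mem_Icc.2 hab⟩} := by
        ext y
        exact ⟨fun hy => le_antisymm hy y.2.1, fun hy => le_of_eq hy⟩
      rw [h1, h2, setIntegral_univ, setIntegral_measure_zero _ (volume_singleton_Icc _),
        sub_zero] at h
      exact h
    · intro s t hst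
      have hst' : (s : ℝ) ≤ t := hst
      have hfv : Continuous fun z => f z * v z := hfc.mul hv
      rw [setIntegral_Iic_sub hfv hst, setIntegral_Iic_sub hv hst,
        ← integral_const_mul, ← integral_sub (integrable_of_continuous hfv).integrableOn
          ((integrable_of_continuous hv).const_mul _).integrableOn]
      have hb : ∀ z ∈ Set.Ioc s t, ‖f z * v z - f s * v z‖ ≤ K * ((t : ℝ) - s) ^ (δ : ℝ) * C := by
        intro z hz
        rw [← sub_mul, norm_mul]
        refine mul_le_mul (hK _ _ _ ?_) (hC z) (norm_nonneg _) (by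
          have := Real.rpow_nonneg (sub_nonneg.2 hst') (δ : ℝ)
          positivity)
        have h1 : (s : ℝ) < z := hz.1
        have h2 : (z : ℝ) ≤ t := hz.2
        rw [abs_of_nonneg] <;> linarith
      have := norm_setIntegral_le_of_norm_le_const (μ := (volume : Measure (Set.Icc a b)))
        (s := Set.Ioc s t) (measure_lt_top _ _) hb
      rw [volume_real_Ioc_Icc hst, Real.norm_eq_abs] at this
      refine this.trans_eq ?_
      rw [Real.rpow_add_of_nonneg (sub_nonneg.2 hst') δ.coe_nonneg (by norm_num), Real.rpow_one]
      ring
  refine youngIntegral_eq_of_tendsto hab (((tendsto_youngIntegral hab hγδ hf hω).add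
    hprim).congr fun p => ?_)
  simp only [Subdivision.riemannSum, ← Finset.sum_add_distrib]
  exact Finset.sum_congr rfl fun k _ => by ring

/-- The Riemann sums of `f` against the indicator path `t ↦ 1_{z ≤ t}` are the values at `z` of the
left-point step functions of `f`; they are bounded by `sup |f|` and converge to `f z` unless `z`
is the left end point. -/
theorem Subdivision.abs_riemannSum_indicator_le (hab : a ≤ b) (p : Subdivision a b)
    {f : Set.Icc a b → ℝ} {z : Set.Icc a b} {c e : ℝ} (he : 0 ≤ e)
    (hf : ∀ x : Set.Icc a b, |(x : ℝ) - z| ≤ p.mesh → |f x - c| ≤ e) :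
    |p.riemannSum (fun x => f x - c) (fun t => Set.indicator (Set.Iic t) (fun _ => (1 : ℝ)) z)|
      ≤ e := by
  set g : Set.Icc a b → ℝ := fun t => Set.indicator (Set.Iic t) (fun _ => (1 : ℝ)) z with hg
  have hgle : ∀ t, z ≤ t → g t = 1 := fun t ht => Set.indicator_of_mem (s := Set.Iic t) ht _
  have hglt : ∀ t, t < z → g t = 0 := fun t ht =>
    Set.indicator_of_notMem (s := Set.Iic t) (not_le.2 ht) _
  have hterm : ∀ k : Fin p.n, |(f (p.pt k.castSucc) - c) * (g (p.pt k.succ) - g (p.pt k.castSucc))|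
      ≤ e * (g (p.pt k.succ) - g (p.pt k.castSucc)) := by
    intro k
    have hk : p.pt k.castSucc ≤ p.pt k.succ := p.mono (Fin.castSucc_lt_succ).le
    have hm := p.sub_le_mesh k
    rcases le_or_gt z (p.pt k.castSucc) with h1 | h1
    · rw [hgle _ h1, hgle _ (h1.trans hk)]; simp
    · rcases le_or_gt z (p.pt k.succ) with h2 | h2
      · rw [hgle _ h2, hglt _ h1, sub_zero, mul_one, mul_one]
        refine hf _ ?_
        have h1' : (p.pt k.castSucc : ℝ) < z := h1
        have h2' : (z : ℝ) ≤ p.pt k.succ := h2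
        rw [abs_sub_comm, abs_of_nonneg] <;> linarith
      · rw [hglt _ h1, hglt _ h2]; simp
  refine (Finset.abs_sum_le_sum_abs _ _).trans ((Finset.sum_le_sum fun k _ => hterm k).trans ?_)
  rw [← Finset.mul_sum, p.sum_sub hab g, hgle ⟨b, Set.right_mem_Icc.2 hab⟩ z.2.2]
  have : 0 ≤ g ⟨a, Set.left_mem_Icc.2 hab⟩ := Set.indicator_nonneg (fun _ _ => zero_le_one) _
  nlinarith

theorem Subdivision.riemannSum_indicator_sub_const (hab : a ≤ b) (p : Subdivision a b)
    (f : Set.Icc a b → ℝ) {z : Set.Icc a b} (hz : a < z) (c : ℝ) :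
    p.riemannSum (fun x => f x - c) (fun t => Set.indicator (Set.Iic t) (fun _ => (1 : ℝ)) z)
      = p.riemannSum f (fun t => Set.indicator (Set.Iic t) (fun _ => (1 : ℝ)) z) - c := by
  have h := p.sum_sub hab (fun t => Set.indicator (Set.Iic t) (fun _ => (1 : ℝ)) z)
  rw [Set.indicator_of_mem (show z ∈ Set.Iic (⟨b, Set.right_mem_Icc.2 hab⟩ : Set.Icc a b)
    from z.2.2), Set.indicator_of_notMem (show z ∉ Set.Iic (⟨a, Set.left_mem_Icc.2 hab⟩ :
    Set.Icc a b) from fun h => not_le.2 hz h), sub_zero] at h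
  simp only [Subdivision.riemannSum, sub_mul, Finset.sum_sub_distrib, ← Finset.mul_sum] at h ⊢
  rw [h, mul_one]

end YoungHolder

/-! ### The σ-field of the path space -/

section PathSpace

variable {a b : ℝ} {γ : ℝ≥0}

theorem measurable_eval (x : Set.Icc a b) : Measurable (fun ω : OrderPath a b γ => ω x) := by
  let _ : MeasurableSpace C(Set.Icc a b, ℝ) := borel _
  have : BorelSpace C(Set.Icc a b, ℝ) := ⟨rfl⟩
  exact (continuous_eval_const (F := C(Set.Icc a b, ℝ)) x).measurable.comp (comap_measurable _)

/-- The σ-field of the path space is generated by the evaluations at a dense sequence: evaluation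
there is a continuous injection of a Polish space, hence a measurable embedding. -/
theorem comap_eval_eq {t : ℕ → Set.Icc a b} (ht : DenseRange t) :
    MeasurableSpace.comap (fun (ω : OrderPath a b γ) (n : ℕ) => ω (t n)) MeasurableSpace.pi
      = (inferInstance : MeasurableSpace (OrderPath a b γ)) := by
  let _ : MeasurableSpace C(Set.Icc a b, ℝ) := borel _
  have : BorelSpace C(Set.Icc a b, ℝ) := ⟨rfl⟩
  have hc : Continuous (fun (f : C(Set.Icc a b, ℝ)) (n : ℕ) => f (t n)) :=
    continuous_pi fun n => continuous_eval_const (F := C(Set.Icc a b, ℝ)) _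
  have hi : Function.Injective (fun (f : C(Set.Icc a b, ℝ)) (n : ℕ) => f (t n)) := by
    intro f g h
    exact DFunLike.coe_injective (ht.equalizer f.continuous g.continuous h)
  have h1 := (hc.measurableEmbedding hi).comap_eq
  have h2 := MeasurableSpace.comap_comp (m := MeasurableSpace.pi)
    (g := fun (ω : OrderPath a b γ) => ω.1)
    (f := fun (f : C(Set.Icc a b, ℝ)) (n : ℕ) => f (t n))
  rw [h1] at h2
  exact h2.symm

/-- A path law is determined by the laws of the linear combinations of the evaluations. -/
theorem measure_ext_of_eval {P Q : Measure (OrderPath a b γ)} [IsFiniteMeasure P]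
    [IsFiniteMeasure Q] [Nonempty (Set.Icc a b)]
    (h : ∀ (I : Finset ℕ) (c : I → ℝ) (t : ℕ → Set.Icc a b),
      P.map (fun ω => ∑ i, c i * ω (t i)) = Q.map (fun ω => ∑ i, c i * ω (t i))) : P = Q := by
  set t := TopologicalSpace.denseSeq (Set.Icc a b)
  have hm : Measurable (fun (ω : OrderPath a b γ) (n : ℕ) => ω (t n)) :=
    measurable_pi_lambda _ fun n => measurable_eval _
  have hI : ∀ I : Finset ℕ, Measurable (fun ω : OrderPath a b γ => I.restrict fun n => ω (t n)) :=
    fun I => (Finset.measurable_restrict I).comp hm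
  have hfin : ∀ I : Finset ℕ, P.map (fun ω => I.restrict fun n => ω (t n))
      = Q.map (fun ω => I.restrict fun n => ω (t n)) := by
    intro I
    refine Measure.ext_of_charFunDual (funext fun L => ?_)
    have hL : (fun ω : OrderPath a b γ => L (I.restrict fun n => ω (t n)))
        = fun ω => ∑ i, L (Pi.single i 1) * ω (t i) := by
      funext ω
      rw [← L.coe_coe, L.toLinearMap.pi_apply_eq_sum_univ]
      refine Finset.sum_congr rfl fun i _ => ?_
      rw [smul_eq_mul, mul_comm]
      congr 2
      ext j
      simp [Pi.single_apply, eq_comm]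
    rw [charFunDual_eq_charFun_map_one, charFunDual_eq_charFun_map_one,
      Measure.map_map L.continuous.measurable (hI I),
      Measure.map_map L.continuous.measurable (hI I)]
    have := h I (fun i => L (Pi.single i 1)) t
    rw [← hL] at this
    exact congrArg (fun μ => charFun μ 1) this
  have hmap : P.map (fun (ω : OrderPath a b γ) (n : ℕ) => ω (t n))
      = Q.map (fun (ω : OrderPath a b γ) (n : ℕ) => ω (t n)) := by
    have h1 := isProjectiveLimit_map (X := fun (n : ℕ) (ω : OrderPath a b γ) => ω (t n)) (P := P)
      hm.aemeasurable
    have h2 := isProjectiveLimit_map (X := fun (n : ℕ) (ω : OrderPath a b γ) => ω (t n)) (P := Q)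
      hm.aemeasurable
    simp_rw [hfin] at h1
    exact h1.unique h2
  refine Measure.ext fun A hA => ?_
  have h1 := comap_eval_eq (γ := γ) (TopologicalSpace.denseRange_denseSeq (Set.Icc a b))
  obtain ⟨B, hB, rfl⟩ : MeasurableSet[MeasurableSpace.comap
    (fun (ω : OrderPath a b γ) (n : ℕ) => ω (t n)) MeasurableSpace.pi] A := h1 ▸ hA
  rw [← Measure.map_apply hm hB, ← Measure.map_apply hm hB, hmap]

end PathSpace

/-! ### Linear functionals of the order flow -/

section EvalPairs

variable {a b : ℝ} {γ : ℝ≥0}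

variable (a b γ) in
/-- The linear span of the pairs `(1_{[a,x]}, ω ↦ ω x)`: a finite linear combination of evaluations
of the path together with the step function of which it is the integral against the path. -/
def evalPairs : Submodule ℝ ((Set.Icc a b → ℝ) × (OrderPath a b γ → ℝ)) :=
  Submodule.span ℝ (Set.range fun x : Set.Icc a b =>
    (Set.indicator (Set.Iic x) (fun _ => (1 : ℝ)), fun ω : OrderPath a b γ => ω x))

theorem mem_evalPairs (x : Set.Icc a b) :
    (Set.indicator (Set.Iic x) (fun _ => (1 : ℝ)), fun ω : OrderPath a b γ => ω x)
      ∈ evalPairs a b γ := Submodule.subset_span ⟨x, rfl⟩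

theorem sum_mem_evalPairs {ι : Type*} (s : Finset ι) (c : ι → ℝ) (t : ι → Set.Icc a b) :
    ((fun z => ∑ i ∈ s, c i * Set.indicator (Set.Iic (t i)) (fun _ => (1 : ℝ)) z),
      fun ω : OrderPath a b γ => ∑ i ∈ s, c i * ω (t i)) ∈ evalPairs a b γ := by
  have h := Submodule.sum_mem (evalPairs a b γ) (t := s)
    (fun i _ => Submodule.smul_mem _ (c i) (mem_evalPairs (t i)))
  convert h using 1
  ext
  · simp [Prod.fst_sum]
  · simp [Prod.snd_sum]

theorem measurable_snd_of_mem_evalPairs {p : (Set.Icc a b → ℝ) × (OrderPath a b γ → ℝ)}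
    (hp : p ∈ evalPairs a b γ) : Measurable p.2 := by
  induction hp using Submodule.span_induction with
  | mem p hp =>
    obtain ⟨x, rfl⟩ := hp
    exact measurable_eval x
  | zero => exact measurable_const
  | add p q _ _ h1 h2 => exact h1.add h2
  | smul c p _ h1 => exact h1.const_mul c

theorem measurable_fst_of_mem_evalPairs {p : (Set.Icc a b → ℝ) × (OrderPath a b γ → ℝ)}
    (hp : p ∈ evalPairs a b γ) : Measurable p.1 := by
  induction hp using Submodule.span_induction with
  | mem p hp =>
    obtain ⟨x, rfl⟩ := hp
    exact measurable_const.indicator measurableSet_Iic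
  | zero => exact measurable_const
  | add p q _ _ h1 h2 => exact h1.add h2
  | smul c p _ h1 => exact h1.const_mul c

theorem exists_abs_fst_le_of_mem_evalPairs {p : (Set.Icc a b → ℝ) × (OrderPath a b γ → ℝ)}
    (hp : p ∈ evalPairs a b γ) : ∃ C, 0 ≤ C ∧ ∀ z, |p.1 z| ≤ C := by
  induction hp using Submodule.span_induction with
  | mem p hp =>
    obtain ⟨x, rfl⟩ := hp
    refine ⟨1, zero_le_one, fun z => ?_⟩
    dsimp only
    by_cases hz : z ∈ Set.Iic x
    · rw [Set.indicator_of_mem hz]; simp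
    · rw [Set.indicator_of_notMem hz]; simp
  | zero => exact ⟨0, le_rfl, fun z => by simp⟩
  | add p q _ _ h1 h2 =>
    obtain ⟨C, hC0, hC⟩ := h1
    obtain ⟨D, hD0, hD⟩ := h2
    exact ⟨C + D, by positivity, fun z => (abs_add_le _ _).trans (add_le_add (hC z) (hD z))⟩
  | smul c p _ h1 =>
    obtain ⟨C, hC0, hC⟩ := h1
    refine ⟨|c| * C, by positivity, fun z => ?_⟩
    have : (c • p).1 z = c * p.1 z := rfl
    rw [this, abs_mul]
    exact mul_le_mul_of_nonneg_left (hC z) (abs_nonneg _)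

theorem integrable_fst_mul {p : (Set.Icc a b → ℝ) × (OrderPath a b γ → ℝ)}
    (hp : p ∈ evalPairs a b γ) {g : Set.Icc a b → ℝ} (hg : Continuous g) :
    Integrable fun z => p.1 z * g z := by
  obtain ⟨C, _, hC⟩ := exists_abs_fst_le_of_mem_evalPairs hp
  exact (integrable_of_continuous hg).bdd_mul
    (measurable_fst_of_mem_evalPairs hp).aestronglyMeasurable (.of_forall hC)

theorem integrable_fst_mul_fst_mul {p q : (Set.Icc a b → ℝ) × (OrderPath a b γ → ℝ)}
    (hp : p ∈ evalPairs a b γ) (hq : q ∈ evalPairs a b γ) {g : Set.Icc a b → ℝ}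
    (hg : Continuous g) : Integrable fun z => p.1 z * q.1 z * g z := by
  obtain ⟨C, _, hC⟩ := exists_abs_fst_le_of_mem_evalPairs hp
  simp_rw [mul_assoc]
  exact (integrable_fst_mul hq hg).bdd_mul
    (measurable_fst_of_mem_evalPairs hp).aestronglyMeasurable (.of_forall hC)

variable {σ W : Set.Icc a b → ℝ} {P : Measure (OrderPath a b γ)}

theorem IsOrderFlowLaw.hasGaussianLaw (hP : IsOrderFlowLaw σ W P)
    {p : (Set.Icc a b → ℝ) × (OrderPath a b γ → ℝ)} (hp : p ∈ evalPairs a b γ) :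
    HasGaussianLaw p.2 P := by
  obtain ⟨c, rfl⟩ := Finsupp.mem_span_range_iff_exists_finsupp.1 hp
  have h := (hP.isGaussianProcess.smul c).hasGaussianLaw_fun_sum (I := c.support)
  have heq : (c.sum fun x r => r • ((Set.indicator (Set.Iic x) (fun _ => (1 : ℝ)),
      fun ω : OrderPath a b γ => ω x) : (Set.Icc a b → ℝ) × (OrderPath a b γ → ℝ))).2
      = fun ω => ∑ i ∈ c.support, c i • ω i := by
    funext ω
    simp [Finsupp.sum, Prod.snd_sum]
  rw [heq]
  exact h

theorem IsOrderFlowLaw.integral_snd (hP : IsOrderFlowLaw σ W P) (hW : Continuous W)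
    {p : (Set.Icc a b → ℝ) × (OrderPath a b γ → ℝ)} (hp : p ∈ evalPairs a b γ) :
    ∫ ω, p.2 ω ∂P = ∫ z, p.1 z * W z := by
  induction hp using Submodule.span_induction with
  | mem p hp =>
    obtain ⟨x, rfl⟩ := hp
    rw [hP.mean, ← integral_indicator measurableSet_Iic]
    congr 1
    funext z
    by_cases hz : z ∈ Set.Iic x
    · simp [Set.indicator_of_mem hz]
    · simp [Set.indicator_of_notMem hz]
  | zero => simp
  | add p q hp hq h1 h2 =>
    simp only [Prod.fst_add, Prod.snd_add, Pi.add_apply, add_mul]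
    rw [integral_add (hP.hasGaussianLaw hp).integrable (hP.hasGaussianLaw hq).integrable,
      integral_add (integrable_fst_mul hp hW) (integrable_fst_mul hq hW), h1, h2]
  | smul c p hp h1 =>
    simp only [Prod.smul_fst, Prod.smul_snd, Pi.smul_apply, smul_eq_mul, mul_assoc]
    rw [integral_const_mul, integral_const_mul, h1]

theorem IsOrderFlowLaw.covariance_snd (hP : IsOrderFlowLaw σ W P)
    (hσ : Continuous fun x => σ x ^ 2) {p q : (Set.Icc a b → ℝ) × (OrderPath a b γ → ℝ)}
    (hp : p ∈ evalPairs a b γ) (hq : q ∈ evalPairs a b γ) :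
    covariance p.2 q.2 P = ∫ z, p.1 z * q.1 z * σ z ^ 2 := by
  have := hP.isProbabilityMeasure
  induction hp, hq using Submodule.span_induction₂ with
  | mem_mem p q hp hq =>
    obtain ⟨x, rfl⟩ := hp
    obtain ⟨y, rfl⟩ := hq
    rw [hP.cov, ← integral_indicator measurableSet_Iic]
    congr 1
    funext z
    by_cases hx : z ≤ x <;> by_cases hy : z ≤ y <;> simp [Set.indicator, hx, hy]
  | zero_left => simp
  | zero_right => simp
  | add_left p q r hp hq hr h1 h2 =>
    simp only [Prod.fst_add, Prod.snd_add, Pi.add_apply, add_mul]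
    rw [covariance_add_left (hP.hasGaussianLaw hp).memLp_two (hP.hasGaussianLaw hq).memLp_two
      (hP.hasGaussianLaw hr).memLp_two, integral_add (integrable_fst_mul_fst_mul hp hr hσ)
      (integrable_fst_mul_fst_mul hq hr hσ), h1, h2]
  | add_right p q r hp hq hr h1 h2 =>
    simp only [Prod.fst_add, Prod.snd_add, Pi.add_apply, mul_add, add_mul]
    rw [covariance_add_right (hP.hasGaussianLaw hp).memLp_two (hP.hasGaussianLaw hq).memLp_two
      (hP.hasGaussianLaw hr).memLp_two, integral_add (integrable_fst_mul_fst_mul hp hq hσ)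
      (integrable_fst_mul_fst_mul hp hr hσ), h1, h2]
  | smul_left c p q hp hq h1 =>
    simp only [Prod.smul_fst, Prod.smul_snd, Pi.smul_apply, smul_eq_mul, mul_assoc]
    rw [covariance_smul_left, h1, integral_const_mul]
    simp only [mul_assoc]
  | smul_right c p q hp hq h1 =>
    simp only [Prod.smul_fst, Prod.smul_snd, Pi.smul_apply, smul_eq_mul]
    rw [covariance_smul_right, h1, ← integral_const_mul]
    congr 1
    funext z
    ring

theorem IsOrderFlowLaw.map_snd (hP : IsOrderFlowLaw σ W P) (hW : Continuous W)
    (hσ : Continuous fun x => σ x ^ 2) {p : (Set.Icc a b → ℝ) × (OrderPath a b γ → ℝ)}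
    (hp : p ∈ evalPairs a b γ) :
    P.map p.2 = gaussianReal (∫ z, p.1 z * W z) (∫ z, p.1 z ^ 2 * σ z ^ 2).toNNReal := by
  have := hP.isProbabilityMeasure
  rw [(hP.hasGaussianLaw hp).map_eq_gaussianReal, hP.integral_snd hW hp,
    ← covariance_self (measurable_snd_of_mem_evalPairs hp).aemeasurable,
    hP.covariance_snd hσ hp hp]
  simp only [pow_two]

/-- The law of the order flow is characterized by the laws of the finite linear combinations of
evaluations. -/
theorem isOrderFlowLaw_of_map_snd [IsProbabilityMeasure P]
    (hσ : Continuous fun x => σ x ^ 2)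
    (h : ∀ p ∈ evalPairs a b γ,
      P.map p.2 = gaussianReal (∫ z, p.1 z * W z) (∫ z, p.1 z ^ 2 * σ z ^ 2).toNNReal) :
    IsOrderFlowLaw σ W P := by
  have hlaw : ∀ p ∈ evalPairs a b γ, HasGaussianLaw p.2 P := fun p hp =>
    ⟨by rw [h p hp]; infer_instance⟩
  have hvar : ∀ p ∈ evalPairs a b γ, variance p.2 P = ∫ z, p.1 z ^ 2 * σ z ^ 2 := by
    intro p hp
    have h1 := variance_map (μ := P) (X := fun x : ℝ => x) (Y := p.2) aemeasurable_id
      (measurable_snd_of_mem_evalPairs hp).aemeasurable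
    rw [h p hp, variance_fun_id_gaussianReal, Real.coe_toNNReal _ (integral_nonneg fun z =>
      mul_nonneg (sq_nonneg _) (sq_nonneg _))] at h1
    exact h1.symm
  refine ⟨inferInstance, ⟨fun I => ⟨isGaussian_of_map_eq_gaussianReal fun L => ?_⟩⟩,
    fun x => ?_, fun x y => ?_⟩
  · have hm : Measurable (fun ω : OrderPath a b γ => I.restrict fun x => ω x) :=
      measurable_pi_lambda _ fun x => measurable_eval _
    have hL : (L ∘ fun ω : OrderPath a b γ => I.restrict fun x => ω x)
        = fun ω => ∑ i ∈ Finset.univ, L (Pi.single i 1) * ω (i : Set.Icc a b) := by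
      funext ω
      rw [Function.comp_apply, ← L.coe_coe, L.toLinearMap.pi_apply_eq_sum_univ]
      refine Finset.sum_congr rfl fun i _ => ?_
      rw [smul_eq_mul, mul_comm]
      congr 2
      ext j
      simp [Pi.single_apply, eq_comm]
    rw [Measure.map_map L.continuous.measurable hm, hL]
    exact ⟨_, _, h _ (sum_mem_evalPairs Finset.univ (fun i => L (Pi.single i 1))
      (fun i : I => (i : Set.Icc a b)))⟩
  · have h1 := integral_map (μ := P) (measurable_eval (γ := γ) x).aemeasurable (f := fun x : ℝ => x)
      aestronglyMeasurable_id
    have h2 := h _ (mem_evalPairs x)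
    dsimp only at h2
    rw [h2, integral_id_gaussianReal] at h1
    rw [← h1, ← integral_indicator measurableSet_Iic]
    congr 1
    funext z
    by_cases hz : z ∈ Set.Iic x
    · simp [Set.indicator_of_mem hz]
    · simp [Set.indicator_of_notMem hz]
  · -- polarization
    have hx := mem_evalPairs (γ := γ) x
    have hy := mem_evalPairs (γ := γ) y
    have h1 := variance_add (hlaw _ hx).memLp_two (hlaw _ hy).memLp_two
    have h2 := hvar _ (Submodule.add_mem _ hx hy)
    simp only [Prod.snd_add, Prod.fst_add] at h1 h2
    rw [h2] at h1
    have h3 := hvar _ hx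
    have h4 := hvar _ hy
    dsimp only at h1 h3 h4
    rw [h3, h4] at h1
    have h5 : ∀ z, (Set.indicator (Set.Iic x) (fun _ => (1 : ℝ)) +
        Set.indicator (Set.Iic y) (fun _ => (1 : ℝ))) z ^ 2 * σ z ^ 2
        = Set.indicator (Set.Iic x) (fun _ => (1 : ℝ)) z ^ 2 * σ z ^ 2
          + 2 * (Set.indicator (Set.Iic (min x y)) (fun z => σ z ^ 2) z)
          + Set.indicator (Set.Iic y) (fun _ => (1 : ℝ)) z ^ 2 * σ z ^ 2 := by
      intro z
      by_cases hx : z ≤ x <;> by_cases hy : z ≤ y <;> simp [Set.indicator, hx, hy]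
      ring
    have hi : ∀ x : Set.Icc a b, Integrable fun z =>
        Set.indicator (Set.Iic x) (fun _ => (1 : ℝ)) z ^ 2 * σ z ^ 2 := by
      intro x
      have := integrable_fst_mul_fst_mul (mem_evalPairs (γ := γ) x) (mem_evalPairs x) hσ
      simpa only [pow_two] using this
    have hi' : Integrable (Set.indicator (Set.Iic (min x y)) (fun z => σ z ^ 2)) :=
      (integrable_of_continuous hσ).indicator measurableSet_Iic
    simp_rw [h5] at h1
    have h6 := integral_add ((hi x).add (hi'.const_mul 2)) (hi y)
    have h7 := integral_add (hi x) (hi'.const_mul 2)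
    rw [integral_const_mul, integral_indicator measurableSet_Iic] at h7
    simp only [Pi.add_apply] at h6 h7
    linarith

theorem IsOrderFlowLaw.unique [Nonempty (Set.Icc a b)] {Q : Measure (OrderPath a b γ)}
    (hP : IsOrderFlowLaw σ W P) (hQ : IsOrderFlowLaw σ W Q) (hW : Continuous W)
    (hσ : Continuous fun x => σ x ^ 2) : P = Q := by
  have := hP.isProbabilityMeasure
  have := hQ.isProbabilityMeasure
  refine measure_ext_of_eval fun I c t => ?_
  have hp := sum_mem_evalPairs (γ := γ) Finset.univ c (fun i : I => t i)
  exact (hP.map_snd hW hσ hp).trans (hQ.map_snd hW hσ hp).symm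

end EvalPairs

/-! ### The law of the Young integral -/

section WienerIntegral

variable {a b : ℝ} {γ δ : ℝ≥0}

theorem map_eq_gaussianReal_of_tendsto {Ω : Type*} [MeasurableSpace Ω] {P : Measure Ω}
    [IsProbabilityMeasure P] {X : ℕ → Ω → ℝ} {Y : Ω → ℝ} (hX : ∀ n, Measurable (X n))
    (hlim : ∀ ω, Tendsto (fun n => X n ω) atTop (𝓝 (Y ω))) {v : ℕ → ℝ≥0} {w : ℝ≥0}
    (hv : Tendsto v atTop (𝓝 w)) (hlaw : ∀ n, P.map (X n) = gaussianReal 0 (v n)) :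
    P.map Y = gaussianReal 0 w := by
  have hY : Measurable Y := measurable_of_tendsto_metrizable hX (tendsto_pi_nhds.2 hlim)
  have : IsProbabilityMeasure (P.map Y) := Measure.isProbabilityMeasure_map hY.aemeasurable
  have hchar : ∀ Z : Ω → ℝ, Measurable Z → ∀ t : ℝ,
      charFun (P.map Z) t = ∫ ω, Complex.exp (t * Z ω * Complex.I) ∂P := by
    intro Z hZ t
    rw [charFun_apply_real, integral_map hZ.aemeasurable (by fun_prop)]
  refine Measure.ext_of_charFun (funext fun t => ?_)
  have h1 : Tendsto (fun n => charFun (P.map (X n)) t) atTop (𝓝 (charFun (P.map Y) t)) := by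
    rw [hchar Y hY]
    simp_rw [fun n => hchar (X n) (hX n) t]
    refine tendsto_integral_of_dominated_convergence (fun _ => 1) (fun n => by
      have := hX n
      fun_prop) (integrable_const _) (fun n => .of_forall fun ω => ?_) (.of_forall fun ω => ?_)
    · have := Complex.norm_exp_ofReal_mul_I (t * X n ω)
      push_cast at this
      exact this.le
    · have hc : Continuous fun x : ℝ => Complex.exp (t * x * Complex.I) := by fun_prop
      exact (hc.tendsto _).comp (hlim ω)
  have h2 : Tendsto (fun n => charFun (P.map (X n)) t) atTop
      (𝓝 (charFun (gaussianReal 0 w) t)) := by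
    simp_rw [hlaw, charFun_gaussianReal]
    have hc : Continuous fun x : ℝ≥0 => Complex.exp (t * (0 : ℝ) * Complex.I
      - ((x : ℝ) : ℂ) * t ^ 2 / 2) := by fun_prop
    exact (hc.tendsto w).comp hv
  exact tendsto_nhds_unique h1 h2

theorem Subdivision.riemannSum_mem_evalPairs (p : Subdivision a b) (f : Set.Icc a b → ℝ) :
    ((fun z => p.riemannSum f (fun t => Set.indicator (Set.Iic t) (fun _ => (1 : ℝ)) z)),
      fun ω : OrderPath a b γ => p.riemannSum f ω) ∈ evalPairs a b γ := by
  have h := Submodule.sum_mem (evalPairs a b γ) (t := Finset.univ) (fun (k : Fin p.n) _ =>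
    Submodule.smul_mem _ (f (p.pt k.castSucc)) (Submodule.sub_mem _ (mem_evalPairs (p.pt k.succ))
      (mem_evalPairs (p.pt k.castSucc))))
  convert h using 1
  ext
  · simp [Prod.fst_sum, Subdivision.riemannSum]
  · simp [Prod.snd_sum, Subdivision.riemannSum]

/-- Under the noise law, the Young integral of a Hölder function plus a linear combination of
evaluations is centred Gaussian, with the variance of a Wiener integral. -/
theorem IsOrderFlowLaw.map_youngIntegral_add (hab : a < b) (hδ : 0 < δ) (hγδ : 1 < δ + γ)
    {σ : Set.Icc a b → ℝ} {P : Measure (OrderPath a b γ)} (hP : IsOrderFlowLaw σ 0 P)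
    (hσ : Continuous fun x => σ x ^ 2) {f : Set.Icc a b → ℝ} (hf : MemHolder δ f)
    (hfc : Continuous f) {p : (Set.Icc a b → ℝ) × (OrderPath a b γ → ℝ)}
    (hp : p ∈ evalPairs a b γ) :
    P.map (fun ω : OrderPath a b γ => youngIntegral f ω + p.2 ω)
      = gaussianReal 0 (∫ z, (f z + p.1 z) ^ 2 * σ z ^ 2).toNNReal := by
  have := hP.isProbabilityMeasure
  let U := uniformSubdivision hab.le
  let φ : ℕ → Set.Icc a b → ℝ := fun n z =>
    (U n).riemannSum f (fun t => Set.indicator (Set.Iic t) (fun _ => (1 : ℝ)) z) + p.1 z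
  have hmem : ∀ n, ((φ n), fun ω : OrderPath a b γ => (U n).riemannSum f ω + p.2 ω)
      ∈ evalPairs a b γ := fun n =>
    Submodule.add_mem _ ((U n).riemannSum_mem_evalPairs (γ := γ) f) hp
  refine map_eq_gaussianReal_of_tendsto
    (X := fun n (ω : OrderPath a b γ) => (U n).riemannSum f ω + p.2 ω)
    (v := fun n => (∫ z, φ n z ^ 2 * σ z ^ 2).toNNReal)
    (fun n => measurable_snd_of_mem_evalPairs (hmem n)) (fun ω => ?_) ?_ (fun n => ?_)
  · exact ((tendsto_youngIntegral hab.le hγδ hf ω.2.2).comp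
      (tendsto_uniformSubdivision hab.le)).add_const _
  · refine (continuous_real_toNNReal.tendsto _).comp ?_
    obtain ⟨C, hC0, hC⟩ := exists_abs_le_of_continuous hfc
    obtain ⟨D, hD0, hD⟩ := exists_abs_fst_le_of_mem_evalPairs hp
    obtain ⟨K, hK0, hK⟩ := hf.exists_abs_sub_le
    refine tendsto_integral_of_dominated_convergence (fun z => (C + D) ^ 2 * σ z ^ 2)
      (fun n => ((((measurable_fst_of_mem_evalPairs (hmem n)).pow_const 2).mul
        hσ.measurable)).aestronglyMeasurable) ((integrable_of_continuous hσ).const_mul _)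
      (fun n => .of_forall fun z => ?_) ?_
    · have h1 := (U n).abs_riemannSum_indicator_le hab.le (f := f) (z := z) (c := 0) hC0
        (fun x _ => by simpa using hC x)
      simp only [sub_zero] at h1
      rw [norm_mul, Real.norm_eq_abs, Real.norm_eq_abs, abs_of_nonneg (sq_nonneg (φ n z)),
        abs_of_nonneg (sq_nonneg (σ z))]
      refine mul_le_mul_of_nonneg_right (sq_le_sq' ?_ ?_) (sq_nonneg _)
      · have := (abs_le.1 ((abs_add_le _ _).trans (add_le_add h1 (hD z)))).1
        exact this
      · have := (abs_le.1 ((abs_add_le _ _).trans (add_le_add h1 (hD z)))).2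
        exact this
    · -- the step functions of `f` need not converge at the left end point
      have hne : ∀ᵐ z : Set.Icc a b, z ≠ ⟨a, Set.left_mem_Icc.2 hab.le⟩ :=
        measure_mono_null (fun z hz => not_not.1 hz) (volume_singleton_Icc _)
      filter_upwards [hne] with z hz
      have hz' : a < z := lt_of_le_of_ne z.2.1 (fun h => hz (Subtype.ext h.symm))
      have hlim : Tendsto (fun n => (U n).riemannSum f
          (fun t => Set.indicator (Set.Iic t) (fun _ => (1 : ℝ)) z)) atTop (𝓝 (f z)) := by
        rw [tendsto_iff_dist_tendsto_zero]
        refine squeeze_zero (fun _ => dist_nonneg) (fun n => ?_)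
          (show Tendsto (fun n => K * (U n).mesh ^ (δ : ℝ)) atTop (𝓝 0) from ?_)
        · rw [Real.dist_eq, ← (U n).riemannSum_indicator_sub_const hab.le f hz']
          exact (U n).abs_riemannSum_indicator_le hab.le
            (mul_nonneg hK0 (Real.rpow_nonneg (U n).mesh_nonneg _)) (fun x hx => hK _ _ _ hx)
        · have h1 := (tendsto_mesh_rpow (a := a) (b := b) (θ := 1 + δ)
            (by have : (0 : ℝ) < δ := hδ
                linarith) K).comp (tendsto_uniformSubdivision hab.le)
          simp only [add_sub_cancel_left] at h1
          exact h1
      exact ((hlim.add_const _).pow 2).mul_const _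
  · have h := hP.map_snd continuous_const hσ (hmem n)
    simpa using h

end WienerIntegral

/-! ### Likelihoods and Girsanov's theorem -/

section NoiseModel

variable {a b : ℝ} {γ δ : ℝ≥0}

theorem memHolder_of_abs_sub_le {f : Set.Icc a b → ℝ} {K : ℝ} (hK : 0 ≤ K)
    (h : ∀ s t : Set.Icc a b, |f s - f t| ≤ K * |(s : ℝ) - t| ^ (δ : ℝ)) : MemHolder δ f := by
  refine ⟨K.toNNReal, fun s t => ?_⟩
  change _ ≤ ENNReal.ofReal K * _
  rw [edist_dist, edist_dist, ENNReal.ofReal_rpow_of_nonneg dist_nonneg δ.coe_nonneg,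
    ← ENNReal.ofReal_mul hK]
  exact ENNReal.ofReal_le_ofReal (h s t)

theorem _root_.MemHolder.div {f g : Set.Icc a b → ℝ} (hf : MemHolder δ f) (hg : MemHolder δ g)
    (hfc : Continuous f) (hgc : Continuous g) (hg0 : ∀ x, 0 < g x) :
    MemHolder δ (fun x => f x / g x) := by
  obtain ⟨K, hK0, hK⟩ := hf.exists_abs_sub_le
  obtain ⟨L, hL0, hL⟩ := hg.exists_abs_sub_le
  obtain ⟨C, hC0, hC⟩ := exists_abs_le_of_continuous hfc
  obtain ⟨D, hD0, hD⟩ := exists_abs_le_of_continuous (hgc.inv₀ fun x => (hg0 x).ne')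
  obtain ⟨M, hM0, hM⟩ := exists_abs_le_of_continuous hgc
  refine memHolder_of_abs_sub_le (K := (K * M + C * L) * (D * D)) (by positivity) fun s t => ?_
  have h1 : f s / g s - f t / g t
      = ((f s - f t) * g t + f t * (g t - g s)) * ((g s)⁻¹ * (g t)⁻¹) := by
    have := (hg0 s).ne'
    have := (hg0 t).ne'
    field_simp
    ring
  have hs := hK s t _ le_rfl
  have ht := hL t s _ (abs_sub_comm (t : ℝ) s).le
  have hd : 0 ≤ |(s : ℝ) - t| ^ (δ : ℝ) := Real.rpow_nonneg (abs_nonneg _) _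
  rw [h1, abs_mul, abs_mul]
  calc _ ≤ (K * |(s : ℝ) - t| ^ (δ : ℝ) * M + C * (L * |(s : ℝ) - t| ^ (δ : ℝ))) * (D * D) := by
        refine mul_le_mul ((abs_add_le _ _).trans ?_) (mul_le_mul (hD s) (hD t) (abs_nonneg _) hD0)
          (by positivity) (by positivity)
        rw [abs_mul, abs_mul]
        exact add_le_add (mul_le_mul hs (hM t) (abs_nonneg _) (by positivity))
          (mul_le_mul (hC t) ht (abs_nonneg _) hC0)
    _ = _ := by ring

theorem HolderSpace.continuous (W : HolderSpace a b δ) : Continuous (W : Set.Icc a b → ℝ) :=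
  W.toContinuousMap.continuous

theorem HolderSpace.abs_apply_le_norm (W : HolderSpace a b δ) (x : Set.Icc a b) : |W x| ≤ ‖W‖ := by
  have h1 := W.toContinuousMap.norm_coe_le_norm x
  have h2 := NNReal.coe_nonneg (nnHolderNorm δ (W : Set.Icc a b → ℝ))
  rw [HolderSpace.norm_def]
  rw [Real.norm_eq_abs] at h1
  linarith

@[simp] theorem HolderSpace.add_apply (W V : HolderSpace a b δ) (x : Set.Icc a b) :
    (W + V) x = W x + V x := rfl

@[simp] theorem HolderSpace.smul_apply (c : ℝ) (V : HolderSpace a b δ) (x : Set.Icc a b) :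
    (c • V) x = c * V x := rfl

/-- The standing assumptions on the noise: the exponents satisfy Young's condition, `σ²` is a
positive Hölder function, and `P₀` is the law of `∫ σ dB`. -/
structure IsNoiseModel (δ : ℝ≥0) (σ : Set.Icc a b → ℝ) (P₀ : Measure (OrderPath a b γ)) : Prop where
  lt : a < b
  pos : 0 < δ
  le_one : γ ≤ 1
  one_lt : 1 < δ + γ
  memHolder : MemHolder δ (fun x => σ x ^ 2)
  sq_pos : ∀ x, 0 < σ x ^ 2
  law : IsOrderFlowLaw σ 0 P₀

/-- The Wiener integral `∫ W/σ² dω`, taken pathwise. -/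
noncomputable def wienerIntegral (σ : Set.Icc a b → ℝ) (W : HolderSpace a b δ)
    (ω : OrderPath a b γ) : ℝ :=
  youngIntegral (fun x => W x / σ x ^ 2) ω

/-- The Cameron–Martin inner product `∫ W V / σ² dx`. -/
noncomputable def pairing (σ : Set.Icc a b → ℝ) (W V : HolderSpace a b δ) : ℝ :=
  ∫ x, W x / σ x ^ 2 * V x

theorem pairing_comm (σ : Set.Icc a b → ℝ) (W V : HolderSpace a b δ) :
    pairing σ W V = pairing σ V W := by
  unfold pairing
  congr 1
  funext x
  ring

theorem pairing_smul_right (σ : Set.Icc a b → ℝ) (V U : HolderSpace a b δ) (c : ℝ) :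
    pairing σ U (c • V) = c * pairing σ U V := by
  unfold pairing
  rw [← integral_const_mul]
  congr 1
  funext x
  simp only [HolderSpace.smul_apply]
  ring

theorem logLikelihood_eq (σ : Set.Icc a b → ℝ) (W : HolderSpace a b δ) (ω : OrderPath a b γ) :
    logLikelihood σ W ω = wienerIntegral σ W ω - 1 / 2 * pairing σ W W := by
  unfold logLikelihood wienerIntegral pairing
  congr 3
  funext x
  ring

variable {σ : Set.Icc a b → ℝ} {P₀ : Measure (OrderPath a b γ)}

namespace IsNoiseModel

theorem continuous_sq (h : IsNoiseModel δ σ P₀) : Continuous fun x => σ x ^ 2 := by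
  obtain ⟨C, hC⟩ := h.memHolder
  exact hC.continuous h.pos

theorem continuous_div (h : IsNoiseModel δ σ P₀) (W : HolderSpace a b δ) :
    Continuous fun x => W x / σ x ^ 2 :=
  W.continuous.div₀ h.continuous_sq fun x => (h.sq_pos x).ne'

theorem memHolder_div (h : IsNoiseModel δ σ P₀) (W : HolderSpace a b δ) :
    MemHolder δ fun x => W x / σ x ^ 2 :=
  W.memHolder.div h.memHolder W.continuous h.continuous_sq h.sq_pos

theorem pairing_add_smul_left (h : IsNoiseModel δ σ P₀) (W V U : HolderSpace a b δ) (c : ℝ) :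
    pairing σ (W + c • V) U = pairing σ W U + c * pairing σ V U := by
  unfold pairing
  rw [← integral_const_mul, ← integral_add]
  · congr 1
    funext x
    simp only [HolderSpace.add_apply, HolderSpace.smul_apply]
    ring
  · exact integrable_of_continuous ((h.continuous_div W).mul U.continuous)
  · exact (integrable_of_continuous ((h.continuous_div V).mul U.continuous)).const_mul c

theorem pairing_add_smul_right (h : IsNoiseModel δ σ P₀) (W V U : HolderSpace a b δ) (c : ℝ) :
    pairing σ U (W + c • V) = pairing σ U W + c * pairing σ U V := by
  rw [pairing_comm, h.pairing_add_smul_left, pairing_comm σ W, pairing_comm σ V]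

theorem exists_abs_pairing_le (h : IsNoiseModel δ σ P₀) :
    ∃ C, 0 ≤ C ∧ ∀ W V : HolderSpace a b δ, |pairing σ W V| ≤ C * ‖W‖ * ‖V‖ := by
  obtain ⟨D, hD0, hD⟩ := exists_abs_le_of_continuous
    (h.continuous_sq.inv₀ fun x => (h.sq_pos x).ne')
  refine ⟨D * (volume : Measure (Set.Icc a b)).real Set.univ, by positivity, fun W V => ?_⟩
  have h1 : ∀ x, ‖W x / σ x ^ 2 * V x‖ ≤ ‖W‖ * D * ‖V‖ := by
    intro x
    rw [div_eq_mul_inv, norm_mul, norm_mul]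
    exact mul_le_mul (mul_le_mul (W.abs_apply_le_norm x) (hD x) (norm_nonneg _) (norm_nonneg _))
      (V.abs_apply_le_norm x) (norm_nonneg _) (mul_nonneg (norm_nonneg _) hD0)
  have := norm_integral_le_of_norm_le_const (μ := (volume : Measure (Set.Icc a b)))
    (.of_forall h1)
  refine this.trans_eq ?_
  ring

theorem continuous_pairing_left (h : IsNoiseModel δ σ P₀) (V : HolderSpace a b δ) :
    Continuous fun W : HolderSpace a b δ => pairing σ W V := by
  obtain ⟨C, _, hC⟩ := h.exists_abs_pairing_le
  refine (LinearMap.mkContinuous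
    (⟨⟨fun W => pairing σ W V, fun W U => ?_⟩, fun c W => ?_⟩ : HolderSpace a b δ →ₗ[ℝ] ℝ)
    (C * ‖V‖) fun W => ?_).continuous
  · simpa using h.pairing_add_smul_left W U V 1
  · have := pairing_smul_right σ W V c
    rwa [pairing_comm, pairing_comm σ V W] at this
  · refine (hC W V).trans_eq ?_
    ring

theorem wienerIntegral_add_smul (h : IsNoiseModel δ σ P₀) (W V : HolderSpace a b δ) (c : ℝ)
    (ω : OrderPath a b γ) :
    wienerIntegral σ (W + c • V) ω = wienerIntegral σ W ω + c * wienerIntegral σ V ω := by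
  unfold wienerIntegral
  rw [← youngIntegral_add_smul_left h.lt.le h.one_lt (h.memHolder_div W) (h.memHolder_div V) ω.2.2]
  congr 1
  funext x
  simp only [HolderSpace.add_apply, HolderSpace.smul_apply]
  ring

theorem logLikelihood_add_smul (h : IsNoiseModel δ σ P₀) (W V : HolderSpace a b δ) (c : ℝ)
    (ω : OrderPath a b γ) :
    logLikelihood σ (W + c • V) ω
      = wienerIntegral σ W ω + c * wienerIntegral σ V ω - 1 / 2 * (pairing σ W W
        + 2 * c * pairing σ W V + c ^ 2 * pairing σ V V) := by
  rw [logLikelihood_eq, h.wienerIntegral_add_smul, h.pairing_add_smul_left,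
    h.pairing_add_smul_right, h.pairing_add_smul_right, pairing_comm σ V W]
  ring

theorem measurable_wienerIntegral (h : IsNoiseModel δ σ P₀) (W : HolderSpace a b δ) :
    Measurable (wienerIntegral (γ := γ) σ W) := by
  refine measurable_of_tendsto_metrizable (f := fun n (ω : OrderPath a b γ) =>
    (uniformSubdivision h.lt.le n).riemannSum (fun x => W x / σ x ^ 2) ω) (fun n => ?_)
    (tendsto_pi_nhds.2 fun ω => (tendsto_youngIntegral h.lt.le h.one_lt (h.memHolder_div W)
      ω.2.2).comp (tendsto_uniformSubdivision h.lt.le))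
  exact Finset.measurable_sum _ fun k _ =>
    ((measurable_eval _).sub (measurable_eval _)).const_mul _

theorem measurable_logLikelihood (h : IsNoiseModel δ σ P₀) (W : HolderSpace a b δ) :
    Measurable (logLikelihood (γ := γ) σ W) := by
  have : logLikelihood (γ := γ) σ W = fun ω => wienerIntegral σ W ω - 1 / 2 * pairing σ W W :=
    funext (logLikelihood_eq σ W)
  rw [this]
  exact (h.measurable_wienerIntegral W).sub_const _

/-- The likelihood of a random portfolio is jointly measurable, although `C^δ` is not separable:
it is a limit of expressions that involve finitely many values of the portfolio. -/
theorem measurable_logLikelihood_uncurry (h : IsNoiseModel δ σ P₀) {S : Type*}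
    [TopologicalSpace S] [MeasurableSpace S] [BorelSpace S] {W' : S → HolderSpace a b δ}
    (hW' : Continuous W') :
    Measurable fun p : OrderPath a b γ × S => logLikelihood σ (W' p.2) p.1 := by
  have heval : ∀ x, Measurable fun s => W' s x := by
    intro x
    have hc : Continuous fun W : HolderSpace a b δ => W x :=
      (LinearMap.mkContinuous
        (⟨⟨fun W => W x, fun W U => rfl⟩, fun c W => rfl⟩ : HolderSpace a b δ →ₗ[ℝ] ℝ)
        1 fun W => by
          rw [one_mul]
          exact W.abs_apply_le_norm x).continuous
    exact (hc.comp hW').measurable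
  have h1 : Measurable fun p : OrderPath a b γ × S => wienerIntegral σ (W' p.2) p.1 := by
    refine measurable_of_tendsto_metrizable (f := fun n (p : OrderPath a b γ × S) =>
      (uniformSubdivision h.lt.le n).riemannSum (fun x => W' p.2 x / σ x ^ 2) p.1) (fun n => ?_)
      (tendsto_pi_nhds.2 fun p => (tendsto_youngIntegral h.lt.le h.one_lt
        (h.memHolder_div (W' p.2)) p.1.2.2).comp (tendsto_uniformSubdivision h.lt.le))
    exact Finset.measurable_sum _ fun k _ =>
      (((heval _).comp measurable_snd).div_const _).mul
        (((measurable_eval _).comp measurable_fst).sub ((measurable_eval _).comp measurable_fst))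
  have h2 : Continuous fun W : HolderSpace a b δ => pairing σ W W := by
    obtain ⟨C, _, hC⟩ := h.exists_abs_pairing_le
    have heq : (fun W : HolderSpace a b δ => pairing σ W W) = fun W =>
        (LinearMap.mkContinuous₂ (LinearMap.mk₂ ℝ (pairing σ)
          (fun W U V => by simpa using h.pairing_add_smul_left W U V 1)
          (fun c W V => by
            have := pairing_smul_right σ W V c
            rwa [pairing_comm, pairing_comm σ V W] at this)
          (fun W U V => by simpa using h.pairing_add_smul_right U V W 1)
          (fun c W V => pairing_smul_right σ V W c)) C (fun W V => hC W V)) W W := rfl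
    rw [heq]
    fun_prop
  simp_rw [logLikelihood_eq]
  exact h1.sub (((h2.comp hW').measurable.comp measurable_snd).const_mul _)

theorem pairing_self_eq (h : IsNoiseModel δ σ P₀) (W : HolderSpace a b δ) :
    pairing σ W W = ∫ x, (W x / σ x ^ 2) ^ 2 * σ x ^ 2 := by
  unfold pairing
  congr 1
  funext x
  have := (h.sq_pos x).ne'
  field_simp

theorem map_wienerIntegral_add (h : IsNoiseModel δ σ P₀) (W : HolderSpace a b δ)
    {p : (Set.Icc a b → ℝ) × (OrderPath a b γ → ℝ)} (hp : p ∈ evalPairs a b γ) :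
    P₀.map (fun ω => wienerIntegral σ W ω + p.2 ω)
      = gaussianReal 0 (∫ z, (W z / σ z ^ 2 + p.1 z) ^ 2 * σ z ^ 2).toNNReal :=
  h.law.map_youngIntegral_add h.lt h.pos h.one_lt h.continuous_sq (h.memHolder_div W)
    (h.continuous_div W) hp

theorem integral_exp_wienerIntegral_add (h : IsNoiseModel δ σ P₀) (W : HolderSpace a b δ)
    {p : (Set.Icc a b → ℝ) × (OrderPath a b γ → ℝ)} (hp : p ∈ evalPairs a b γ) :
    ∫ ω, Real.exp (wienerIntegral σ W ω + p.2 ω) ∂P₀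
      = Real.exp ((∫ z, (W z / σ z ^ 2 + p.1 z) ^ 2 * σ z ^ 2) / 2) := by
  have h1 := mgf_gaussianReal (h.map_wienerIntegral_add W hp) 1
  simp only [mgf, one_mul, one_pow, mul_one, zero_add] at h1
  rw [h1, Real.coe_toNNReal _ (integral_nonneg fun z => mul_nonneg (sq_nonneg _) (sq_nonneg _))]

theorem integral_exp_wienerIntegral (h : IsNoiseModel δ σ P₀) (W : HolderSpace a b δ) :
    ∫ ω, Real.exp (wienerIntegral σ W ω) ∂P₀ = Real.exp (pairing σ W W / 2) := by
  have h1 := h.integral_exp_wienerIntegral_add W (Submodule.zero_mem _)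
  simp only [Prod.snd_zero, Prod.fst_zero, Pi.zero_apply, add_zero] at h1
  rw [h1, h.pairing_self_eq]

theorem integrable_exp_wienerIntegral (h : IsNoiseModel δ σ P₀) (W : HolderSpace a b δ) :
    Integrable (fun ω => Real.exp (wienerIntegral σ W ω)) P₀ := by
  by_contra hn
  have h1 := h.integral_exp_wienerIntegral W
  rw [integral_undef hn] at h1
  exact (Real.exp_pos _).ne h1

theorem integral_exp_logLikelihood (h : IsNoiseModel δ σ P₀) (W : HolderSpace a b δ) :
    ∫ ω, Real.exp (logLikelihood σ W ω) ∂P₀ = 1 := by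
  simp_rw [logLikelihood_eq, sub_eq_add_neg, Real.exp_add]
  rw [integral_mul_const, h.integral_exp_wienerIntegral, ← Real.exp_add]
  ring_nf
  exact Real.exp_zero

theorem integrable_exp_logLikelihood (h : IsNoiseModel δ σ P₀) (W : HolderSpace a b δ) :
    Integrable (fun ω => Real.exp (logLikelihood σ W ω)) P₀ := by
  simp_rw [logLikelihood_eq, sub_eq_add_neg, Real.exp_add]
  exact (h.integrable_exp_wienerIntegral W).mul_const _

theorem lintegral_exp_logLikelihood (h : IsNoiseModel δ σ P₀) (W : HolderSpace a b δ) :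
    ∫⁻ ω, ENNReal.ofReal (Real.exp (logLikelihood σ W ω)) ∂P₀ = 1 := by
  rw [← ofReal_integral_eq_lintegral_ofReal (h.integrable_exp_logLikelihood W)
    (.of_forall fun _ => (Real.exp_pos _).le), h.integral_exp_logLikelihood W, ENNReal.ofReal_one]

theorem isProbabilityMeasure_flowLaw (h : IsNoiseModel δ σ P₀) (W : HolderSpace a b δ) :
    IsProbabilityMeasure (flowLaw σ P₀ W) := by
  constructor
  rw [flowLaw, withDensity_apply _ MeasurableSet.univ, setLIntegral_univ,
    h.lintegral_exp_logLikelihood]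

theorem integral_flowLaw (h : IsNoiseModel δ σ P₀) (W : HolderSpace a b δ)
    (g : OrderPath a b γ → ℝ) :
    ∫ ω, g ω ∂(flowLaw σ P₀ W) = ∫ ω, Real.exp (logLikelihood σ W ω) * g ω ∂P₀ := by
  rw [flowLaw, integral_withDensity_eq_integral_toReal_smul₀
    (h.measurable_logLikelihood W).exp.ennreal_ofReal.aemeasurable
    (.of_forall fun _ => ENNReal.ofReal_lt_top)]
  simp_rw [ENNReal.toReal_ofReal (Real.exp_pos _).le, smul_eq_mul]

theorem integrable_flowLaw_iff (h : IsNoiseModel δ σ P₀) (W : HolderSpace a b δ)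
    (g : OrderPath a b γ → ℝ) :
    Integrable g (flowLaw σ P₀ W) ↔
      Integrable (fun ω => Real.exp (logLikelihood σ W ω) * g ω) P₀ := by
  rw [flowLaw, integrable_withDensity_iff_integrable_smul₀'
    (h.measurable_logLikelihood W).exp.ennreal_ofReal.aemeasurable
    (.of_forall fun _ => ENNReal.ofReal_lt_top)]
  simp_rw [ENNReal.toReal_ofReal (Real.exp_pos _).le, smul_eq_mul]

theorem flowLaw_absolutelyContinuous (W : HolderSpace a b δ) : flowLaw σ P₀ W ≪ P₀ :=
  withDensity_absolutelyContinuous _ _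

/-- Girsanov's theorem for deterministic drifts: under the tilted law the canonical path is the
order flow with drift `W`. The Laplace transforms of linear combinations of evaluations agree. -/
theorem isOrderFlowLaw_flowLaw (h : IsNoiseModel δ σ P₀) (W : HolderSpace a b δ) :
    IsOrderFlowLaw σ W (flowLaw σ P₀ W) := by
  have := h.isProbabilityMeasure_flowLaw W
  refine isOrderFlowLaw_of_map_snd h.continuous_sq fun p hp => ?_
  set m := ∫ z, p.1 z * W z with hm
  set v := ∫ z, p.1 z ^ 2 * σ z ^ 2 with hv
  have hv0 : 0 ≤ v := integral_nonneg fun z => mul_nonneg (sq_nonneg _) (sq_nonneg _)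
  have hmgf : mgf id (gaussianReal m v.toNNReal) = mgf p.2 (flowLaw σ P₀ W) := by
    funext t
    rw [mgf_gaussianReal Measure.map_id, mgf, h.integral_flowLaw, Real.coe_toNNReal _ hv0]
    have h1 := h.integral_exp_wienerIntegral_add W (Submodule.smul_mem _ t hp)
    simp only [Prod.smul_snd, Prod.smul_fst, Pi.smul_apply, smul_eq_mul] at h1
    have h2 : ∀ z, (W z / σ z ^ 2 + t * p.1 z) ^ 2 * σ z ^ 2
        = W z / σ z ^ 2 * W z + 2 * t * (p.1 z * W z) + t ^ 2 * (p.1 z ^ 2 * σ z ^ 2) := by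
      intro z
      have := (h.sq_pos z).ne'
      generalize σ z ^ 2 = s at *
      field_simp
      ring
    have i1 := integrable_of_continuous ((h.continuous_div W).mul W.continuous)
    have i2 := (integrable_fst_mul hp W.continuous).const_mul (2 * t)
    have i3 : Integrable fun z => t ^ 2 * (p.1 z ^ 2 * σ z ^ 2) := by
      have := (integrable_fst_mul_fst_mul hp hp h.continuous_sq).const_mul (t ^ 2)
      simpa only [← pow_two] using this
    have h3 : ∫ z, (W z / σ z ^ 2 + t * p.1 z) ^ 2 * σ z ^ 2
        = pairing σ W W + 2 * t * m + t ^ 2 * v := by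
      simp_rw [h2]
      have e1 := integral_add (i1.add i2) i3
      have e2 := integral_add i1 i2
      rw [integral_const_mul] at e1 e2
      simp only [Pi.add_apply, Pi.mul_apply] at e1 e2
      rw [e1, e2]
      rfl
    rw [h3] at h1
    have h4 : ∀ ω, Real.exp (logLikelihood σ W ω) * Real.exp (t * p.2 ω)
        = Real.exp (-(1 / 2 * pairing σ W W)) * Real.exp (wienerIntegral σ W ω + t * p.2 ω) := by
      intro ω
      rw [logLikelihood_eq, ← Real.exp_add, ← Real.exp_add]
      ring_nf
    simp_rw [h4]
    rw [integral_const_mul, h1, ← Real.exp_add]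
    ring_nf
  have hc := eqOn_complexMGF_of_mgf hmgf
  rw [integrableExpSet_id_gaussianReal, interior_univ] at hc
  have := Measure.ext_of_complexMGF_eq (aemeasurable_id (μ := gaussianReal m v.toNNReal))
    (measurable_snd_of_mem_evalPairs hp).aemeasurable (funext fun z => hc (Set.mem_univ _))
  rw [← this, Measure.map_id]

end IsNoiseModel

end NoiseModel

/-! ### The Cameron–Martin shift -/

section Shift

variable {a b : ℝ} {γ δ : ℝ≥0}

theorem abs_setIntegral_Iic_sub_le {v : Set.Icc a b → ℝ} (hv : Continuous v) {C : ℝ}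
    (hC : ∀ x, |v x| ≤ C) (s t : Set.Icc a b) :
    |(∫ z in Set.Iic s, v z) - ∫ z in Set.Iic t, v z| ≤ C * |(s : ℝ) - t| := by
  wlog hst : t ≤ s generalizing s t
  · rw [abs_sub_comm, abs_sub_comm (s : ℝ)]
    exact this t s (le_of_not_ge hst)
  rw [setIntegral_Iic_sub hv hst]
  have h1 := norm_setIntegral_le_of_norm_le_const (μ := (volume : Measure (Set.Icc a b)))
    (s := Set.Ioc t s) (f := v) (C := C) (measure_lt_top _ _)
    (fun z _ => hC z)
  rw [volume_real_Ioc_Icc hst] at h1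
  rwa [abs_of_nonneg (sub_nonneg.2 (show (t : ℝ) ≤ s from hst))]

theorem memHolder_primitive (hγ : γ ≤ 1) (v : HolderSpace a b δ) :
    MemHolder γ fun t : Set.Icc a b => ∫ z in Set.Iic t, v z := by
  refine MemHolder.of_le (r := 1) ?_ hγ
  refine memHolder_of_abs_sub_le (norm_nonneg v) fun s t => ?_
  simpa using abs_setIntegral_Iic_sub_le v.continuous v.abs_apply_le_norm s t

/-- The Cameron–Martin shift `ω ↦ ω + ∫_a^· v`. -/
noncomputable def shift (hγ : γ ≤ 1) (v : HolderSpace a b δ) (ω : OrderPath a b γ) :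
    OrderPath a b γ :=
  ⟨⟨fun t => ω t + ∫ z in Set.Iic t, v z, by
    obtain ⟨C, hC⟩ := memHolder_primitive (γ := 1) le_rfl v
    exact ω.1.continuous.add (hC.continuous one_pos)⟩, by
    refine ⟨fun x hx => ?_, ω.2.2.add (memHolder_primitive hγ v)⟩
    have h1 : Set.Iic x = {x} := by
      ext y
      refine ⟨fun hy => le_antisymm hy ?_, fun hy => le_of_eq hy⟩
      exact Subtype.coe_le_coe.1 (hx.le.trans y.2.1)
    change ω x + ∫ z in Set.Iic x, v z = 0
    rw [ω.2.1 x hx, h1, setIntegral_measure_zero _ (volume_singleton_Icc _), add_zero]⟩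

theorem shift_apply (hγ : γ ≤ 1) (v : HolderSpace a b δ) (ω : OrderPath a b γ) (t : Set.Icc a b) :
    shift hγ v ω t = ω t + ∫ z in Set.Iic t, v z := rfl

theorem measurable_shift [Nonempty (Set.Icc a b)] (hγ : γ ≤ 1) (v : HolderSpace a b δ) :
    Measurable (shift hγ v) := by
  have h1 := comap_eval_eq (γ := γ) (TopologicalSpace.denseRange_denseSeq (Set.Icc a b))
  intro A hA
  obtain ⟨B, hB, rfl⟩ : MeasurableSet[MeasurableSpace.comap (fun (ω : OrderPath a b γ) (n : ℕ) =>
    ω (TopologicalSpace.denseSeq (Set.Icc a b) n)) MeasurableSpace.pi] A := h1 ▸ hA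
  have hm : Measurable fun (ω : OrderPath a b γ) (n : ℕ) =>
      shift hγ v ω (TopologicalSpace.denseSeq (Set.Icc a b) n) :=
    measurable_pi_lambda _ fun n => (measurable_eval _).add_const _
  exact hm hB

theorem snd_shift (hγ : γ ≤ 1) (v : HolderSpace a b δ)
    {p : (Set.Icc a b → ℝ) × (OrderPath a b γ → ℝ)} (hp : p ∈ evalPairs a b γ)
    (ω : OrderPath a b γ) : p.2 (shift hγ v ω) = p.2 ω + ∫ z, p.1 z * v z := by
  induction hp using Submodule.span_induction with
  | mem p hp =>
    obtain ⟨x, rfl⟩ := hp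
    dsimp only
    rw [shift_apply, ← integral_indicator measurableSet_Iic]
    congr 2
    funext z
    by_cases hz : z ∈ Set.Iic x
    · simp [Set.indicator_of_mem hz]
    · simp [Set.indicator_of_notMem hz]
  | zero => simp
  | add p q hp hq h1 h2 =>
    simp only [Prod.fst_add, Prod.snd_add, Pi.add_apply, add_mul]
    rw [integral_add (integrable_fst_mul hp v.continuous) (integrable_fst_mul hq v.continuous),
      h1, h2]
    ring
  | smul c p hp h1 =>
    simp only [Prod.smul_fst, Prod.smul_snd, Pi.smul_apply, smul_eq_mul, mul_assoc]
    rw [integral_const_mul, h1]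
    ring

namespace IsNoiseModel

variable {σ : Set.Icc a b → ℝ} {P₀ : Measure (OrderPath a b γ)}

theorem logLikelihood_shift (h : IsNoiseModel δ σ P₀) (W v : HolderSpace a b δ)
    (ω : OrderPath a b γ) :
    logLikelihood σ W (shift h.le_one v ω) = logLikelihood σ W ω + pairing σ W v := by
  have h1 := youngIntegral_add_primitive h.lt.le h.pos h.one_lt (h.memHolder_div W) ω.2.2
    (h.continuous_div W) v.continuous
  have h2 : wienerIntegral σ W (shift h.le_one v ω) = wienerIntegral σ W ω + pairing σ W v := h1
  rw [logLikelihood_eq, logLikelihood_eq, h2]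
  ring

/-- Changing the portfolio amounts to a Cameron–Martin shift of the order flow. -/
theorem flowLaw_add (h : IsNoiseModel δ σ P₀) (W v : HolderSpace a b δ) :
    flowLaw σ P₀ (W + v) = (flowLaw σ P₀ W).map (shift h.le_one v) := by
  have : Nonempty (Set.Icc a b) := ⟨⟨a, Set.left_mem_Icc.2 h.lt.le⟩⟩
  have := h.isProbabilityMeasure_flowLaw W
  have hm := measurable_shift h.le_one v
  have : IsProbabilityMeasure ((flowLaw σ P₀ W).map (shift h.le_one v)) :=
    Measure.isProbabilityMeasure_map hm.aemeasurable
  refine (h.isOrderFlowLaw_flowLaw (W + v)).unique (σ := σ) (W := (W + v : HolderSpace a b δ)) ?_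
    (W + v).continuous h.continuous_sq
  refine isOrderFlowLaw_of_map_snd h.continuous_sq fun p hp => ?_
  have hp2 := measurable_snd_of_mem_evalPairs hp
  rw [Measure.map_map hp2 hm]
  have h1 : p.2 ∘ shift h.le_one v = (fun x => x + ∫ z, p.1 z * v z) ∘ p.2 :=
    funext fun ω => snd_shift h.le_one v hp ω
  rw [h1, ← Measure.map_map (measurable_add_const _) hp2,
    (h.isOrderFlowLaw_flowLaw W).map_snd W.continuous h.continuous_sq hp,
    gaussianReal_map_add_const]
  simp only [HolderSpace.add_apply, mul_add]
  rw [integral_add (integrable_fst_mul hp W.continuous) (integrable_fst_mul hp v.continuous)]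

end IsNoiseModel

end Shift

/-! ### Exponential tilting of a probability measure -/

section Tilting

variable {S : Type*} [MeasurableSpace S] {μ : Measure S}
  {l X G : S → ℝ} {M : ℝ}

theorem exp_abs_le (x : ℝ) : Real.exp |x| ≤ Real.exp x + Real.exp (-x) := by
  rcases abs_cases x with ⟨h, _⟩ | ⟨h, _⟩ <;> rw [h] <;>
    linarith [Real.exp_pos x, Real.exp_pos (-x)]

theorem exp_add_mul_le {l x t : ℝ} (ht : |t| ≤ 1) :
    Real.exp (l + t * x) ≤ Real.exp (l + x) + Real.exp (l - x) := by
  have h1 : t * x ≤ |x| := (le_abs_self _).trans (by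
    rw [abs_mul]; exact mul_le_of_le_one_left (abs_nonneg _) ht)
  calc Real.exp (l + t * x) = Real.exp l * Real.exp (t * x) := Real.exp_add _ _
    _ ≤ Real.exp l * (Real.exp x + Real.exp (-x)) := by
        gcongr
        exact (Real.exp_le_exp.2 h1).trans (exp_abs_le x)
    _ = _ := by rw [mul_add, ← Real.exp_add, ← Real.exp_add, sub_eq_add_neg]

theorem abs_mul_exp_le {l x t : ℝ} (ht : |t| ≤ 1 / 2) :
    |x| * Real.exp (l + t * x) ≤ 2 * (Real.exp (l + x) + Real.exp (l - x)) := by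
  have h1 : t * x ≤ |x| / 2 := (le_abs_self _).trans (by
    rw [abs_mul]; nlinarith [abs_nonneg x])
  have h2 : |x| ≤ 2 * Real.exp (|x| / 2) := by linarith [Real.add_one_le_exp (|x| / 2)]
  calc |x| * Real.exp (l + t * x) ≤ (2 * Real.exp (|x| / 2)) * Real.exp (l + |x| / 2) := by
        gcongr
    _ = 2 * (Real.exp l * Real.exp |x|) := by
        rw [mul_assoc, ← Real.exp_add, ← Real.exp_add]; ring_nf
    _ ≤ 2 * (Real.exp l * (Real.exp x + Real.exp (-x))) := by
        gcongr
        exact exp_abs_le x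
    _ = _ := by rw [mul_add, ← Real.exp_add, ← Real.exp_add, sub_eq_add_neg]

theorem integrable_exp_add_mul (hl : Measurable l) (hX : Measurable X)
    (hp : Integrable (fun u => Real.exp (l u + X u)) μ)
    (hm : Integrable (fun u => Real.exp (l u - X u)) μ) {t : ℝ} (ht : |t| ≤ 1) :
    Integrable (fun u => Real.exp (l u + t * X u)) μ :=
  (hp.add hm).mono' (by fun_prop) (.of_forall fun u => by
    rw [Real.norm_eq_abs, Real.abs_exp]; exact exp_add_mul_le ht)

theorem integrable_exp_mul_self (hl : Measurable l) (hX : Measurable X)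
    (hp : Integrable (fun u => Real.exp (l u + X u)) μ)
    (hm : Integrable (fun u => Real.exp (l u - X u)) μ) {t : ℝ} (ht : |t| ≤ 1 / 2) :
    Integrable (fun u => Real.exp (l u + t * X u) * X u) μ :=
  ((hp.add hm).const_mul 2).mono' (by fun_prop) (.of_forall fun u => by
    rw [norm_mul, Real.norm_eq_abs, Real.abs_exp, mul_comm]; exact abs_mul_exp_le ht)

theorem integrable_tilted_self (hl : Measurable l) (hX : Measurable X)
    (hp : Integrable (fun u => Real.exp (l u + X u)) μ)
    (hm : Integrable (fun u => Real.exp (l u - X u)) μ) {t : ℝ} (ht : |t| ≤ 1 / 2) :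
    Integrable X (μ.tilted fun u => l u + t * X u) := by
  rw [integrable_tilted_iff (integrable_exp_add_mul hl hX hp hm (ht.trans (by norm_num)))]
  exact integrable_exp_mul_self hl hX hp hm ht

variable [IsProbabilityMeasure μ]

theorem covariance_eq_sub_of_integrable {X Y : S → ℝ} (hX : Integrable X μ) (hY : Integrable Y μ)
    (hXY : Integrable (fun u => X u * Y u) μ) :
    covariance X Y μ = ∫ u, X u * Y u ∂μ - (∫ u, X u ∂μ) * ∫ u, Y u ∂μ := by
  have h1 : ∀ u, (X u - ∫ u, X u ∂μ) * (Y u - ∫ u, Y u ∂μ)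
      = X u * Y u - (∫ u, X u ∂μ) * Y u - (X u - ∫ u, X u ∂μ) * ∫ u, Y u ∂μ := fun u => by ring
  have i1 : Integrable (fun u => (X u - ∫ u, X u ∂μ) * ∫ u, Y u ∂μ) μ :=
    (hX.sub (integrable_const _)).mul_const _
  have i2 : Integrable (fun u => X u * Y u - (∫ u, X u ∂μ) * Y u) μ := hXY.sub (hY.const_mul _)
  unfold covariance
  simp_rw [h1]
  rw [integral_sub i2 i1, integral_sub hXY (hY.const_mul _), integral_const_mul,
    integral_mul_const, integral_sub hX (integrable_const _)]
  simp

theorem abs_covariance_le (hG : Measurable G) (hM : ∀ u, |G u| ≤ M) (hX : Integrable X μ) :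
    |covariance G X μ| ≤ 2 * M * ∫ u, |X u| ∂μ := by
  have hGi : Integrable G μ := Integrable.of_bound hG.aestronglyMeasurable M (.of_forall hM)
  have h1 : Integrable (fun u => G u * X u) μ := hX.bdd_mul hG.aestronglyMeasurable (.of_forall hM)
  have h2 : |∫ u, G u * X u ∂μ| ≤ M * ∫ u, |X u| ∂μ := by
    rw [← integral_const_mul (μ := μ) M, ← Real.norm_eq_abs]
    refine norm_integral_le_of_norm_le (hX.abs.const_mul M) (.of_forall fun u => ?_)
    rw [norm_mul]
    exact mul_le_mul_of_nonneg_right (hM u) (abs_nonneg _)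
  have h3 : |∫ u, G u ∂μ| ≤ M := by
    have := norm_integral_le_of_norm_le_const (μ := μ) (f := G) (C := M) (.of_forall hM)
    simpa using this
  have h4 : |∫ u, X u ∂μ| ≤ ∫ u, |X u| ∂μ := abs_integral_le_integral_abs
  have h5 : 0 ≤ ∫ u, |X u| ∂μ := integral_nonneg fun u => abs_nonneg _
  rw [covariance_eq_sub_of_integrable hGi hX h1]
  refine (abs_sub _ _).trans ?_
  rw [abs_mul]
  have := mul_le_mul h3 h4 (abs_nonneg _) ((abs_nonneg _).trans h3)
  linarith

/-- Tilting a probability measure along `X` changes the mean of a bounded function at the rate of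
its covariance with `X`. -/
theorem hasDerivAt_integral_tilted (hl : Measurable l) (hX : Measurable X) (hG : Measurable G)
    (hM : ∀ u, |G u| ≤ M)
    (hp : Integrable (fun u => Real.exp (l u + X u)) μ)
    (hm : Integrable (fun u => Real.exp (l u - X u)) μ) {t : ℝ} (ht : |t| < 1 / 2) :
    HasDerivAt (fun r => ∫ u, G u ∂(μ.tilted fun u => l u + r * X u))
      (covariance G X (μ.tilted fun u => l u + t * X u)) t := by
  have ht1 : |t| ≤ 1 := ht.le.trans (by norm_num)
  have hderiv : ∀ H : S → ℝ, Measurable H → ∀ C : ℝ, (∀ u, |H u| ≤ C) →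
      HasDerivAt (fun r => ∫ u, Real.exp (l u + r * X u) * H u ∂μ)
        (∫ u, Real.exp (l u + t * X u) * X u * H u ∂μ) t := by
    intro H hH C hC
    refine (hasDerivAt_integral_of_dominated_loc_of_deriv_le
      (F := fun r u => Real.exp (l u + r * X u) * H u)
      (F' := fun r u => Real.exp (l u + r * X u) * X u * H u)
      (bound := fun u => 2 * (Real.exp (l u + X u) + Real.exp (l u - X u)) * C)
      (s := {r | |r| < 1 / 2}) ?_ (.of_forall fun r => by fun_prop) ?_ (by fun_prop)
      (.of_forall fun u r hr => ?_) (((hp.add hm).const_mul 2).mul_const C)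
      (.of_forall fun u r _ => ?_)).2
    · exact (isOpen_lt continuous_abs continuous_const).mem_nhds ht
    · exact (integrable_exp_add_mul hl hX hp hm ht1).mul_bdd hH.aestronglyMeasurable
        (.of_forall hC)
    · rw [norm_mul, norm_mul, Real.norm_eq_abs, Real.abs_exp, Real.norm_eq_abs,
        mul_comm (Real.exp _)]
      exact mul_le_mul (abs_mul_exp_le (le_of_lt hr)) (hC u) (norm_nonneg _) (by positivity)
    · have h1 : HasDerivAt (fun r => l u + r * X u) (X u) r := by
        simpa using ((hasDerivAt_id r).mul_const (X u)).const_add (l u)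
      exact (h1.exp).mul_const (H u)
  have hZ : ∀ r, |r| ≤ 1 → 0 < ∫ u, Real.exp (l u + r * X u) ∂μ := fun r hr =>
    integral_exp_pos (integrable_exp_add_mul hl hX hp hm hr)
  have hN := hderiv G hG M hM
  have hD := hderiv (fun _ => 1) measurable_const 1 (fun _ => by simp)
  simp only [mul_one] at hD
  have htilt : ∀ r (H : S → ℝ), ∫ u, H u ∂(μ.tilted fun u => l u + r * X u)
      = (∫ u, Real.exp (l u + r * X u) * H u ∂μ) / ∫ u, Real.exp (l u + r * X u) ∂μ := by
    intro r H
    rw [integral_tilted, ← integral_div]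
    congr 1
    funext u
    rw [smul_eq_mul]
    ring
  have hprob : IsProbabilityMeasure (μ.tilted fun u => l u + t * X u) :=
    isProbabilityMeasure_tilted (integrable_exp_add_mul hl hX hp hm ht1)
  have hXi := integrable_tilted_self hl hX hp hm ht.le
  have hGi : Integrable G (μ.tilted fun u => l u + t * X u) :=
    Integrable.of_bound hG.aestronglyMeasurable M (.of_forall hM)
  have h := hN.div hD (hZ t ht1).ne'
  simp_rw [htilt _ G]
  refine h.congr_deriv ?_
  rw [covariance_eq_sub_of_integrable hGi hXi (hXi.bdd_mul hG.aestronglyMeasurable (.of_forall hM)),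
    htilt, htilt, htilt]
  have h2 : ∫ u, Real.exp (l u + t * X u) * (G u * X u) ∂μ
      = ∫ u, Real.exp (l u + t * X u) * X u * G u ∂μ := by
    congr 1
    funext u
    ring
  rw [h2]
  have := (hZ t ht1).ne'
  field_simp

/-- The inverse of the normalizing constant is controlled by the negative exponential moment over
any set of positive measure. -/
theorem inv_integral_exp_le {f : S → ℝ} (hf : Integrable (fun u => Real.exp (f u)) μ) {K : Set S}
    (hK : 0 < μ.real K) (hfK : Integrable (fun u => Real.exp (-f u)) (μ.restrict K)) :
    (∫ u, Real.exp (f u) ∂μ)⁻¹ ≤ (μ.real K ^ 2)⁻¹ * ∫ u in K, Real.exp (-f u) ∂μ := by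
  set Z := ∫ u, Real.exp (f u) ∂μ with hZ
  set κ := μ.real K with hκ
  have hZ0 : 0 < Z := integral_exp_pos hf
  have hz : ∫ u in K, Real.exp (f u) ∂μ ≤ Z :=
    setIntegral_le_integral hf (.of_forall fun u => (Real.exp_pos _).le)
  -- the tangent line of `x ↦ x⁻¹` at `Z / κ`
  have hpt : ∀ u, 2 * (κ / Z) - (κ / Z) ^ 2 * Real.exp (f u) ≤ Real.exp (-f u) := by
    intro u
    have hx := Real.exp_pos (f u)
    rw [Real.exp_neg, ← sub_nonneg]
    have : (Real.exp (f u))⁻¹ - (2 * (κ / Z) - (κ / Z) ^ 2 * Real.exp (f u))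
        = (1 - κ / Z * Real.exp (f u)) ^ 2 * (Real.exp (f u))⁻¹ := by
      field_simp
      ring
    rw [this]
    positivity
  have hint : ∫ u in K, (2 * (κ / Z) - (κ / Z) ^ 2 * Real.exp (f u)) ∂μ
      ≤ ∫ u in K, Real.exp (-f u) ∂μ :=
    integral_mono ((integrable_const _).sub (hf.restrict.const_mul _)) hfK hpt
  rw [integral_sub (integrable_const _) (hf.restrict.const_mul _), integral_const,
    integral_const_mul, measureReal_restrict_apply_univ, smul_eq_mul, ← hκ] at hint
  have h1 : (κ / Z) ^ 2 * ∫ u in K, Real.exp (f u) ∂μ ≤ (κ / Z) ^ 2 * Z := by gcongr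
  have h2 : κ * (2 * (κ / Z)) - (κ / Z) ^ 2 * Z = κ ^ 2 * Z⁻¹ := by
    field_simp
    ring
  rw [← div_eq_inv_mul, le_div_iff₀ (by positivity)]
  linarith

/-- A bound for the first absolute moment of `X` under the tilted measures, with a free
parameter `c`. By the inequality between the arithmetic and the geometric mean, it avoids the
quotient of exponential moments. -/
theorem integral_abs_tilted_le (hl : Measurable l) (hX : Measurable X)
    (hp : Integrable (fun u => Real.exp (l u + X u)) μ)
    (hm : Integrable (fun u => Real.exp (l u - X u)) μ) {K : Set S} (hKm : MeasurableSet K)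
    (hK : 0 < μ.real K) {R : ℝ} (hR : ∀ u ∈ K, |X u| ≤ R)
    (hlK : Integrable (fun u => Real.exp (-l u)) (μ.restrict K)) {c : ℝ} (hc : 0 < c) {t : ℝ}
    (ht : |t| ≤ 1 / 2) :
    ∫ u, |X u| ∂(μ.tilted fun u => l u + t * X u)
      ≤ 2 * c * (∫ u, Real.exp (l u + X u) ∂μ + ∫ u, Real.exp (l u - X u) ∂μ)
        + 2 * c⁻¹ * ((μ.real K ^ 2)⁻¹ * (Real.exp (R / 2) * ∫ u in K, Real.exp (-l u) ∂μ)) := by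
  have ht1 : |t| ≤ 1 := ht.trans (by norm_num)
  have hi := integrable_exp_add_mul hl hX hp hm ht1
  set Z := ∫ u, Real.exp (l u + t * X u) ∂μ with hZ
  have hZ0 : 0 < Z := integral_exp_pos hi
  have hneg : ∀ u ∈ K, Real.exp (-(l u + t * X u)) ≤ Real.exp (R / 2) * Real.exp (-l u) := by
    intro u hu
    rw [← Real.exp_add]
    refine Real.exp_le_exp.2 ?_
    have h1 : -(t * X u) ≤ |t| * |X u| := by rw [← abs_mul]; exact neg_le_abs _
    have h2 := hR u hu
    nlinarith [abs_nonneg (X u), abs_nonneg t]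
  have hnegi : Integrable (fun u => Real.exp (-(l u + t * X u))) (μ.restrict K) := by
    refine (hlK.const_mul (Real.exp (R / 2))).mono' (by fun_prop) ?_
    filter_upwards [ae_restrict_mem hKm] with u hu
    rw [Real.norm_eq_abs, Real.abs_exp]
    exact hneg u hu
  have hZinv : Z⁻¹ ≤ (μ.real K ^ 2)⁻¹ * (Real.exp (R / 2) * ∫ u in K, Real.exp (-l u) ∂μ) := by
    refine (inv_integral_exp_le hi hK hnegi).trans ?_
    gcongr
    rw [← integral_const_mul]
    refine integral_mono_ae hnegi (hlK.const_mul _) ?_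
    filter_upwards [ae_restrict_mem hKm] with u hu using hneg u hu
  have hpt : ∀ u, (Real.exp (l u + t * X u) / Z) • |X u|
      ≤ 2 * c * (Real.exp (l u + X u) + Real.exp (l u - X u))
        + 2 * c⁻¹ * Z⁻¹ ^ 2 * Real.exp (l u + t * X u) := by
    intro u
    set e := Real.exp (|X u| / 4) with he
    have he2 : e ^ 2 = Real.exp (|X u| / 2) := by
      rw [he, ← Real.exp_nat_mul]
      congr 1
      push_cast
      ring
    have h1 : |X u| ≤ 4 * e := by linarith [Real.add_one_le_exp (|X u| / 4)]
    have h2 : 2 * (e * Z⁻¹) ≤ c * e ^ 2 + c⁻¹ * Z⁻¹ ^ 2 := by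
      have : c * e ^ 2 + c⁻¹ * Z⁻¹ ^ 2 - 2 * (e * Z⁻¹) = c⁻¹ * (c * e - Z⁻¹) ^ 2 := by
        field_simp
        ring
      have h3 : 0 ≤ c⁻¹ * (c * e - Z⁻¹) ^ 2 := by positivity
      linarith
    have h3 : Real.exp (l u + t * X u) * e ^ 2 ≤ Real.exp (l u + X u) + Real.exp (l u - X u) := by
      have h4 : t * X u ≤ |X u| / 2 := (le_abs_self _).trans (by
        rw [abs_mul]; nlinarith [abs_nonneg (X u)])
      rw [he2, ← Real.exp_add]
      calc Real.exp (l u + t * X u + |X u| / 2) ≤ Real.exp (l u + |X u|) :=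
            Real.exp_le_exp.2 (by linarith)
        _ = Real.exp (l u) * Real.exp |X u| := Real.exp_add _ _
        _ ≤ Real.exp (l u) * (Real.exp (X u) + Real.exp (-X u)) := by
            gcongr
            exact exp_abs_le _
        _ = _ := by rw [mul_add, ← Real.exp_add, ← Real.exp_add, sub_eq_add_neg]
    have hE := Real.exp_pos (l u + t * X u)
    calc (Real.exp (l u + t * X u) / Z) • |X u|
        = Real.exp (l u + t * X u) * Z⁻¹ * |X u| := by rw [smul_eq_mul, div_eq_mul_inv]
      _ ≤ Real.exp (l u + t * X u) * Z⁻¹ * (4 * e) := by gcongr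
      _ = 2 * Real.exp (l u + t * X u) * (2 * (e * Z⁻¹)) := by ring
      _ ≤ 2 * Real.exp (l u + t * X u) * (c * e ^ 2 + c⁻¹ * Z⁻¹ ^ 2) := by gcongr
      _ = 2 * c * (Real.exp (l u + t * X u) * e ^ 2)
          + 2 * c⁻¹ * Z⁻¹ ^ 2 * Real.exp (l u + t * X u) := by ring
      _ ≤ _ := by gcongr
  have hXi : Integrable (fun u => (Real.exp (l u + t * X u) / Z) • |X u|) μ := by
    have := (integrable_exp_mul_self hl hX hp hm ht).abs.div_const Z
    refine this.congr (.of_forall fun u => ?_)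
    simp only [abs_mul, Real.abs_exp, smul_eq_mul]
    ring
  rw [integral_tilted]
  refine (integral_mono hXi (((hp.add hm).const_mul _).add (hi.const_mul _)) hpt).trans ?_
  have e1 := integral_add ((hp.add hm).const_mul (2 * c)) (hi.const_mul (2 * c⁻¹ * Z⁻¹ ^ 2))
  have e2 := integral_add hp hm
  rw [integral_const_mul, integral_const_mul] at e1
  simp only [Pi.add_apply] at e1 e2 ⊢
  rw [e1, e2, ← hZ]
  have e3 : 2 * c⁻¹ * Z⁻¹ ^ 2 * Z = 2 * c⁻¹ * Z⁻¹ := by field_simp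
  rw [e3]
  gcongr

end Tilting

/-! ### An integrable bound for the posterior moments -/

theorem exists_measure_norm_le_pos {a b : ℝ} {δ : ℝ≥0} {S : Type*} [MeasurableSpace S]
    (W' : S → HolderSpace a b δ) (π₀ : Measure S)
    [IsProbabilityMeasure π₀] : ∃ R : ℝ, 0 < π₀.real {u | ‖W' u‖ ≤ R} := by
  by_contra! hn
  have h1 : ∀ n : ℕ, π₀ {u | ‖W' u‖ ≤ n} = 0 := fun n =>
    (measureReal_eq_zero_iff).1 (le_antisymm (hn n) measureReal_nonneg)
  have h2 : π₀ Set.univ = 0 := by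
    refine measure_mono_null (fun u _ => ?_) (measure_iUnion_null h1)
    obtain ⟨n, hn⟩ := exists_nat_ge ‖W' u‖
    exact Set.mem_iUnion.2 ⟨n, hn⟩
  simp at h2

section MomentBound

variable {a b : ℝ} {γ δ : ℝ≥0} {σ : Set.Icc a b → ℝ} {P₀ : Measure (OrderPath a b γ)}
  {S : Type*} [TopologicalSpace S] [MeasurableSpace S] [BorelSpace S]

namespace IsNoiseModel

theorem measurable_logLikelihood_right (h : IsNoiseModel δ σ P₀) {W' : S → HolderSpace a b δ}
    (hW' : Continuous W') (ω : OrderPath a b γ) : Measurable fun u => logLikelihood σ (W' u) ω := by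
  have h1 := h.measurable_logLikelihood_uncurry hW'
  exact h1.of_uncurry_left (f := fun ω u => logLikelihood σ (W' u) ω)

theorem measurable_pairing (h : IsNoiseModel δ σ P₀) {W' : S → HolderSpace a b δ}
    (hW' : Continuous W') (v : HolderSpace a b δ) : Measurable fun u => pairing σ (W' u) v :=
  ((h.continuous_pairing_left v).comp hW').measurable

theorem integrable_exp_logLikelihood_prod (h : IsNoiseModel δ σ P₀) {W' : S → HolderSpace a b δ}
    (hW' : Continuous W') (ν : Measure S) [IsFiniteMeasure ν] :
    Integrable (fun p : OrderPath a b γ × S => Real.exp (logLikelihood σ (W' p.2) p.1))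
      (P₀.prod ν) := by
  have := h.law.isProbabilityMeasure
  rw [integrable_prod_iff' (h.measurable_logLikelihood_uncurry hW').exp.aestronglyMeasurable]
  refine ⟨.of_forall fun u => h.integrable_exp_logLikelihood (W' u), ?_⟩
  simp_rw [Real.norm_eq_abs, Real.abs_exp, h.integral_exp_logLikelihood]
  exact integrable_const _

/-- Completing the square in the product of two likelihoods. -/
theorem integrable_exp_mul_exp_sub_pairing (h : IsNoiseModel δ σ P₀) {W' : S → HolderSpace a b δ}
    (hW' : Continuous W') (ν : Measure S) [IsFiniteMeasure ν] (V : HolderSpace a b δ) :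
    Integrable (fun p : OrderPath a b γ × S => Real.exp (logLikelihood σ V p.1)
      * Real.exp (logLikelihood σ (W' p.2) p.1 - pairing σ (W' p.2) V)) (P₀.prod ν) := by
  refine (h.integrable_exp_logLikelihood_prod (W' := fun u => W' u + (1 : ℝ) • V) (by fun_prop)
    ν).congr (.of_forall fun p => ?_)
  dsimp only
  rw [← Real.exp_add, h.logLikelihood_add_smul, logLikelihood_eq, logLikelihood_eq]
  ring_nf

/-- Where the belief is bounded, `e^{2ℓ(W) - ℓ(V) - ℓ(W'u)}` is a bounded multiple of the likelihood
of the portfolio `2W - V - W'u`. -/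
theorem integrable_exp_mul_exp_neg (h : IsNoiseModel δ σ P₀) {W' : S → HolderSpace a b δ}
    (hW' : Continuous W') (ν : Measure S) [IsFiniteMeasure ν] (W V : HolderSpace a b δ) (R : ℝ) :
    Integrable (fun p : OrderPath a b γ × S =>
      Real.exp (2 * logLikelihood σ W p.1 - logLikelihood σ V p.1)
        * Real.exp (-logLikelihood σ (W' p.2) p.1)) (P₀.prod (ν.restrict {u | ‖W' u‖ ≤ R})) := by
  have := h.law.isProbabilityMeasure
  obtain ⟨C, hC0, hC⟩ := h.exists_abs_pairing_le
  let X : S → HolderSpace a b δ := fun u => (W + (1 : ℝ) • W + (-1 : ℝ) • V) + (-1 : ℝ) • W' u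
  have hX : Continuous X := by fun_prop
  set N := ‖W + (1 : ℝ) • W + (-1 : ℝ) • V‖ + R with hN
  have hKm : MeasurableSet {u | ‖W' u‖ ≤ R} := (isClosed_le hW'.norm continuous_const).measurableSet
  set c := 1 / 2 * (C * N * N) - pairing σ W W + 1 / 2 * pairing σ V V + 1 / 2 * (C * R * R) with hc
  refine ((h.integrable_exp_logLikelihood_prod hX (ν.restrict {u | ‖W' u‖ ≤ R})).const_mul
    (Real.exp c)).mono' ?_ ?_
  · exact (((((h.measurable_logLikelihood W).comp measurable_fst).const_mul 2).sub
      ((h.measurable_logLikelihood V).comp measurable_fst)).exp.mul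
      (h.measurable_logLikelihood_uncurry hW').neg.exp).aestronglyMeasurable
  · filter_upwards [Measure.quasiMeasurePreserving_snd.ae (ae_restrict_mem hKm)] with p hp
    have hp' : ‖W' p.2‖ ≤ R := hp
    have hR : 0 ≤ R := (norm_nonneg _).trans hp'
    have h1 : ‖X p.2‖ ≤ N := by
      refine (norm_add_le _ _).trans ?_
      rw [norm_smul, norm_neg, norm_one, one_mul]
      exact add_le_add le_rfl hp'
    have hN0 : 0 ≤ N := (norm_nonneg _).trans h1
    have h2 : pairing σ (X p.2) (X p.2) ≤ C * N * N :=
      (le_abs_self _).trans ((hC _ _).trans (by gcongr))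
    have h3 : pairing σ (W' p.2) (W' p.2) ≤ C * R * R :=
      (le_abs_self _).trans ((hC _ _).trans (by gcongr))
    have h4 : wienerIntegral σ (X p.2) p.1 = 2 * wienerIntegral σ W p.1 - wienerIntegral σ V p.1
        - wienerIntegral σ (W' p.2) p.1 := by
      simp only [X]
      rw [h.wienerIntegral_add_smul, h.wienerIntegral_add_smul, h.wienerIntegral_add_smul]
      ring
    rw [← Real.exp_add, ← Real.exp_add, Real.norm_eq_abs, Real.abs_exp, Real.exp_le_exp,
      logLikelihood_eq, logLikelihood_eq, logLikelihood_eq, logLikelihood_eq, h4]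
    linarith

/-- The key integrability. The belief may be unbounded, yet the posterior mean of
`|∫ W'(·,u) v / σ²|`, also when the order flow is shifted along `v`, is dominated by a function that
is integrable under `P_W`. The parameter in `integral_abs_tilted_le` is chosen as
`min (e^{ℓ(v)}) (e^{ℓ(-v)}) / e^{ℓ(W)}`, which makes the two exponential moments integrable, since
`e^{ℓ(∓v)} e^{ℓ(W'u) ± ∫ W'u v / σ²} = e^{ℓ(W'u ∓ v)}`. -/
theorem exists_integrable_bound (h : IsNoiseModel δ σ P₀) {W' : S → HolderSpace a b δ}
    (hW' : Continuous W') (π₀ : Measure S) [IsProbabilityMeasure π₀] (W v : HolderSpace a b δ) :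
    ∃ D : OrderPath a b γ → ℝ, Integrable D (flowLaw σ P₀ W) ∧ ∀ᵐ ω ∂P₀,
      Integrable (fun u => Real.exp (logLikelihood σ (W' u) ω + pairing σ (W' u) v)) π₀ ∧
      Integrable (fun u => Real.exp (logLikelihood σ (W' u) ω - pairing σ (W' u) v)) π₀ ∧
      ∀ t : ℝ, |t| ≤ 1 / 2 → ∫ u, |pairing σ (W' u) v|
        ∂(π₀.tilted fun u => logLikelihood σ (W' u) ω + t * pairing σ (W' u) v) ≤ D ω := by
  have := h.law.isProbabilityMeasure
  obtain ⟨R, hR⟩ := exists_measure_norm_le_pos W' π₀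
  obtain ⟨C, hC0, hC⟩ := h.exists_abs_pairing_le
  set K := {u | ‖W' u‖ ≤ R} with hK
  have hKm : MeasurableSet K := (isClosed_le hW'.norm continuous_const).measurableSet
  have hXK : ∀ u ∈ K, |pairing σ (W' u) v| ≤ C * R * ‖v‖ := fun u hu =>
    (hC _ _).trans (by
      have : ‖W' u‖ ≤ R := hu
      gcongr)
  have hneg : ∀ u, pairing σ (W' u) ((-1 : ℝ) • v) = -pairing σ (W' u) v := fun u => by
    rw [pairing_smul_right]; ring
  have A1 := h.integrable_exp_mul_exp_sub_pairing hW' π₀ v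
  have A2 := h.integrable_exp_mul_exp_sub_pairing hW' π₀ ((-1 : ℝ) • v)
  have B1 := h.integrable_exp_mul_exp_neg hW' π₀ W v R
  have B2 := h.integrable_exp_mul_exp_neg hW' π₀ W ((-1 : ℝ) • v) R
  simp only [hneg, sub_neg_eq_add] at A2
  set q := (π₀.real K ^ 2)⁻¹ * Real.exp (C * R * ‖v‖ / 2) with hq
  have hDi := (((A1.integral_prod_left.add A2.integral_prod_left).const_mul 2).add
    ((B1.integral_prod_left.add B2.integral_prod_left).const_mul (2 * q)))
  refine ⟨fun ω => Real.exp (-logLikelihood σ W ω) * (2 * (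
      (∫ u, Real.exp (logLikelihood σ v ω)
        * Real.exp (logLikelihood σ (W' u) ω - pairing σ (W' u) v) ∂π₀)
      + ∫ u, Real.exp (logLikelihood σ ((-1 : ℝ) • v) ω)
        * Real.exp (logLikelihood σ (W' u) ω + pairing σ (W' u) v) ∂π₀)
      + 2 * q * (
      (∫ u in K, Real.exp (2 * logLikelihood σ W ω - logLikelihood σ v ω)
        * Real.exp (-logLikelihood σ (W' u) ω) ∂π₀)
      + ∫ u in K, Real.exp (2 * logLikelihood σ W ω - logLikelihood σ ((-1 : ℝ) • v) ω)
        * Real.exp (-logLikelihood σ (W' u) ω) ∂π₀)), ?_, ?_⟩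
  · rw [h.integrable_flowLaw_iff]
    refine hDi.congr (.of_forall fun ω => ?_)
    dsimp only [Pi.add_apply]
    rw [Real.exp_neg, mul_inv_cancel_left₀ (Real.exp_ne_zero _)]
  · filter_upwards [A1.prod_right_ae, A2.prod_right_ae, B1.prod_right_ae] with ω h1 h2 h3
    have hl := h.measurable_logLikelihood_right hW' ω
    have hX := h.measurable_pairing hW' v
    have hdiv : ∀ (c : ℝ) (f : S → ℝ) (ν : Measure S),
        Integrable (fun u => Real.exp c * f u) ν → Integrable f ν := by
      intro c f ν hf
      refine (hf.const_mul (Real.exp (-c))).congr (.of_forall fun u => ?_)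
      dsimp only
      rw [← mul_assoc, ← Real.exp_add, neg_add_cancel, Real.exp_zero, one_mul]
    have hm := hdiv _ _ _ h1
    have hp := hdiv _ _ _ h2
    have hlK := hdiv _ _ _ h3
    refine ⟨hp, hm, fun t ht => ?_⟩
    simp only [integral_const_mul]
    set e1 := Real.exp (logLikelihood σ v ω) with he1
    set e2 := Real.exp (logLikelihood σ ((-1 : ℝ) • v) ω) with he2
    set e := Real.exp (logLikelihood σ W ω) with he
    have e1p : 0 < e1 := Real.exp_pos _
    have e2p : 0 < e2 := Real.exp_pos _
    have ep : 0 < e := Real.exp_pos _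
    have hρ : 0 < min e1 e2 := lt_min e1p e2p
    have hmain := integral_abs_tilted_le hl hX hp hm hKm hR hXK hlK (c := min e1 e2 / e)
      (by positivity) ht
    refine hmain.trans ?_
    set Ap := ∫ u, Real.exp (logLikelihood σ (W' u) ω + pairing σ (W' u) v) ∂π₀
    set Am := ∫ u, Real.exp (logLikelihood σ (W' u) ω - pairing σ (W' u) v) ∂π₀
    set Q := ∫ u in K, Real.exp (-logLikelihood σ (W' u) ω) ∂π₀
    have hAp : 0 ≤ Ap := integral_nonneg fun u => (Real.exp_pos _).le
    have hAm : 0 ≤ Am := integral_nonneg fun u => (Real.exp_pos _).le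
    have hQ : 0 ≤ Q := integral_nonneg fun u => (Real.exp_pos _).le
    have hq0 : 0 ≤ q := by positivity
    rw [Real.exp_sub, Real.exp_sub, Real.exp_neg, ← he, ← he1, ← he2,
      show Real.exp (2 * logLikelihood σ W ω) = e ^ 2 by
        rw [he, ← Real.exp_nat_mul]; norm_num]
    have hinv : (min e1 e2)⁻¹ ≤ e1⁻¹ + e2⁻¹ := by
      rcases min_choice e1 e2 with h | h <;> rw [h]
      · exact le_add_of_nonneg_right (by positivity)
      · exact le_add_of_nonneg_left (by positivity)
    have t1 : min e1 e2 / e * (Ap + Am) ≤ e⁻¹ * (e1 * Am + e2 * Ap) := by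
      rw [div_eq_inv_mul, mul_assoc]
      gcongr
      have := mul_le_mul_of_nonneg_right (min_le_right e1 e2) hAp
      have := mul_le_mul_of_nonneg_right (min_le_left e1 e2) hAm
      linarith
    have t2 : (min e1 e2 / e)⁻¹ * (q * Q) ≤ e⁻¹ * (q * (e ^ 2 / e1 * Q + e ^ 2 / e2 * Q)) := by
      have : e⁻¹ * (q * (e ^ 2 / e1 * Q + e ^ 2 / e2 * Q)) = e * (e1⁻¹ + e2⁻¹) * (q * Q) := by
        field_simp
      rw [this, inv_div, div_eq_mul_inv]
      gcongr
    calc _ = 2 * (min e1 e2 / e * (Ap + Am)) + 2 * ((min e1 e2 / e)⁻¹ * (q * Q)) := by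
          rw [hq]; ring
      _ ≤ 2 * (e⁻¹ * (e1 * Am + e2 * Ap))
          + 2 * (e⁻¹ * (q * (e ^ 2 / e1 * Q + e ^ 2 / e2 * Q))) := by gcongr
      _ = _ := by ring

end IsNoiseModel

end MomentBound

/-! ### Payoffs of portfolios under a law of the signal -/

section Payoff

variable {T S : Type*} [MeasurableSpace T] [MeasurableSpace S] {lam : Measure T}
  {η : T → S → ℝ} {M : ℝ≥0} {V : T → ℝ} {C : ℝ}

/-- The payoff `∫ η(x, u) V(x) dx` of the portfolio `V` under the signal `u`. -/
noncomputable def portfolioPayoff (lam : Measure T) (η : T → S → ℝ) (V : T → ℝ) (u : S) : ℝ :=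
  ∫ x, η x u * V x ∂lam

theorem integrable_section (hη_meas : Measurable (Function.uncurry η))
    (hη : ∀ u, ∫⁻ x, ‖η x u‖ₑ ∂lam ≤ M) (u : S) : Integrable (fun x => η x u) lam :=
  ⟨(hη_meas.of_uncurry_right).aestronglyMeasurable, (hη u).trans_lt ENNReal.coe_lt_top⟩

theorem integral_abs_section_le (hη_meas : Measurable (Function.uncurry η))
    (hη : ∀ u, ∫⁻ x, ‖η x u‖ₑ ∂lam ≤ M) (u : S) : ∫ x, |η x u| ∂lam ≤ M := by
  have h1 := integral_norm_eq_lintegral_enorm (integrable_section hη_meas hη u).1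
  simp only [Real.norm_eq_abs] at h1
  rw [h1]
  exact ENNReal.toReal_le_coe_of_le_coe (hη u)

theorem integrable_section_mul (hη_meas : Measurable (Function.uncurry η))
    (hη : ∀ u, ∫⁻ x, ‖η x u‖ₑ ∂lam ≤ M) (hV : Measurable V) (hC : ∀ x, |V x| ≤ C) (u : S) :
    Integrable (fun x => η x u * V x) lam :=
  (integrable_section hη_meas hη u).mul_bdd hV.aestronglyMeasurable (.of_forall hC)

theorem abs_portfolioPayoff_le (hη_meas : Measurable (Function.uncurry η))
    (hη : ∀ u, ∫⁻ x, ‖η x u‖ₑ ∂lam ≤ M) (hC0 : 0 ≤ C) (hC : ∀ x, |V x| ≤ C) (u : S) :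
    |portfolioPayoff lam η V u| ≤ M * C := by
  have h1 : |portfolioPayoff lam η V u| ≤ ∫ x, |η x u| * C ∂lam := by
    rw [← Real.norm_eq_abs]
    refine norm_integral_le_of_norm_le ((integrable_section hη_meas hη u).abs.mul_const C)
      (.of_forall fun x => ?_)
    rw [norm_mul]
    exact mul_le_mul_of_nonneg_left (hC x) (abs_nonneg _)
  rw [integral_mul_const] at h1
  exact h1.trans (mul_le_mul_of_nonneg_right (integral_abs_section_le hη_meas hη u) hC0)

theorem measurable_portfolioPayoff [SFinite lam] (hη_meas : Measurable (Function.uncurry η))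
    (hV : Measurable V) : Measurable (portfolioPayoff lam η V) := by
  have h1 : Measurable fun p : S × T => η p.2 p.1 * V p.2 :=
    (hη_meas.comp measurable_swap).mul (hV.comp measurable_snd)
  exact (h1.stronglyMeasurable.integral_prod_right (ν := lam)).measurable

theorem portfolioPayoff_add_smul (hη_meas : Measurable (Function.uncurry η))
    (hη : ∀ u, ∫⁻ x, ‖η x u‖ₑ ∂lam ≤ M) {U : T → ℝ} {C' : ℝ} (hV : Measurable V)
    (hC : ∀ x, |V x| ≤ C) (hU : Measurable U) (hC' : ∀ x, |U x| ≤ C') (t : ℝ) (u : S) :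
    portfolioPayoff lam η (fun x => V x + t * U x) u
      = portfolioPayoff lam η V u + t * portfolioPayoff lam η U u := by
  unfold portfolioPayoff
  rw [← integral_const_mul, ← integral_add (integrable_section_mul hη_meas hη hV hC u)
    ((integrable_section_mul hη_meas hη hU hC' u).const_mul t)]
  congr 1 with x
  ring

variable [SFinite lam] {ν : Measure S} [SFinite ν] {g : S → ℝ}

theorem integrable_payoff_mul (hη_meas : Measurable (Function.uncurry η))
    (hη : ∀ u, ∫⁻ x, ‖η x u‖ₑ ∂lam ≤ M) (hgm : Measurable g) (hg : Integrable g ν) :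
    Integrable (fun p : T × S => η p.1 p.2 * g p.2) (lam.prod ν) := by
  have hm : Measurable fun p : T × S => η p.1 p.2 * g p.2 :=
    hη_meas.mul (hgm.comp measurable_snd)
  rw [integrable_prod_iff' hm.aestronglyMeasurable]
  refine ⟨.of_forall fun u => (integrable_section hη_meas hη u).mul_const (g u), ?_⟩
  refine (hg.abs.const_mul (M : ℝ)).mono'
    (hm.norm.stronglyMeasurable.integral_prod_left (μ := lam)).aestronglyMeasurable
    (.of_forall fun u => ?_)
  rw [Real.norm_of_nonneg (integral_nonneg fun _ => norm_nonneg _)]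
  simp only [norm_mul, Real.norm_eq_abs]
  rw [integral_mul_const]
  exact mul_le_mul_of_nonneg_right (integral_abs_section_le hη_meas hη u) (abs_nonneg _)

theorem integral_abs_integral_payoff_mul_le (hη_meas : Measurable (Function.uncurry η))
    (hη : ∀ u, ∫⁻ x, ‖η x u‖ₑ ∂lam ≤ M) (hgm : Measurable g) (hg : Integrable g ν) :
    ∫ x, |∫ u, η x u * g u ∂ν| ∂lam ≤ M * ∫ u, |g u| ∂ν := by
  have hi := integrable_payoff_mul hη_meas hη hgm hg
  calc ∫ x, |∫ u, η x u * g u ∂ν| ∂lam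
      ≤ ∫ x, ∫ u, |η x u * g u| ∂ν ∂lam :=
        integral_mono hi.integral_prod_left.abs hi.norm.integral_prod_left
          fun x => abs_integral_le_integral_abs
    _ = ∫ u, ∫ x, |η x u * g u| ∂lam ∂ν := integral_integral_swap hi.norm
    _ ≤ ∫ u, M * |g u| ∂ν := by
        refine integral_mono hi.norm.integral_prod_right (hg.abs.const_mul _) fun u => ?_
        simp only [abs_mul]
        rw [integral_mul_const]
        exact mul_le_mul_of_nonneg_right (integral_abs_section_le hη_meas hη u) (abs_nonneg _)
    _ = _ := integral_const_mul _ _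

theorem integral_mul_integral_payoff_mul (hη_meas : Measurable (Function.uncurry η))
    (hη : ∀ u, ∫⁻ x, ‖η x u‖ₑ ∂lam ≤ M) (hgm : Measurable g) (hg : Integrable g ν)
    (hV : Measurable V) (hC : ∀ x, |V x| ≤ C) :
    ∫ x, V x * ∫ u, η x u * g u ∂ν ∂lam = ∫ u, portfolioPayoff lam η V u * g u ∂ν := by
  have hi := integrable_payoff_mul hη_meas hη hgm hg
  have hj : Integrable (fun p : T × S => V p.1 * (η p.1 p.2 * g p.2)) (lam.prod ν) :=
    hi.bdd_mul (hV.comp measurable_fst).aestronglyMeasurable (.of_forall fun p => hC p.1)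
  simp only [← integral_const_mul]
  rw [integral_integral_swap hj]
  congr 1 with u
  rw [portfolioPayoff, ← integral_mul_const]
  congr 1 with x
  ring

variable [IsProbabilityMeasure ν]

theorem ae_integrable_payoff (hη_meas : Measurable (Function.uncurry η))
    (hη : ∀ u, ∫⁻ x, ‖η x u‖ₑ ∂lam ≤ M) : ∀ᵐ x ∂lam, Integrable (η x) ν := by
  simpa using (integrable_payoff_mul (ν := ν) (g := fun _ => 1) hη_meas hη measurable_const
    (integrable_const _)).prod_right_ae

theorem ae_covariance_payoff_eq (hη_meas : Measurable (Function.uncurry η))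
    (hη : ∀ u, ∫⁻ x, ‖η x u‖ₑ ∂lam ≤ M) (hgm : Measurable g) (hg : Integrable g ν) :
    ∀ᵐ x ∂lam, covariance (η x) g ν = ∫ u, η x u * (g u - ∫ u', g u' ∂ν) ∂ν := by
  filter_upwards [ae_integrable_payoff (ν := ν) hη_meas hη,
    (integrable_payoff_mul (ν := ν) hη_meas hη hgm hg).prod_right_ae] with x h1 h2
  rw [covariance_eq_sub_of_integrable h1 hg h2]
  simp only [mul_sub]
  rw [integral_sub h2 (h1.mul_const _), integral_mul_const]

theorem integrable_covariance_payoff (hη_meas : Measurable (Function.uncurry η))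
    (hη : ∀ u, ∫⁻ x, ‖η x u‖ₑ ∂lam ≤ M) (hgm : Measurable g) (hg : Integrable g ν) :
    Integrable (fun x => covariance (η x) g ν) lam :=
  (integrable_payoff_mul (ν := ν) hη_meas hη (hgm.sub_const (∫ u', g u' ∂ν))
    (hg.sub (integrable_const _))).integral_prod_left.congr
    ((ae_covariance_payoff_eq hη_meas hη hgm hg).mono fun _ h => h.symm)

theorem integral_abs_covariance_payoff_le (hη_meas : Measurable (Function.uncurry η))
    (hη : ∀ u, ∫⁻ x, ‖η x u‖ₑ ∂lam ≤ M) (hgm : Measurable g) (hg : Integrable g ν) :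
    ∫ x, |covariance (η x) g ν| ∂lam ≤ 2 * M * ∫ u, |g u| ∂ν := by
  have hg' : Integrable (fun u => g u - ∫ u', g u' ∂ν) ν := hg.sub (integrable_const _)
  rw [integral_congr_ae ((ae_covariance_payoff_eq hη_meas hη hgm hg).mono fun _ h =>
    congrArg abs h)]
  refine (integral_abs_integral_payoff_mul_le hη_meas hη (hgm.sub_const _) hg').trans ?_
  have h1 : ∫ u, |g u - ∫ u', g u' ∂ν| ∂ν ≤ ∫ u, (|g u| + |∫ u', g u' ∂ν|) ∂ν :=
    integral_mono hg'.abs (hg.abs.add (integrable_const _)) fun u => abs_sub _ _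
  rw [integral_add hg.abs (integrable_const _)] at h1
  have h2 : |∫ u', g u' ∂ν| ≤ ∫ u, |g u| ∂ν := abs_integral_le_integral_abs
  simp only [integral_const, probReal_univ, one_smul] at h1
  have := mul_le_mul_of_nonneg_left (h1.trans (add_le_add le_rfl h2)) M.2
  refine this.trans (le_of_eq ?_)
  change (M : ℝ) * _ = _
  ring

theorem integral_mul_covariance_payoff (hη_meas : Measurable (Function.uncurry η))
    (hη : ∀ u, ∫⁻ x, ‖η x u‖ₑ ∂lam ≤ M) (hgm : Measurable g) (hg : Integrable g ν)
    (hV : Measurable V) (hC0 : 0 ≤ C) (hC : ∀ x, |V x| ≤ C) :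
    ∫ x, V x * covariance (η x) g ν ∂lam = covariance (portfolioPayoff lam η V) g ν := by
  have hg' : Integrable (fun u => g u - ∫ u', g u' ∂ν) ν := hg.sub (integrable_const _)
  have hPm := measurable_portfolioPayoff (lam := lam) hη_meas hV
  have hPb := abs_portfolioPayoff_le hη_meas hη hC0 hC
  have hP : Integrable (portfolioPayoff lam η V) ν :=
    Integrable.of_bound hPm.aestronglyMeasurable _ (.of_forall hPb)
  have hPg : Integrable (fun u => portfolioPayoff lam η V u * g u) ν :=
    hg.bdd_mul hPm.aestronglyMeasurable (.of_forall hPb)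
  rw [integral_congr_ae ((ae_covariance_payoff_eq hη_meas hη hgm hg).mono fun x h =>
    congrArg (V x * ·) h), integral_mul_integral_payoff_mul hη_meas hη (hgm.sub_const _) hg' hV hC,
    covariance_eq_sub_of_integrable hP hg hPg]
  simp only [mul_sub]
  rw [integral_sub hPg (hP.mul_const _), integral_mul_const]

end Payoff

/-! ### Measurability and integrability of prices and price impact -/

section KernelCovariance

variable {A S : Type*} [MeasurableSpace A] [MeasurableSpace S]

theorem stronglyMeasurable_covariance_kernel (κ : Kernel A S) [IsSFiniteKernel κ] {f g : A → S → ℝ}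
    (hf : Measurable (Function.uncurry f)) (hg : Measurable (Function.uncurry g)) :
    StronglyMeasurable fun p => covariance (f p) (g p) (κ p) := by
  have h1 : Measurable fun p => ∫ u, f p u ∂κ p :=
    (hf.stronglyMeasurable.integral_kernel_prod_right).measurable
  have h2 : Measurable fun p => ∫ u, g p u ∂κ p :=
    (hg.stronglyMeasurable.integral_kernel_prod_right).measurable
  have h3 : Measurable (Function.uncurry fun p u =>
      (f p u - ∫ u, f p u ∂κ p) * (g p u - ∫ u, g p u ∂κ p)) :=
    (hf.sub (h1.comp measurable_fst)).mul (hg.sub (h2.comp measurable_fst))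
  exact h3.stronglyMeasurable.integral_kernel_prod_right

end KernelCovariance

section PosteriorShift

variable {a b : ℝ} {γ δ : ℝ≥0} {σ : Set.Icc a b → ℝ} {P₀ : Measure (OrderPath a b γ)}
  {S : Type*} [MeasurableSpace S] (π₀ : Measure S) (W' : S → HolderSpace a b δ)

theorem IsNoiseModel.signalPosterior_shift (h : IsNoiseModel δ σ P₀) (v : HolderSpace a b δ) (t : ℝ)
    (ω : OrderPath a b γ) :
    signalPosterior σ π₀ W' (shift h.le_one (t • v) ω)
      = π₀.tilted fun u => logLikelihood σ (W' u) ω + t * pairing σ (W' u) v := by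
  simp only [signalPosterior, h.logLikelihood_shift, pairing_smul_right]

theorem tilted_zero_mul_pairing (σ : Set.Icc a b → ℝ) (v : HolderSpace a b δ)
    (ω : OrderPath a b γ) :
    (π₀.tilted fun u => logLikelihood σ (W' u) ω + 0 * pairing σ (W' u) v)
      = signalPosterior σ π₀ W' ω := by
  simp only [zero_mul, add_zero, signalPosterior]

end PosteriorShift

section Posterior

variable {a b : ℝ} {γ δ : ℝ≥0} {σ : Set.Icc a b → ℝ} {P₀ : Measure (OrderPath a b γ)}
  {S : Type*} [TopologicalSpace S] [MeasurableSpace S] [BorelSpace S]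
  {W' : S → HolderSpace a b δ} (π₀ : Measure S) [IsProbabilityMeasure π₀]
  {η : Set.Icc a b → S → ℝ} {M : ℝ≥0}

namespace IsNoiseModel

/-- The posterior as a kernel from order flows to signals. It is the zero measure at the order flows
whose likelihood is not integrable under the prior, by the convention of `Measure.tilted`. -/
noncomputable def posteriorKernel (h : IsNoiseModel δ σ P₀) (hW' : Continuous W') :
    Kernel (OrderPath a b γ) S where
  toFun := signalPosterior σ π₀ W'
  measurable' := by
    refine Measure.measurable_of_measurable_coe _ fun s hs => ?_
    have h1 : Measurable (Function.uncurry fun (ω : OrderPath a b γ) u =>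
        Real.exp (logLikelihood σ (W' u) ω)) :=
      (h.measurable_logLikelihood_uncurry hW').exp
    have h2 : Measurable fun ω : OrderPath a b γ => ∫ u, Real.exp (logLikelihood σ (W' u) ω) ∂π₀ :=
      (h1.stronglyMeasurable.integral_prod_right (ν := π₀)).measurable
    simp only [signalPosterior, tilted_apply]
    exact ((h1.div (h2.comp measurable_fst)).ennreal_ofReal).lintegral_prod_right'
      (ν := π₀.restrict s)

instance (h : IsNoiseModel δ σ P₀) (hW' : Continuous W') :
    IsFiniteKernel (h.posteriorKernel π₀ hW') :=
  ⟨⟨1, ENNReal.one_lt_top, fun ω =>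
    (prob_le_one : (π₀.tilted fun u => logLikelihood σ (W' u) ω) Set.univ ≤ 1)⟩⟩

variable {π₀}

theorem stronglyMeasurable_integral_posterior (h : IsNoiseModel δ σ P₀) (hW' : Continuous W')
    {G : S → ℝ} (hG : Measurable G) :
    StronglyMeasurable fun ω : OrderPath a b γ => ∫ u, G u ∂signalPosterior σ π₀ W' ω :=
  StronglyMeasurable.integral_kernel_prod_right (κ := h.posteriorKernel π₀ hW')
    (f := fun _ u => G u) (hG.comp measurable_snd).stronglyMeasurable

theorem stronglyMeasurable_covariance_posterior (h : IsNoiseModel δ σ P₀) (hW' : Continuous W')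
    {G X : S → ℝ} (hG : Measurable G) (hX : Measurable X) :
    StronglyMeasurable fun ω : OrderPath a b γ => covariance G X (signalPosterior σ π₀ W' ω) :=
  stronglyMeasurable_covariance_kernel (h.posteriorKernel π₀ hW')
    (f := fun _ u => G u) (g := fun _ u => X u) (hG.comp measurable_snd) (hX.comp measurable_snd)

theorem stronglyMeasurable_price (h : IsNoiseModel δ σ P₀) (hW' : Continuous W')
    (hη_meas : Measurable (Function.uncurry η)) :
    StronglyMeasurable fun p : OrderPath a b γ × Set.Icc a b => price σ π₀ η W' p.2 p.1 :=
  StronglyMeasurable.integral_kernel_prod_right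
    (κ := (h.posteriorKernel π₀ hW').comap Prod.fst measurable_fst) (f := fun p u => η p.2 u)
    (hη_meas.comp ((measurable_snd.comp measurable_fst).prodMk measurable_snd)).stronglyMeasurable

theorem stronglyMeasurable_priceImpact (h : IsNoiseModel δ σ P₀) (hW' : Continuous W')
    (hη_meas : Measurable (Function.uncurry η)) (v : HolderSpace a b δ) :
    StronglyMeasurable fun p : OrderPath a b γ × Set.Icc a b =>
      priceImpact σ π₀ η W' v p.2 p.1 :=
  stronglyMeasurable_covariance_kernel
    ((h.posteriorKernel π₀ hW').comap Prod.fst measurable_fst) (f := fun p u => η p.2 u)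
    (g := fun _ u => pairing σ (W' u) v)
    (hη_meas.comp ((measurable_snd.comp measurable_fst).prodMk measurable_snd))
    ((h.measurable_pairing hW' v).comp measurable_snd)

theorem ae_isProbabilityMeasure_signalPosterior (h : IsNoiseModel δ σ P₀) (hW' : Continuous W')
    (W : HolderSpace a b δ) :
    ∀ᵐ ω ∂(flowLaw σ P₀ W), IsProbabilityMeasure (signalPosterior σ π₀ W' ω) := by
  have := h.law.isProbabilityMeasure
  have h1 := (h.integrable_exp_logLikelihood_prod hW' π₀).prod_right_ae
  exact (h1.filter_mono (flowLaw_absolutelyContinuous W).ae_le).mono fun ω hω =>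
    isProbabilityMeasure_tilted hω

/-- The posterior mean of `|∫ W'(·, u) v / σ²|` is finite and dominated by an integrable function of
the order flow. -/
theorem exists_integrable_bound_posterior (h : IsNoiseModel δ σ P₀) (hW' : Continuous W')
    (W v : HolderSpace a b δ) :
    ∃ D : OrderPath a b γ → ℝ, Integrable D (flowLaw σ P₀ W) ∧ ∀ᵐ ω ∂(flowLaw σ P₀ W),
      Integrable (fun u => pairing σ (W' u) v) (signalPosterior σ π₀ W' ω) ∧
      ∫ u, |pairing σ (W' u) v| ∂signalPosterior σ π₀ W' ω ≤ D ω := by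
  obtain ⟨D, hD, hb⟩ := h.exists_integrable_bound hW' π₀ W v
  refine ⟨D, hD, (hb.filter_mono (flowLaw_absolutelyContinuous W).ae_le).mono fun ω hω => ?_⟩
  rw [← tilted_zero_mul_pairing π₀ W' σ v ω]
  exact ⟨integrable_tilted_self (h.measurable_logLikelihood_right hW' ω)
    (h.measurable_pairing hW' v) hω.1 hω.2.1 (by norm_num), hω.2.2 0 (by norm_num)⟩

theorem integrable_price (h : IsNoiseModel δ σ P₀) (hW' : Continuous W')
    (hη_meas : Measurable (Function.uncurry η)) (hη : ∀ u, ∫⁻ x, ‖η x u‖ₑ ≤ M)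
    (W : HolderSpace a b δ) :
    Integrable (fun p : OrderPath a b γ × Set.Icc a b => price σ π₀ η W' p.2 p.1)
      ((flowLaw σ P₀ W).prod volume) := by
  have := h.isProbabilityMeasure_flowLaw W
  have hm := h.stronglyMeasurable_price (π₀ := π₀) hW' hη_meas
  have hp := h.ae_isProbabilityMeasure_signalPosterior (π₀ := π₀) hW' W
  rw [integrable_prod_iff hm.aestronglyMeasurable]
  constructor
  · filter_upwards [hp] with ω hω
    have := (integrable_payoff_mul (ν := signalPosterior σ π₀ W' ω) (g := fun _ => 1) hη_meas hη
      measurable_const (integrable_const _)).integral_prod_left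
    simpa only [price, mul_one] using this
  · refine Integrable.of_bound (C := M) hm.norm.integral_prod_right.aestronglyMeasurable ?_
    filter_upwards [hp] with ω hω
    rw [Real.norm_of_nonneg (integral_nonneg fun _ => norm_nonneg _)]
    have := integral_abs_integral_payoff_mul_le (ν := signalPosterior σ π₀ W' ω) (g := fun _ => 1)
      hη_meas hη measurable_const (integrable_const _)
    simpa [price] using this

theorem integrable_priceImpact (h : IsNoiseModel δ σ P₀) (hW' : Continuous W')
    (hη_meas : Measurable (Function.uncurry η)) (hη : ∀ u, ∫⁻ x, ‖η x u‖ₑ ≤ M)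
    (W v : HolderSpace a b δ) :
    Integrable (fun p : OrderPath a b γ × Set.Icc a b => priceImpact σ π₀ η W' v p.2 p.1)
      ((flowLaw σ P₀ W).prod volume) := by
  have := h.isProbabilityMeasure_flowLaw W
  have hm := h.stronglyMeasurable_priceImpact (π₀ := π₀) hW' hη_meas v
  have hp := h.ae_isProbabilityMeasure_signalPosterior (π₀ := π₀) hW' W
  have hX := h.measurable_pairing hW' v
  obtain ⟨D, hD, hb⟩ := h.exists_integrable_bound_posterior (π₀ := π₀) hW' W v
  rw [integrable_prod_iff hm.aestronglyMeasurable]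
  constructor
  · filter_upwards [hp, hb] with ω hω h1
    exact integrable_covariance_payoff hη_meas hη hX h1.1
  · refine (hD.const_mul (2 * M)).mono' hm.norm.integral_prod_right.aestronglyMeasurable ?_
    filter_upwards [hp, hb] with ω hω h1
    rw [Real.norm_of_nonneg (integral_nonneg fun _ => norm_nonneg _)]
    exact (integral_abs_covariance_payoff_le hη_meas hη hX h1.1).trans
      (mul_le_mul_of_nonneg_left h1.2 (by positivity))

theorem ae_integrable_posterior (h : IsNoiseModel δ σ P₀) (hW' : Continuous W')
    (hη_meas : Measurable (Function.uncurry η)) (hη : ∀ u, ∫⁻ x, ‖η x u‖ₑ ≤ M)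
    (W v : HolderSpace a b δ) :
    ∀ᵐ p ∂((flowLaw σ P₀ W).prod (volume : Measure (Set.Icc a b))),
      Integrable (η p.2) (signalPosterior σ π₀ W' p.1) ∧
      Integrable (fun u => pairing σ (W' u) v) (signalPosterior σ π₀ W' p.1) ∧
      Integrable (fun u => η p.2 u * pairing σ (W' u) v) (signalPosterior σ π₀ W' p.1) := by
  have := h.isProbabilityMeasure_flowLaw W
  have hX := h.measurable_pairing hW' v
  obtain ⟨D, hD, hb⟩ := h.exists_integrable_bound_posterior (π₀ := π₀) hW' W v
  let κ : Kernel (OrderPath a b γ × Set.Icc a b) S :=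
    (h.posteriorKernel π₀ hW').comap Prod.fst measurable_fst
  have hη' : Measurable fun q : (OrderPath a b γ × Set.Icc a b) × S => η q.1.2 q.2 :=
    hη_meas.comp ((measurable_snd.comp measurable_fst).prodMk measurable_snd)
  have hX' : Measurable fun q : (OrderPath a b γ × Set.Icc a b) × S => pairing σ (W' q.2) v :=
    hX.comp measurable_snd
  have m1 := measurableSet_kernel_integrable (κ := κ) (f := fun p u => η p.2 u)
    hη'.stronglyMeasurable
  have m2 := measurableSet_kernel_integrable (κ := κ) (f := fun _ u => pairing σ (W' u) v)
    hX'.stronglyMeasurable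
  have m3 := measurableSet_kernel_integrable (κ := κ)
    (f := fun p u => η p.2 u * pairing σ (W' u) v) (hη'.mul hX').stronglyMeasurable
  refine (Measure.ae_prod_iff_ae_ae (m1.inter (m2.inter m3))).2 ?_
  filter_upwards [h.ae_isProbabilityMeasure_signalPosterior (π₀ := π₀) hW' W, hb] with ω hω h1
  filter_upwards [ae_integrable_payoff (ν := signalPosterior σ π₀ W' ω) hη_meas hη,
    (integrable_payoff_mul hη_meas hη hX h1.1).prod_right_ae] with x h2 h3
  exact ⟨h2, h1.1, h3⟩

end IsNoiseModel

end Posterior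

/-! ### The derivative of the expected profit -/

section FirstOrderCondition

variable {a b : ℝ} {γ δ : ℝ≥0} {σ : Set.Icc a b → ℝ} {P₀ : Measure (OrderPath a b γ)}
  {S : Type*} [TopologicalSpace S] [MeasurableSpace S] [BorelSpace S]
  {W' : S → HolderSpace a b δ} {π₀ : Measure S} [IsProbabilityMeasure π₀]
  {η : Set.Icc a b → S → ℝ} {M : ℝ≥0}

namespace IsNoiseModel

theorem integrable_integral_posterior (h : IsNoiseModel δ σ P₀) (hW' : Continuous W')
    {G : S → ℝ} {K : ℝ} (hG : Measurable G) (hK : ∀ u, |G u| ≤ K) (W : HolderSpace a b δ) :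
    Integrable (fun ω => ∫ u, G u ∂signalPosterior σ π₀ W' ω) (flowLaw σ P₀ W) := by
  have := h.isProbabilityMeasure_flowLaw W
  refine Integrable.of_bound (C := K)
    (h.stronglyMeasurable_integral_posterior hW' hG).aestronglyMeasurable ?_
  filter_upwards [h.ae_isProbabilityMeasure_signalPosterior (π₀ := π₀) hW' W] with ω hω
  simpa using norm_integral_le_of_norm_le_const (μ := signalPosterior σ π₀ W' ω) (f := G)
    (.of_forall hK)

/-- The expected profit is the expected payoff minus the expected cost, where the cost averages the
portfolio payoff over the posterior. -/
theorem expectedProfit_eq (h : IsNoiseModel δ σ P₀) (hW' : Continuous W')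
    (hη_meas : Measurable (Function.uncurry η)) (hη : ∀ u, ∫⁻ x, ‖η x u‖ₑ ≤ M) (s : S)
    (V : HolderSpace a b δ) :
    expectedProfit σ P₀ π₀ η W' s V = portfolioPayoff volume η V s
      - ∫ ω, ∫ u, portfolioPayoff volume η V u ∂signalPosterior σ π₀ W' ω ∂flowLaw σ P₀ V := by
  have := h.isProbabilityMeasure_flowLaw V
  have hVm := V.continuous.measurable
  have hGm : Measurable (portfolioPayoff volume η V) := measurable_portfolioPayoff hη_meas hVm
  have hGb := abs_portfolioPayoff_le hη_meas hη (norm_nonneg V) V.abs_apply_le_norm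
  have h1 : ∀ᵐ ω ∂flowLaw σ P₀ V, ∫ x, (η x s - price σ π₀ η W' x ω) * V x
      = portfolioPayoff volume η V s
        - ∫ u, portfolioPayoff volume η V u ∂signalPosterior σ π₀ W' ω := by
    filter_upwards [h.ae_isProbabilityMeasure_signalPosterior (π₀ := π₀) hW' V] with ω hω
    have i1 := integrable_section_mul hη_meas hη hVm V.abs_apply_le_norm s
    have i2 : Integrable (fun x => price σ π₀ η W' x ω) volume := by
      simpa only [price, mul_one] using (integrable_payoff_mul (ν := signalPosterior σ π₀ W' ω)
        (g := fun _ => 1) hη_meas hη measurable_const (integrable_const _)).integral_prod_left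
    have i3 : Integrable (fun x => price σ π₀ η W' x ω * V x) volume :=
      i2.mul_bdd hVm.aestronglyMeasurable (.of_forall V.abs_apply_le_norm)
    simp only [sub_mul]
    rw [integral_sub i1 i3]
    congr 1
    have := integral_mul_integral_payoff_mul (ν := signalPosterior σ π₀ W' ω) (g := fun _ => 1)
      hη_meas hη measurable_const (integrable_const _) hVm V.abs_apply_le_norm
    simp only [mul_one] at this
    rw [← this]
    congr 1 with x
    exact mul_comm _ _
  rw [expectedProfit, integral_congr_ae h1, integral_sub (integrable_const _)
    (h.integrable_integral_posterior hW' hGm hGb V)]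
  simp

/-- Trading `t • v` on top of `W` affects the market maker's inference by tilting the posterior
along `∫ W'(·, u) v / σ²`. -/
theorem integral_posterior_flowLaw_add (h : IsNoiseModel δ σ P₀) (hW' : Continuous W')
    {G : S → ℝ} (hG : Measurable G) (W v : HolderSpace a b δ) (t : ℝ) :
    ∫ ω, ∫ u, G u ∂signalPosterior σ π₀ W' ω ∂flowLaw σ P₀ (W + t • v)
      = ∫ ω, ∫ u, G u ∂(π₀.tilted fun u => logLikelihood σ (W' u) ω + t * pairing σ (W' u) v)
        ∂flowLaw σ P₀ W := by
  have : Nonempty (Set.Icc a b) := ⟨⟨a, Set.left_mem_Icc.2 h.lt.le⟩⟩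
  rw [h.flowLaw_add, integral_map (measurable_shift h.le_one _).aemeasurable
    (h.stronglyMeasurable_integral_posterior hW' hG).aestronglyMeasurable]
  simp only [h.signalPosterior_shift]

theorem hasDerivAt_integral_posterior (h : IsNoiseModel δ σ P₀) (hW' : Continuous W')
    {G : S → ℝ} {K : ℝ} (hG : Measurable G) (hK : ∀ u, |G u| ≤ K) (W v : HolderSpace a b δ) :
    HasDerivAt (fun t : ℝ =>
        ∫ ω, ∫ u, G u ∂signalPosterior σ π₀ W' ω ∂flowLaw σ P₀ (W + t • v))
      (∫ ω, covariance G (fun u => pairing σ (W' u) v) (signalPosterior σ π₀ W' ω)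
        ∂flowLaw σ P₀ W) 0 := by
  have : Nonempty (Set.Icc a b) := ⟨⟨a, Set.left_mem_Icc.2 h.lt.le⟩⟩
  have hX := h.measurable_pairing hW' v
  obtain ⟨u₀⟩ : Nonempty S := π₀.nonempty_of_neZero
  have hK0 : 0 ≤ K := (abs_nonneg _).trans (hK u₀)
  obtain ⟨D, hD, hb⟩ := h.exists_integrable_bound hW' π₀ W v
  have hac : flowLaw σ P₀ W ≪ P₀ := flowLaw_absolutelyContinuous W
  replace hb := hb.filter_mono hac.ae_le
  simp only [h.integral_posterior_flowLaw_add hW' hG]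
  have key := (hasDerivAt_integral_of_dominated_loc_of_deriv_le (μ := flowLaw σ P₀ W)
    (F := fun t ω => ∫ u, G u
      ∂(π₀.tilted fun u => logLikelihood σ (W' u) ω + t * pairing σ (W' u) v))
    (F' := fun t ω => covariance G (fun u => pairing σ (W' u) v)
      (π₀.tilted fun u => logLikelihood σ (W' u) ω + t * pairing σ (W' u) v))
    (bound := fun ω => 2 * K * D ω) (s := {t | |t| < 1 / 2}) (x₀ := (0 : ℝ))
    ?_ (.of_forall fun t => ?_) ?_ ?_ ?_ (hD.const_mul _) ?_).2
  · simpa only [tilted_zero_mul_pairing] using key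
  · exact (isOpen_lt continuous_abs continuous_const).mem_nhds (by norm_num)
  · simp only [← h.signalPosterior_shift]
    exact ((h.stronglyMeasurable_integral_posterior hW' hG).comp_measurable
      (measurable_shift h.le_one _)).aestronglyMeasurable
  · simp only [tilted_zero_mul_pairing]
    exact h.integrable_integral_posterior hW' hG hK W
  · simp only [tilted_zero_mul_pairing]
    exact (h.stronglyMeasurable_covariance_posterior hW' hG hX).aestronglyMeasurable
  · filter_upwards [hb] with ω hω t ht
    have ht' : |t| ≤ 1 / 2 := le_of_lt ht
    have hl := h.measurable_logLikelihood_right hW' ω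
    have := isProbabilityMeasure_tilted (integrable_exp_add_mul hl hX hω.1 hω.2.1
      (ht'.trans (by norm_num)))
    exact (abs_covariance_le hG hK (integrable_tilted_self hl hX hω.1 hω.2.1 ht')).trans
      (mul_le_mul_of_nonneg_left (hω.2.2 t ht') (by positivity))
  · filter_upwards [hb] with ω hω t ht
    exact hasDerivAt_integral_tilted (h.measurable_logLikelihood_right hW' ω) hX hG hK hω.1 hω.2.1
      ht

theorem arrowDebreuTerm_eq (h : IsNoiseModel δ σ P₀) (hW' : Continuous W')
    (hη_meas : Measurable (Function.uncurry η)) (hη : ∀ u, ∫⁻ x, ‖η x u‖ₑ ≤ M)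
    (W v : HolderSpace a b δ) :
    arrowDebreuTerm σ P₀ π₀ η W' W v
      = ∫ ω, ∫ u, portfolioPayoff volume η v u ∂signalPosterior σ π₀ W' ω ∂flowLaw σ P₀ W := by
  have := h.isProbabilityMeasure_flowLaw W
  have hvm := v.continuous.measurable
  have hi : Integrable (fun p : OrderPath a b γ × Set.Icc a b =>
      price σ π₀ η W' p.2 p.1 * v p.2) ((flowLaw σ P₀ W).prod volume) :=
    (h.integrable_price hW' hη_meas hη W).mul_bdd
      (hvm.comp measurable_snd).aestronglyMeasurable (.of_forall fun p => v.abs_apply_le_norm p.2)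
  unfold arrowDebreuTerm expectedPrice
  simp only [← integral_mul_const]
  rw [← integral_integral_swap hi]
  refine integral_congr_ae ?_
  filter_upwards [h.ae_isProbabilityMeasure_signalPosterior (π₀ := π₀) hW' W] with ω hω
  have := integral_mul_integral_payoff_mul (ν := signalPosterior σ π₀ W' ω) (g := fun _ => 1)
    hη_meas hη measurable_const (integrable_const _) hvm v.abs_apply_le_norm
  simp only [mul_one] at this
  rw [← this]
  congr 1 with x
  exact mul_comm _ _

theorem priceImpactTerm_eq (h : IsNoiseModel δ σ P₀) (hW' : Continuous W')
    (hη_meas : Measurable (Function.uncurry η)) (hη : ∀ u, ∫⁻ x, ‖η x u‖ₑ ≤ M)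
    (W v : HolderSpace a b δ) :
    priceImpactTerm σ P₀ π₀ η W' W v
      = ∫ ω, covariance (portfolioPayoff volume η W) (fun u => pairing σ (W' u) v)
          (signalPosterior σ π₀ W' ω) ∂flowLaw σ P₀ W := by
  have := h.isProbabilityMeasure_flowLaw W
  have hWm := W.continuous.measurable
  obtain ⟨D, hD, hb⟩ := h.exists_integrable_bound_posterior (π₀ := π₀) hW' W v
  have hi : Integrable (fun p : OrderPath a b γ × Set.Icc a b =>
      W p.2 * priceImpact σ π₀ η W' v p.2 p.1) ((flowLaw σ P₀ W).prod volume) :=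
    (h.integrable_priceImpact hW' hη_meas hη W v).bdd_mul
      (hWm.comp measurable_snd).aestronglyMeasurable (.of_forall fun p => W.abs_apply_le_norm p.2)
  unfold priceImpactTerm
  simp only [← integral_const_mul]
  rw [← integral_integral_swap hi]
  refine integral_congr_ae ?_
  filter_upwards [h.ae_isProbabilityMeasure_signalPosterior (π₀ := π₀) hW' W, hb] with ω hω h1
  exact integral_mul_covariance_payoff hη_meas hη (h.measurable_pairing hW' v) h1.1 hWm
    (norm_nonneg W) W.abs_apply_le_norm

theorem hasLineDerivAt_expectedProfit (h : IsNoiseModel δ σ P₀) (hW' : Continuous W')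
    (hη_meas : Measurable (Function.uncurry η)) (hη : ∀ u, ∫⁻ x, ‖η x u‖ₑ ≤ M) (s : S)
    (W v : HolderSpace a b δ) :
    HasLineDerivAt ℝ (expectedProfit σ P₀ π₀ η W' s)
      (payoffTerm η s v - arrowDebreuTerm σ P₀ π₀ η W' W v - priceImpactTerm σ P₀ π₀ η W' W v)
      W v := by
  have hWm := W.continuous.measurable
  have hvm := v.continuous.measurable
  set GW : S → ℝ := portfolioPayoff volume η W with hGW
  set Gv : S → ℝ := portfolioPayoff volume η v with hGv
  have mW : Measurable GW := measurable_portfolioPayoff hη_meas hWm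
  have mv : Measurable Gv := measurable_portfolioPayoff hη_meas hvm
  have bW := abs_portfolioPayoff_le hη_meas hη (norm_nonneg W) W.abs_apply_le_norm
  have bv := abs_portfolioPayoff_le hη_meas hη (norm_nonneg v) v.abs_apply_le_norm
  have dW := h.hasDerivAt_integral_posterior (π₀ := π₀) hW' mW bW W v
  have dv := h.hasDerivAt_integral_posterior (π₀ := π₀) hW' mv bv W v
  have hG : ∀ (t : ℝ) u, portfolioPayoff volume η (W + t • v : HolderSpace a b δ) u
      = GW u + t * Gv u := fun t u => by
    rw [hGW, hGv, ← portfolioPayoff_add_smul hη_meas hη hWm W.abs_apply_le_norm hvm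
      v.abs_apply_le_norm]
    rfl
  have hJ : ∀ t : ℝ, expectedProfit σ P₀ π₀ η W' s (W + t • v) = GW s + t * Gv s
      - (∫ ω, ∫ u, GW u ∂signalPosterior σ π₀ W' ω ∂flowLaw σ P₀ (W + t • v)
        + t * ∫ ω, ∫ u, Gv u ∂signalPosterior σ π₀ W' ω ∂flowLaw σ P₀ (W + t • v)) := by
    intro t
    rw [h.expectedProfit_eq hW' hη_meas hη, hG]
    congr 1
    rw [← integral_const_mul, ← integral_add (h.integrable_integral_posterior hW' mW bW _)
      ((h.integrable_integral_posterior hW' mv bv _).const_mul t)]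
    refine integral_congr_ae ?_
    filter_upwards [h.ae_isProbabilityMeasure_signalPosterior (π₀ := π₀) hW' (W + t • v)] with ω hω
    simp only [hG]
    rw [integral_add (Integrable.of_bound mW.aestronglyMeasurable _ (.of_forall bW))
      ((Integrable.of_bound mv.aestronglyMeasurable _ (.of_forall bv)).const_mul t),
      integral_const_mul]
  unfold HasLineDerivAt
  simp only [hJ]
  have d := (((hasDerivAt_id (0 : ℝ)).mul_const (Gv s)).const_add (GW s)).sub
    (dW.add ((hasDerivAt_id (0 : ℝ)).mul dv))
  have hpay : payoffTerm η s v = Gv s := by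
    simp only [payoffTerm, hGv, portfolioPayoff, mul_comm]
  refine d.congr_deriv ?_
  rw [hpay, h.arrowDebreuTerm_eq hW' hη_meas hη, h.priceImpactTerm_eq hW' hη_meas hη]
  simp only [id_eq, zero_smul, add_zero, zero_mul, one_mul]
  ring

end IsNoiseModel

end FirstOrderCondition

end InsiderTrading

theorem mainTheorem4
    -- the index set `[a,b]` and the Hölder exponents
    {a b : ℝ} (hab : a < b) {γ δ : ℝ≥0} (hγ : (1 : ℝ) / 3 < γ ∧ (γ : ℝ) < 1 / 2)
    (hδ : 0 < δ ∧ δ ≤ 1) (hγδ : 1 < δ + γ)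
    -- the signal space and the prior
    {S : Type*} [TopologicalSpace S] [MeasurableSpace S] [BorelSpace S]
    (π₀ : Measure S) [IsProbabilityMeasure π₀]
    -- the payoffs `η(x,s)`, for example probability densities `η(·,s)`
    (η : Set.Icc a b → S → ℝ) (hη_meas : Measurable (Function.uncurry η))
    (hη : ∃ M : ℝ≥0, ∀ s, ∫⁻ x, ‖η x s‖ₑ ≤ M)
    -- the noise-trading intensity and the law of the noise `σ dB`
    (σ : Set.Icc a b → ℝ) (hσ : MemHolder δ (fun x => σ x ^ 2)) (hσ_pos : ∀ x, 0 < σ x ^ 2)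
    (P₀ : Measure (OrderPath a b γ)) (hP₀ : IsOrderFlowLaw σ 0 P₀)
    -- the market maker's belief and the signal that the insider observes
    (W' : S → HolderSpace a b δ) (hW' : Continuous W') (s : S) :
    -- all the expectations and integrals below are meaningful
    (∀ W : HolderSpace a b δ,
      IsOrderFlowLaw σ W (flowLaw σ P₀ W) ∧
      (∀ᵐ ω ∂(flowLaw σ P₀ W), IsProbabilityMeasure (signalPosterior σ π₀ W' ω)) ∧
      Integrable (fun p : OrderPath a b γ × Set.Icc a b => η p.2 s - price σ π₀ η W' p.2 p.1)
        ((flowLaw σ P₀ W).prod volume) ∧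
      ∀ v : HolderSpace a b δ,
        (∀ᵐ p ∂((flowLaw σ P₀ W).prod (volume : Measure (Set.Icc a b))),
          Integrable (η p.2) (signalPosterior σ π₀ W' p.1) ∧
          Integrable (insiderProjection σ W' v) (signalPosterior σ π₀ W' p.1) ∧
          Integrable (fun u => η p.2 u * insiderProjection σ W' v u) (signalPosterior σ π₀ W' p.1)) ∧
        Integrable (fun p : OrderPath a b γ × Set.Icc a b => priceImpact σ π₀ η W' v p.2 p.1)
          ((flowLaw σ P₀ W).prod volume)) ∧
    -- Gâteaux differentiability and the decomposition of the derivative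
    (∀ W v : HolderSpace a b δ,
      HasLineDerivAt ℝ (expectedProfit σ P₀ π₀ η W' s)
        (payoffTerm η s v - arrowDebreuTerm σ P₀ π₀ η W' W v
          - priceImpactTerm σ P₀ π₀ η W' W v) W v) ∧
    -- the first-order condition at an optimum
    (∀ W : HolderSpace a b δ,
      (∀ V : HolderSpace a b δ,
        expectedProfit σ P₀ π₀ η W' s V ≤ expectedProfit σ P₀ π₀ η W' s W) →
      ∀ v : HolderSpace a b δ,
        lineDeriv ℝ (expectedProfit σ P₀ π₀ η W' s) W v = 0 ∧
        payoffTerm η s v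
          = arrowDebreuTerm σ P₀ π₀ η W' W v + priceImpactTerm σ P₀ π₀ η W' W v) := by
  obtain ⟨M, hM⟩ := hη
  have hγ1 : γ ≤ 1 := by
    rw [← NNReal.coe_le_coe]
    exact (hγ.2.trans (by norm_num)).le
  have h : IsNoiseModel δ σ P₀ :=
    { lt := hab, pos := hδ.1, le_one := hγ1, one_lt := hγδ, memHolder := hσ, sq_pos := hσ_pos,
      law := hP₀ }
  have hderiv := h.hasLineDerivAt_expectedProfit (π₀ := π₀) hW' hη_meas hM s
  refine ⟨fun W => ⟨h.isOrderFlowLaw_flowLaw W, h.ae_isProbabilityMeasure_signalPosterior hW' W,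
    ?_, fun v => ⟨h.ae_integrable_posterior hW' hη_meas hM W v,
      h.integrable_priceImpact hW' hη_meas hM W v⟩⟩, hderiv, fun W hW v => ?_⟩
  · have := h.isProbabilityMeasure_flowLaw W
    have := isFiniteMeasure_volume_Icc (a := a) (b := b)
    exact ((integrable_section hη_meas hM s).comp_snd _).sub (h.integrable_price hW' hη_meas hM W)
  · have h0 : payoffTerm η s v - arrowDebreuTerm σ P₀ π₀ η W' W v
        - priceImpactTerm σ P₀ π₀ η W' W v = 0 := by
      refine IsLocalMax.hasDerivAt_eq_zero (.of_forall fun t => ?_) (hderiv W v)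
      simpa using hW (W + t • v)
    exact ⟨(hderiv W v).lineDeriv.trans h0, by linarith⟩
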